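/- Let $q_0>0$, let $\mathbf q_\pm\in\mathbb C^2$ satisfy $\|\mathbf q_\pm\|=q_0$ (no parallelism or orthogonality relation between $\mathbf q_+$ and $\mathbf q_-$ is required; the non-parallel case is $|\mathbf q_+^\dagger\mathbf q_-|<q_0^2$), let $\sigma,t\in\mathbb R$, and let $\mathbf q(\cdot,t):\mathbb R\to\mathbb C^2$ be twice continuously differentiable with $\mathbf q(x,t)\to\mathbf q_\pm$ as $x\to\pm\infty$, $\mathbf q(\cdot,t)-\mathbf q_\pm\in L^1(\mathbb R^\pm)$ and $\mathbf q_x(\cdot,t),\mathbf q_{xx}(\cdot,t)\in L^1(\mathbb R)$ (for instance the time-$t$ profile of such a solution of the defocusing-defocusing coupled Hirota equations). For $\mathbf v=(v_1,v_2)^T$ put $\mathbf v^\perp=(v_2,-v_1)^\dagger$. Put $$k=\tfrac12\Big(z+\tfrac{q_0^2}{z}\Big),\quad \lambda=\tfrac12\Big(z-\tfrac{q_0^2}{z}\Big),\quad \widehat\rho=\frac{z^2}{z^2-q_0^2},\quad \mathbf J=\operatorname{diag}(1,-1,-1),\quad \mathbf Q=\begin{pmatrix}0&-\mathbf q^\dagger\\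 \mathbf q&\mathbf 0\end{pmatrix},$$ $$\widehat{\mathbf Y}_\pm(z)=\begin{pmatrix}\mathrm i\widehat\rho&0&\widehat\rho\, q_0/z\\ \mathrm i\widehat\rho\,\mathbf q_\pm/z&\mathbf q_\pm^\perp/q_0&\widehat\rho\,\mathbf q_\pm/q_0\end{pmatrix},\qquad \mathbf\Delta=\operatorname{diag}(\delta_1,\delta_2,-\delta_1),$$ $\delta_1=\lambda x+2\lambda[k+\sigma(3k^2-\lambda^2)]t$, $\delta_2=-kx-(\lambda^2+k^2+4\sigma k^3)t$. For $z\in\mathbb R\setminus\{0,\pm q_0\}$ let $\psi_\pm(z;x,t)$ be the Jost solutions: $\psi_x=(\mathrm ik\mathbf J+\mathrm i\mathbf Q)\psi$ and $\psi_\pm=\widehat{\mathbf Y}_\pm\mathrm e^{\mathrm i\mathbf\Delta}+o(1)$ as $x\to\pm\infty$. Then the scattering matrix $\mathbf H(z)=(h_{ij}(z))$ with $\psi_+(z)=\psi_-(z)\mathbf H(z)$ exists, is unique, and is invertible; let $\mathbf S=(s_{ij})=\mathbf H^{-1}$. As $z\to\infty$, $z\in\mathbb R$: $$s_{11}=1+O(1/z),\quad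 s_{22}=\frac{\mathbf q_-^\dagger\mathbf q_+}{q_0^2}+O(1/z),\quad s_{33}=\frac{\mathbf q_+^\dagger\mathbf q_-}{q_0^2}+O(1/z),$$ $$s_{32}=\frac{\mathbf q_+^\dagger\mathbf q_-^\perp}{q_0^2}+O(1/z),\quad s_{23}=\frac{(\mathbf q_+^\perp)^\dagger\mathbf q_-}{q_0^2}+O(1/z),\quad s_{21},s_{31}=O(1/z^2),\quad s_{12},s_{13}=O(1/z),$$ $$h_{11}=1+O(1/z),\quad h_{22}=\frac{\mathbf q_+^\dagger\mathbf q_-}{q_0^2}+O(1/z),\quad h_{33}=\frac{\mathbf q_-^\dagger\mathbf q_+}{q_0^2}+O(1/z),$$ $$h_{32}=\frac{\mathbf q_-^\dagger\mathbf q_+^\perp}{q_0^2}+O(1/z),\quad h_{23}=\frac{(\mathbf q_-^\perp)^\dagger\mathbf q_+}{q_0^2}+O(1/z),\quad h_{21},h_{31}=O(1/z^2),\quad h_{12},h_{13}=O(1/z).$$ As $z\to0$, $z\in\mathbb R$: $$s_{11}=\frac{\mathbf q_+^\dagger\mathbf q_-}{q_0^2}+O(z),\quad s_{22}=\frac{\mathbf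 q_-^\dagger\mathbf q_+}{q_0^2}+O(z),\quad s_{33}=1+O(z),\quad s_{12}=\frac{\mathrm i\,\mathbf q_+^\dagger\mathbf q_-^\perp}{q_0z}+O(1),\quad s_{32}=O(1),$$ $$h_{11}=\frac{\mathbf q_-^\dagger\mathbf q_+}{q_0^2}+O(z),\quad h_{22}=\frac{\mathbf q_+^\dagger\mathbf q_-}{q_0^2}+O(z),\quad h_{33}=1+O(z),\quad h_{12}=\frac{\mathrm i\,\mathbf q_-^\dagger\mathbf q_+^\perp}{q_0z}+O(1),\quad h_{32}=O(1),$$ and $s_{21},s_{31},s_{13},s_{23},h_{21},h_{31},h_{13},h_{23}=O(z)$. Moreover $s_{11},h_{33}$ extend holomorphically to $\operatorname{Im}z<0$ and $s_{33},h_{11}$ to $\operatorname{Im}z>0$, continuously up to $\mathbb R\setminus\{0,\pm q_0\}$, and their asymptotics above, at $\infty$ and at $0$, hold for $z$ in the corresponding closed half-plane. -/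

import Mathlib

open Complex Filter Topology Asymptotics Bornology
open scoped ComplexConjugate

namespace CoupledHirota

/-- Two-component vectors with the Hermitian (Euclidean) norm; `inner ℂ u v` is `u† v`. -/
abbrev V2 := EuclideanSpace ℂ (Fin 2)

/-- `3 × 3` complex matrices. -/
abbrev M3 := Matrix (Fin 3) (Fin 3) ℂ

/-- The orthogonal vector `v^⊥ = (v₂, -v₁)†`. -/
noncomputable def perp (v : V2) : V2 := !₂[conj (v 1), -conj (v 0)]

/-- `J = diag (1, -1, -1)`. -/
def matJ : M3 := Matrix.diagonal ![1, -1, -1]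

/-- `Q = (0, -q†; q, 0)`. -/
noncomputable def matQ (v : V2) : M3 :=
  !![0, -conj (v 0), -conj (v 1);
     v 0, 0, 0;
     v 1, 0, 0]

/-- `k(z) = (z + q₀² / z) / 2`. -/
noncomputable def kz (q₀ : ℝ) (z : ℂ) : ℂ := (z + (q₀ : ℂ) ^ 2 / z) / 2

/-- `λ(z) = (z - q₀² / z) / 2`. -/
noncomputable def lamz (q₀ : ℝ) (z : ℂ) : ℂ := (z - (q₀ : ℂ) ^ 2 / z) / 2

/-- `ρ̂(z) = z² / (z² - q₀²)`. -/
noncomputable def rho (q₀ : ℝ) (z : ℂ) : ℂ := z ^ 2 / (z ^ 2 - (q₀ : ℂ) ^ 2)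

/-- The matrix `X = i k J + i Q` of the spatial part of the Lax pair. -/
noncomputable def laxX (q₀ : ℝ) (z : ℂ) (v : V2) : M3 :=
  (I * kz q₀ z) • matJ + I • matQ v

/-- The eigenvector matrix `Ŷ(z)` for the boundary value `v`. -/
noncomputable def matY (q₀ : ℝ) (v : V2) (z : ℂ) : M3 :=
  !![rho q₀ z * I, 0, rho q₀ z * (q₀ / z);
     rho q₀ z * (I * v 0 / z), perp v 0 / q₀, rho q₀ z * (v 0 / q₀);
     rho q₀ z * (I * v 1 / z), perp v 1 / q₀, rho q₀ z * (v 1 / q₀)]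

/-- `δ₁ = λ x + 2 λ [k + σ (3 k² - λ²)] t`. -/
noncomputable def delta1 (q₀ σ : ℝ) (z : ℂ) (x t : ℝ) : ℂ :=
  lamz q₀ z * x
    + 2 * lamz q₀ z * (kz q₀ z + σ * (3 * kz q₀ z ^ 2 - lamz q₀ z ^ 2)) * t

/-- `δ₂ = - k x - (λ² + k² + 4 σ k³) t`. -/
noncomputable def delta2 (q₀ σ : ℝ) (z : ℂ) (x t : ℝ) : ℂ :=
  -kz q₀ z * x - (lamz q₀ z ^ 2 + kz q₀ z ^ 2 + 4 * σ * kz q₀ z ^ 3) * t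

/-- `exp (i Δ)` with `Δ = diag (δ₁, δ₂, -δ₁)`. -/
noncomputable def expDelta (q₀ σ : ℝ) (z : ℂ) (x t : ℝ) : M3 :=
  Matrix.diagonal
    ![exp (I * delta1 q₀ σ z x t), exp (I * delta2 q₀ σ z x t), exp (-I * delta1 q₀ σ z x t)]

/-- `x ↦ ψ x` is the Jost eigenfunction at time `t` and spectral parameter `z` for the potential
`u = q(·, t)`, normalized at the end `l` of the line (`atTop` or `atBot`), where the potential
tends to `v`: it solves `ψ_x = X ψ` and `ψ = Ŷ exp (i Δ) + o(1)` along `l`. -/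
def IsJost (q₀ σ t : ℝ) (u : ℝ → V2) (v : V2) (l : Filter ℝ) (z : ℝ) (ψ : ℝ → M3) : Prop :=
  (∀ x i j, HasDerivAt (fun y => ψ y i j) ((laxX q₀ z (u x) * ψ x) i j) x) ∧
  Tendsto (fun x => ψ x - matY q₀ v z * expDelta q₀ σ z x t) l (𝓝 0)

/-- `H` is the scattering matrix at `z`, that is `ψ₊ = ψ₋ H` for the Jost eigenfunctions. -/
def IsScatteringMatrix (q₀ σ t : ℝ) (u : ℝ → V2) (vm vp : V2) (z : ℝ) (H : M3) : Prop :=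
  ∃ ψm ψp : ℝ → M3, IsJost q₀ σ t u vm atBot z ψm ∧ IsJost q₀ σ t u vp atTop z ψp ∧
    ∀ x, ψp x = ψm x * H

/-- The potential `u = q(·, t)` has the boundary values `vm`, `vp` at `-∞`, `+∞` and is
sufficiently regular: `u - vm ∈ L¹(-∞, 0)`, `u - vp ∈ L¹(0, ∞)`, `u` is twice continuously
differentiable, and `u'`, `u''` are integrable. -/
structure IsPotential (u : ℝ → V2) (vm vp : V2) : Prop where
  tendsto_left : Tendsto u atBot (𝓝 vm)
  tendsto_right : Tendsto u atTop (𝓝 vp)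
  integrable_left : MeasureTheory.IntegrableOn (fun x => u x - vm) (Set.Iio 0)
  integrable_right : MeasureTheory.IntegrableOn (fun x => u x - vp) (Set.Ioi 0)
  contDiff : ContDiff ℝ 2 u
  integrable_deriv : MeasureTheory.Integrable (deriv u)
  integrable_deriv2 : MeasureTheory.Integrable (deriv (deriv u))

/-- `F` is the continuation of the function `f` on the real line (minus `0, ± q₀`) to the closed
half-plane `D` (minus the same points): it is holomorphic inside, continuous up to the real line,
and agrees with `f` there. Such an `F` is unique on `D` minus these points. -/
def IsContinuation (q₀ : ℝ) (D : Set ℂ) (f : ℝ → ℂ) (F : ℂ → ℂ) : Prop :=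
  DifferentiableOn ℂ F (interior D) ∧
  ContinuousOn F (D \ {0, (q₀ : ℂ), -(q₀ : ℂ)}) ∧
  ∀ z : ℝ, z ≠ 0 → z ≠ q₀ → z ≠ -q₀ → F z = f z

/-- The closed upper half-plane. -/
def upperHalf : Set ℂ := {z | 0 ≤ z.im}

/-- The closed lower half-plane. -/
def lowerHalf : Set ℂ := {z | z.im ≤ 0}

/-- `f(z) = a + O(1/z)` as `z → ∞` and `f(z) = b + O(z)` as `z → 0`, both inside `D`. -/
def LimitsIn (D : Set ℂ) (f : ℂ → ℂ) (a b : ℂ) : Prop :=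
  ((fun z => f z - a) =O[cobounded ℂ ⊓ 𝓟 D] fun z => z⁻¹) ∧
  ((fun z => f z - b) =O[𝓝[D \ {0}] 0] fun z => z)

end CoupledHirota

namespace CoupledHirota

open MeasureTheory Set
open scoped Matrix

/-! ### Integrals depending on a parameter -/

/-! Everything reduces to one kind of object: a column of a Jost solution normalised at `+∞`,
stripped of its exponential and evaluated at `x = 0`. Conjugating by `Ŷ` diagonalises the limiting
system and leaves an integrable perturbation. The column then solves a Volterra equation on `(x, ∞)`
whose kernels are bounded by one when the exponent differences have the right sign. This holds for
the first column in the closed upper half-plane, for the third in the lower, and for the second on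
the real line only. Picard iteration in an exponential weight (`VolterraData.exists_solution`,
`exists_columns`) gives existence, continuity and holomorphy in `z`.

The Volterra equation is useless for large `z`, since its perturbation does not decay in `z`.
Instead the original system is diagonalised up to terms of order `1/z²` by explicit corrections
built from `q` and `q_x`; this uses two derivatives of `q`. The remaining forcing is integrable in
`x` and `O(1/z)`. A first pass bounds the column, the forcing being absorbed for large `z`. A second
pass feeds in what is already known to be small and gains another factor `1/z`
(`norm_diagonal_sub_le`, `exists_column_estimate`, `exists_column_bound`).

For real `z` the form `ψ† J ψ'` does not depend on `x`, and on each Jost matrix it equals `C =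
diag(ρ̂, -1, -ρ̂)`. Hence Jost solutions are unique, `H = C⁻¹ ψ₋† J ψ₊` may be read at `x = 0`, and
`S = C⁻¹ H† C`. The left Jost solution is a reflection of a right one for the potential `-q̄(-x)` at
time `-t`. The conjugation in the reflection undoes the one in the form, so the entries of `H`
become bilinear pairings of right-normalised columns (`scat_reflect_apply`); that is why the two
corner entries continue holomorphically. In the pairing of a first column with another one the terms
of order `1/z` cancel exactly, whence `O(1/z²)`. The time phases cancel on the diagonal, have
modulus one elsewhere, and in the lower block differ from one by `O(1/z)` (`delta_add_delta`).

Finally `z ↦ q₀²/z` preserves `k`, reverses `λ`, and so exchanges the first and third columns. It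
turns each statement at infinity into one at the origin (`InftyBound.isBigO_zero`); the factor
`q₀/z` that it introduces produces the pole of the `12` entries. The same symmetry transfers the
continuation of `h₁₁` to `h₃₃`, and `S` follows by Schwarz reflection. -/

theorem differentiableOn_integral_of_dominated {α : Type*} [MeasurableSpace α] {μ : Measure α}
    {F : ℂ → α → ℂ} {U : Set ℂ} (hU : IsOpen U)
    (hmeas : ∀ z ∈ U, AEStronglyMeasurable (F z) μ)
    (hdiff : ∀ y, DifferentiableOn ℂ (fun z => F z y) U)
    (hbound : ∀ z₀ ∈ U, ∃ s ∈ 𝓝 z₀, ∃ b : α → ℝ, Integrable b μ ∧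
      ∀ᵐ y ∂μ, ∀ z ∈ s, ‖F z y‖ ≤ b y) :
    DifferentiableOn ℂ (fun z => ∫ y, F z y ∂μ) U := by
  intro z₀ hz₀
  obtain ⟨s, hs, b, hb, hsb⟩ := hbound z₀ hz₀
  obtain ⟨ε, hε, hεs⟩ := Metric.mem_nhds_iff.1 (Filter.inter_mem hs (hU.mem_nhds hz₀))
  have hball : ∀ z ∈ Metric.ball z₀ (ε / 2), Metric.closedBall z (ε / 4) ⊆ Metric.ball z₀ ε := by
    intro z hz w hw
    rw [Metric.mem_ball] at hz ⊢
    rw [Metric.mem_closedBall] at hw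
    linarith [dist_triangle w z z₀]
  have hmem : ∀ᶠ z in 𝓝 z₀, z ∈ U := hU.mem_nhds hz₀
  have hderiv : ∀ y, ∀ z ∈ Metric.ball z₀ (ε / 2),
      HasDerivAt (fun z => F z y) (deriv (fun z => F z y) z) z := by
    intro y z hz
    have : z ∈ U := (hεs (hball z hz (Metric.mem_closedBall_self (by positivity)))).2
    exact ((hdiff y).differentiableAt (hU.mem_nhds this)).hasDerivAt
  -- Cauchy's estimate on circles of radius `ε / 4`, which stay in the ball of radius `ε`, converts
  -- the bound on the integrand into one on its derivative.
  refine (hasDerivAt_integral_of_dominated_loc_of_deriv_le (s := Metric.ball z₀ (ε / 2))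
    (F' := fun z y => deriv (fun z => F z y) z) (bound := fun y => b y / (ε / 4))
    (Metric.ball_mem_nhds _ (by positivity)) (hmem.mono hmeas)
    ?_ ?_ ?_ (hb.div_const _) (Eventually.of_forall fun y z hz => hderiv y z hz)).2.differentiableAt.differentiableWithinAt
  · refine hb.mono' (hmeas z₀ hz₀) (hsb.mono fun y hy => hy z₀ (mem_of_mem_nhds hs))
  -- Measurability of the derivative in `y`: it is a pointwise limit of difference quotients along
  -- this sequence.
  · have hseq : Tendsto (fun n : ℕ => z₀ + ((1 / ((n : ℝ) + 1) : ℝ) : ℂ)) atTop (𝓝[≠] z₀) := by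
      rw [tendsto_nhdsWithin_iff]
      constructor
      · have h1 : Tendsto (fun n : ℕ => ((1 / ((n : ℝ) + 1) : ℝ) : ℂ)) atTop (𝓝 ((0 : ℝ) : ℂ)) :=
          (Complex.continuous_ofReal.tendsto _).comp tendsto_one_div_add_atTop_nhds_zero_nat
        simpa using h1.const_add z₀
      · refine Eventually.of_forall fun n => ?_
        have : (0 : ℝ) < 1 / ((n : ℝ) + 1) := by positivity
        simp only [mem_compl_iff, mem_singleton_iff, add_eq_left, ofReal_eq_zero]
        exact this.ne'
    obtain ⟨N, hN⟩ := (((hseq.mono_right nhdsWithin_le_nhds).eventually hmem)).exists_forall_of_atTop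
    have hlim : ∀ y, Tendsto (fun n : ℕ =>
        slope (fun z => F z y) z₀ (z₀ + ((1 / (((n + N : ℕ) : ℝ) + 1) : ℝ) : ℂ))) atTop
        (𝓝 (deriv (fun z => F z y) z₀)) := fun y =>
      ((hasDerivAt_iff_tendsto_slope.1
        (hderiv y z₀ (Metric.mem_ball_self (by positivity)))).comp hseq).comp
        (tendsto_add_atTop_nat N)
    refine aestronglyMeasurable_of_tendsto_ae atTop (fun n => ?_) (Eventually.of_forall hlim)
    simp only [slope, vsub_eq_sub, smul_eq_mul]
    exact ((hmeas _ (hN (n + N) (by omega))).sub (hmeas _ hz₀)).const_mul _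
  · filter_upwards [hsb] with y hy z hz
    refine Complex.norm_deriv_le_of_forall_mem_sphere_norm_le (by positivity) ?_ fun w hw => ?_
    · refine DifferentiableOn.diffContOnCl ?_
      rw [closure_ball _ (by positivity)]
      exact (hdiff y).mono fun w hw => (hεs (hball z hz hw)).2
    · exact hy w (hεs (hball z hz (Metric.sphere_subset_closedBall hw))).1

/-! ### Tail integrals -/

theorem integrableOn_Ioi_of_continuous {E : Type*} [NormedAddCommGroup E] {f : ℝ → E}
    (hc : Continuous f) {a : ℝ} (hi : IntegrableOn f (Ioi a)) (x : ℝ) : IntegrableOn f (Ioi x) := by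
  rcases le_total a x with h | h
  · exact hi.mono_set (Ioi_subset_Ioi h)
  · rw [← Ioc_union_Ioi_eq_Ioi h]
    exact (hc.integrableOn_Ioc).union hi

theorem hasDerivAt_integral_Ioi {E : Type*} [NormedAddCommGroup E] [NormedSpace ℝ E]
    [CompleteSpace E] {f : ℝ → E} (hc : Continuous f)
    (hi : ∀ x, IntegrableOn f (Ioi x)) (x : ℝ) :
    HasDerivAt (fun x => ∫ y in Ioi x, f y) (-f x) x := by
  have h1 : (fun x => ∫ y in Ioi x, f y) = fun x => (∫ y in Ioi 0, f y) - ∫ y in (0 : ℝ)..x, f y := by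
    ext x
    rw [← intervalIntegral.integral_Ioi_sub_Ioi' (hi 0) (hi x), sub_sub_cancel]
  rw [h1]
  exact (intervalIntegral.integral_hasDerivAt_right (hc.intervalIntegrable _ _)
    (hc.stronglyMeasurableAtFilter _ _) hc.continuousAt).const_sub _

theorem norm_exp_mul_le_one {a : ℂ} (ha : 0 ≤ a.re) {s : ℝ} (hs : s ≤ 0) :
    ‖exp (a * s)‖ ≤ 1 := by
  rw [Complex.norm_exp, Real.exp_le_one_iff]
  simpa using mul_nonpos_of_nonneg_of_nonpos ha hs

theorem hasDerivAt_exp_mul_sub (a : ℂ) (c x : ℝ) :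
    HasDerivAt (fun x : ℝ => exp (a * ((x - c : ℝ) : ℂ))) (a * exp (a * ((x - c : ℝ) : ℂ))) x := by
  have h1 : HasDerivAt (fun x : ℝ => ((x - c : ℝ) : ℂ)) 1 x := by
    simpa using ((hasDerivAt_id x).sub_const c).ofReal_comp
  have h2 := (h1.const_mul a).cexp
  rw [mul_one, mul_comm] at h2
  exact h2

/-- The kernel factors as `exp (a x) * exp (-a y)`, so `x` survives only in a prefactor and in the
endpoint of integration, and the product rule applies. -/
theorem hasDerivAt_integral_exp_mul {a : ℂ} (ha : 0 ≤ a.re) {f : ℝ → ℂ} (hc : Continuous f)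
    (hi : ∀ x, IntegrableOn f (Ioi x)) (x : ℝ) :
    HasDerivAt (fun x : ℝ => ∫ y in Ioi x, exp (a * ((x - y : ℝ) : ℂ)) * f y)
      (a * (∫ y in Ioi x, exp (a * ((x - y : ℝ) : ℂ)) * f y) - f x) x := by
  have hexp : ∀ x y : ℝ, exp (a * ((x - y : ℝ) : ℂ)) =
      exp (a * ((x - 0 : ℝ) : ℂ)) * exp (a * ((0 - y : ℝ) : ℂ)) := by
    intro x y
    rw [← Complex.exp_add]
    congr 1
    push_cast
    ring
  have hc' : Continuous fun y : ℝ => exp (a * ((0 - y : ℝ) : ℂ)) * f y := by fun_prop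
  have hi' : ∀ x, IntegrableOn (fun y : ℝ => exp (a * ((0 - y : ℝ) : ℂ)) * f y) (Ioi x) := by
    intro x
    refine integrableOn_Ioi_of_continuous hc' (a := 0) ?_ x
    refine Integrable.mono' (hi 0).norm hc'.aestronglyMeasurable ?_
    filter_upwards [ae_restrict_mem measurableSet_Ioi] with y hy
    rw [norm_mul]
    refine mul_le_of_le_one_left (norm_nonneg _) (norm_exp_mul_le_one ha ?_)
    simpa using (mem_Ioi.1 hy).le
  have hsplit : ∀ x : ℝ, (∫ y in Ioi x, exp (a * ((x - y : ℝ) : ℂ)) * f y) =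
      exp (a * ((x - 0 : ℝ) : ℂ)) * ∫ y in Ioi x, exp (a * ((0 - y : ℝ) : ℂ)) * f y := by
    intro x
    rw [← integral_const_mul]
    refine integral_congr_ae (Eventually.of_forall fun y => ?_)
    dsimp only
    rw [hexp x y, mul_assoc]
  rw [funext hsplit, hsplit x]
  have h := (hasDerivAt_exp_mul_sub a 0 x).mul (hasDerivAt_integral_Ioi hc' hi' x)
  convert! h using 1
  have := hexp x x
  simp only [sub_self, ofReal_zero, mul_zero, Complex.exp_zero] at this
  rw [mul_neg, ← mul_assoc (exp (a * ((x - 0 : ℝ) : ℂ))), ← this, one_mul]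
  ring

/-- A function squeezed between uniformly small multiples of a locally bounded function is a
locally uniform limit. -/
theorem tendstoLocallyUniformlyOn_of_le_mul {X E : Type*} [TopologicalSpace X]
    [NormedAddCommGroup E] {f : ℕ → X → E} {f' : X → E} {c : ℕ → ℝ} {b : X → ℝ} {S : Set X}
    (hb : ContinuousOn b S) (hc : Tendsto c atTop (𝓝 0)) (hc0 : ∀ k, 0 ≤ c k)
    (h : ∀ k, ∀ x ∈ S, ‖f' x - f k x‖ ≤ c k * b x) :
    TendstoLocallyUniformlyOn f f' atTop S := by
  rw [Metric.tendstoLocallyUniformlyOn_iff]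
  intro ε hε x hx
  have h1 : ∀ᶠ y in 𝓝[S] x, b y < |b x| + 1 :=
    (hb x hx).eventually (gt_mem_nhds (by linarith [le_abs_self (b x)]))
  have h2 : ∀ᶠ k in atTop, c k * (|b x| + 1) < ε := by
    have : Tendsto (fun k => c k * (|b x| + 1)) atTop (𝓝 0) := by
      simpa using hc.mul_const (|b x| + 1)
    exact this.eventually (gt_mem_nhds hε)
  refine ⟨_, Filter.inter_mem h1 self_mem_nhdsWithin, ?_⟩
  filter_upwards [h2] with k hk y hy
  rw [dist_eq_norm]
  exact ((h k y hy.2).trans (mul_le_mul_of_nonneg_left hy.1.le (hc0 k))).trans_lt hk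

/-! ### A Volterra equation on the line with a complex parameter -/

/-- The data of the system `n' = diag (A z) n + W z x n`, `n → e` at `+∞`, with a parameter `z`. -/
structure VolterraData (D : Set ℂ) (A : ℂ → Fin 3 → ℂ) (W : ℂ → ℝ → Fin 3 → Fin 3 → ℂ)
    (M : ℂ → ℝ) (g : ℝ → ℝ) (e : Fin 3 → ℂ) : Prop where
  re_nonneg : ∀ z ∈ D, ∀ l, 0 ≤ (A z l).re
  mul_eq_zero : ∀ z ∈ D, ∀ l, A z l * e l = 0
  norm_le_one : ‖e‖ ≤ 1
  continuousOn_exponent : ∀ l, ContinuousOn (fun z => A z l) D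
  differentiableOn_exponent : ∀ l, DifferentiableOn ℂ (fun z => A z l) (interior D)
  norm_coeff_le : ∀ z ∈ D, ∀ x i l, ‖W z x i l‖ ≤ M z * g x
  continuous_coeff : ∀ z ∈ D, ∀ i l, Continuous (fun x => W z x i l)
  continuousOn_coeff : ∀ x i l, ContinuousOn (fun z => W z x i l) D
  differentiableOn_coeff : ∀ x i l, DifferentiableOn ℂ (fun z => W z x i l) (interior D)
  continuousOn_bound : ContinuousOn M D
  bound_nonneg : ∀ z ∈ D, 0 ≤ M z
  continuous_density : Continuous g
  density_nonneg : ∀ x, 0 ≤ g x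
  integrable_density : ∀ x, IntegrableOn g (Ioi x)

/-- The weight in which the Volterra operator is a contraction. -/
noncomputable def weight (M : ℂ → ℝ) (g : ℝ → ℝ) (z : ℂ) (x : ℝ) : ℝ :=
  Real.exp (6 * M z * ∫ y in Ioi x, g y)

/-- The integrand of the Volterra operator. -/
noncomputable def volterraKernel (A : ℂ → Fin 3 → ℂ) (W : ℂ → ℝ → Fin 3 → Fin 3 → ℂ)
    (n : ℂ → ℝ → Fin 3 → ℂ) (z : ℂ) (x : ℝ) (l : Fin 3) (y : ℝ) : ℂ :=
  exp (A z l * ((x - y : ℝ) : ℂ)) * ∑ i, W z y l i * n z y i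

/-- The Volterra operator. -/
noncomputable def volterraOp (A : ℂ → Fin 3 → ℂ) (W : ℂ → ℝ → Fin 3 → Fin 3 → ℂ)
    (e : Fin 3 → ℂ) (n : ℂ → ℝ → Fin 3 → ℂ) (z : ℂ) (x : ℝ) : Fin 3 → ℂ :=
  fun l => e l - ∫ y in Ioi x, volterraKernel A W n z x l y

namespace VolterraData

variable {D : Set ℂ} {A : ℂ → Fin 3 → ℂ} {W : ℂ → ℝ → Fin 3 → Fin 3 → ℂ}
  {M : ℂ → ℝ} {g : ℝ → ℝ} {e : Fin 3 → ℂ}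

theorem hasDerivAt_weight (h : VolterraData D A W M g e) (z : ℂ) (x : ℝ) :
    HasDerivAt (weight M g z) (-(6 * M z * g x * weight M g z x)) x := by
  have h1 := ((hasDerivAt_integral_Ioi h.continuous_density h.integrable_density x).const_mul
    (6 * M z)).exp
  convert! h1 using 1
  simp only [weight]
  ring

theorem continuous_weight (h : VolterraData D A W M g e) (z : ℂ) : Continuous (weight M g z) :=
  continuous_iff_continuousAt.2 fun x => (h.hasDerivAt_weight z x).continuousAt

theorem continuousOn_weight (h : VolterraData D A W M g e) (x : ℝ) :
    ContinuousOn (fun z => weight M g z x) D :=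
  Real.continuous_exp.comp_continuousOn
    ((h.continuousOn_bound.const_mul 6).mul continuousOn_const)

theorem tendsto_weight (M : ℂ → ℝ) (g : ℝ → ℝ) (z : ℂ) :
    Tendsto (weight M g z) atTop (𝓝 1) := by
  have h1 : Tendsto (fun x : ℝ => 6 * M z * ∫ y in Ioi x, g y) atTop (𝓝 (6 * M z * 0)) :=
    (tendsto_integral_Ioi_zero tendsto_id).const_mul _
  have h2 := (Real.continuous_exp.tendsto _).comp h1
  rw [mul_zero, Real.exp_zero] at h2
  exact h2

theorem tail_nonneg (h : VolterraData D A W M g e) (x : ℝ) : 0 ≤ ∫ y in Ioi x, g y :=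
  integral_nonneg fun y => h.density_nonneg y

theorem one_le_weight (h : VolterraData D A W M g e) {z : ℂ} (hz : z ∈ D) (x : ℝ) :
    1 ≤ weight M g z x :=
  Real.one_le_exp (mul_nonneg (mul_nonneg (by norm_num) (h.bound_nonneg z hz)) (h.tail_nonneg x))

theorem weight_le (h : VolterraData D A W M g e) {z : ℂ} (hz : z ∈ D) {x y : ℝ} (hxy : x ≤ y) :
    weight M g z y ≤ weight M g z x := by
  refine Real.exp_le_exp.2 (mul_le_mul_of_nonneg_left ?_
    (mul_nonneg (by norm_num) (h.bound_nonneg z hz)))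
  exact setIntegral_mono_set (h.integrable_density x)
    (Eventually.of_forall h.density_nonneg) (Ioi_subset_Ioi hxy).eventuallyLE

theorem integrableOn_weight (h : VolterraData D A W M g e) {z : ℂ} (hz : z ∈ D) (x : ℝ) :
    IntegrableOn (fun y => 3 * M z * g y * weight M g z y) (Ioi x) := by
  have hM := h.bound_nonneg z hz
  refine Integrable.mono' (((h.integrable_density x).const_mul (3 * M z)).mul_const
    (weight M g z x)) ?_ ?_
  · exact ((continuous_const.mul h.continuous_density).mul
      (h.continuous_weight z)).aestronglyMeasurable
  · filter_upwards [ae_restrict_mem measurableSet_Ioi] with y hy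
    have hg := h.density_nonneg y
    have := h.one_le_weight hz y
    rw [Real.norm_of_nonneg (by positivity)]
    exact mul_le_mul_of_nonneg_left (h.weight_le hz (mem_Ioi.1 hy).le) (by positivity)

/-- The weight satisfies `w' = -6 M g w`, while a row of three coefficients costs only `3 M g`. The
ratio of these constants is the contraction factor `1/2`. -/
theorem integral_weight (h : VolterraData D A W M g e) {z : ℂ} (hz : z ∈ D) (x : ℝ) :
    ∫ y in Ioi x, 3 * M z * g y * weight M g z y = (weight M g z x - 1) / 2 := by
  have h1 : ∀ y ∈ Ici x, HasDerivAt (fun y => -(1 / 2) * weight M g z y)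
      (3 * M z * g y * weight M g z y) y := by
    intro y _
    convert! (h.hasDerivAt_weight z y).const_mul (-(1 / 2)) using 1
    ring
  rw [integral_Ioi_of_hasDerivAt_of_tendsto' h1 (h.integrableOn_weight hz x)
    ((tendsto_weight M g z).const_mul _)]
  ring

/-- The estimate for the integrand of the Volterra operator. -/
theorem norm_kernel_le (h : VolterraData D A W M g e) {z : ℂ} (hz : z ∈ D)
    {n : ℂ → ℝ → Fin 3 → ℂ} {C : ℝ} {x y : ℝ} (hn : ‖n z y‖ ≤ C * weight M g z y)
    (hxy : x ≤ y) (l : Fin 3) :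
    ‖volterraKernel A W n z x l y‖ ≤ C * (3 * M z * g y * weight M g z y) := by
  have hM := h.bound_nonneg z hz
  have hg := h.density_nonneg y
  rw [volterraKernel, norm_mul]
  refine (mul_le_of_le_one_left (norm_nonneg _)
    (norm_exp_mul_le_one (h.re_nonneg z hz l) (by linarith))).trans ?_
  refine (norm_sum_le _ _).trans ?_
  have : ∀ i ∈ (Finset.univ : Finset (Fin 3)), ‖W z y l i * n z y i‖ ≤
      M z * g y * (C * weight M g z y) := by
    intro i _
    rw [norm_mul]
    exact mul_le_mul (h.norm_coeff_le z hz y l i) ((norm_le_pi_norm _ i).trans hn)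
      (norm_nonneg _) (by positivity)
  refine (Finset.sum_le_sum this).trans (le_of_eq ?_)
  simp
  ring

theorem continuous_sum (h : VolterraData D A W M g e) {z : ℂ} (hz : z ∈ D)
    {n : ℂ → ℝ → Fin 3 → ℂ} (hn : Continuous (n z)) (l : Fin 3) :
    Continuous fun y => ∑ i, W z y l i * n z y i :=
  continuous_finsetSum _ fun i _ =>
    (h.continuous_coeff z hz l i).mul ((continuous_apply i).comp hn)

theorem continuous_kernel (h : VolterraData D A W M g e) {z : ℂ} (hz : z ∈ D)
    {n : ℂ → ℝ → Fin 3 → ℂ} (hn : Continuous (n z)) (x : ℝ) (l : Fin 3) :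
    Continuous fun y => volterraKernel A W n z x l y :=
  Continuous.mul (by fun_prop) (h.continuous_sum hz hn l)

theorem integrableOn_kernel (h : VolterraData D A W M g e) {z : ℂ} (hz : z ∈ D)
    {n : ℂ → ℝ → Fin 3 → ℂ} (hc : Continuous (n z)) {C : ℝ}
    (hn : ∀ y, ‖n z y‖ ≤ C * weight M g z y) (x : ℝ) (l : Fin 3) :
    IntegrableOn (fun y => volterraKernel A W n z x l y) (Ioi x) := by
  refine Integrable.mono' ((h.integrableOn_weight hz x).const_mul C)
    (h.continuous_kernel hz hc x l).aestronglyMeasurable ?_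
  filter_upwards [ae_restrict_mem measurableSet_Ioi] with y hy
  exact h.norm_kernel_le hz (hn y) (mem_Ioi.1 hy).le l

theorem norm_integral_kernel_le (h : VolterraData D A W M g e) {z : ℂ} (hz : z ∈ D)
    {n : ℂ → ℝ → Fin 3 → ℂ} {C : ℝ} (hn : ∀ y, ‖n z y‖ ≤ C * weight M g z y) (x : ℝ) (l : Fin 3) :
    ‖∫ y in Ioi x, volterraKernel A W n z x l y‖ ≤ C * ((weight M g z x - 1) / 2) := by
  rw [← h.integral_weight hz x, ← integral_const_mul]
  refine norm_integral_le_of_norm_le ((h.integrableOn_weight hz x).const_mul C) ?_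
  filter_upwards [ae_restrict_mem measurableSet_Ioi] with y hy
  exact h.norm_kernel_le hz (hn y) (mem_Ioi.1 hy).le l

theorem integrableOn_sum (h : VolterraData D A W M g e) {z : ℂ} (hz : z ∈ D)
    {n : ℂ → ℝ → Fin 3 → ℂ} (hc : Continuous (n z)) {C : ℝ}
    (hn : ∀ y, ‖n z y‖ ≤ C * weight M g z y) (x : ℝ) (l : Fin 3) :
    IntegrableOn (fun y => ∑ i, W z y l i * n z y i) (Ioi x) := by
  -- With zero exponents the Volterra kernel is the bare sum, so the kernel estimate applies to it.
  have h0 : VolterraData D (fun _ _ => 0) W M g e :=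
    { h with
      re_nonneg := fun _ _ _ => le_rfl
      mul_eq_zero := fun _ _ _ => zero_mul _
      continuousOn_exponent := fun _ => continuousOn_const
      differentiableOn_exponent := fun _ => differentiableOn_const _ }
  simpa [volterraKernel] using h0.integrableOn_kernel hz hc hn x l

theorem hasDerivAt_op (h : VolterraData D A W M g e) {z : ℂ} (hz : z ∈ D)
    {n : ℂ → ℝ → Fin 3 → ℂ} (hc : Continuous (n z)) {C : ℝ}
    (hn : ∀ y, ‖n z y‖ ≤ C * weight M g z y) (x : ℝ) (l : Fin 3) :
    HasDerivAt (fun x => volterraOp A W e n z x l)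
      (A z l * volterraOp A W e n z x l + ∑ i, W z x l i * n z x i) x := by
  have h1 := (hasDerivAt_integral_exp_mul (h.re_nonneg z hz l) (h.continuous_sum hz hc l)
    (fun x => h.integrableOn_sum hz hc hn x l) x).const_sub (e l)
  convert! h1 using 1
  simp only [volterraOp, volterraKernel]
  -- The constant `e` is annihilated by the diagonal part, which is why it enters the integral
  -- equation without an exponential.
  linear_combination h.mul_eq_zero z hz l

theorem continuous_op (h : VolterraData D A W M g e) {z : ℂ} (hz : z ∈ D)
    {n : ℂ → ℝ → Fin 3 → ℂ} (hc : Continuous (n z)) {C : ℝ}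
    (hn : ∀ y, ‖n z y‖ ≤ C * weight M g z y) : Continuous (volterraOp A W e n z) :=
  continuous_pi fun l => continuous_iff_continuousAt.2 fun x =>
    (h.hasDerivAt_op hz hc hn x l).continuousAt

/-- The constant contributes at most `1` and the integral at most `(w - 1) / 2`; together this is at
most `w` because `w ≥ 1`. So the weighted unit ball is invariant. -/
theorem norm_op_le (h : VolterraData D A W M g e) {z : ℂ} (hz : z ∈ D)
    {n : ℂ → ℝ → Fin 3 → ℂ} (hn : ∀ y, ‖n z y‖ ≤ weight M g z y) (x : ℝ) :
    ‖volterraOp A W e n z x‖ ≤ weight M g z x := by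
  have hw := h.one_le_weight hz x
  refine (pi_norm_le_iff_of_nonneg (by linarith)).2 fun l => ?_
  have h1 := h.norm_integral_kernel_le hz (C := 1) (fun y => by simpa using hn y) x l
  have h2 := (norm_le_pi_norm e l).trans h.norm_le_one
  refine (norm_sub_le _ _).trans ?_
  linarith

/-- The operator is affine, so the difference is the integral for `n' - n`. This is the contraction
estimate. -/
theorem norm_op_sub_le (h : VolterraData D A W M g e) {z : ℂ} (hz : z ∈ D)
    {n n' : ℂ → ℝ → Fin 3 → ℂ} (hc : Continuous (n z)) (hc' : Continuous (n' z)) {C C' K : ℝ}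
    (hn : ∀ y, ‖n z y‖ ≤ C * weight M g z y) (hn' : ∀ y, ‖n' z y‖ ≤ C' * weight M g z y)
    (hK : 0 ≤ K) (hd : ∀ y, ‖n z y - n' z y‖ ≤ K * weight M g z y) (x : ℝ) :
    ‖volterraOp A W e n z x - volterraOp A W e n' z x‖ ≤ K / 2 * weight M g z x := by
  have hw := h.one_le_weight hz x
  refine (pi_norm_le_iff_of_nonneg (by positivity)).2 fun l => ?_
  have h1 := h.norm_integral_kernel_le hz (n := n' - n) (C := K)
    (fun y => by simpa [norm_sub_rev] using hd y) x l
  have h2 : (volterraOp A W e n z x - volterraOp A W e n' z x) l =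
      ∫ y in Ioi x, volterraKernel A W (n' - n) z x l y := by
    simp only [volterraOp, Pi.sub_apply]
    rw [sub_sub_sub_cancel_left, ← integral_sub (h.integrableOn_kernel hz hc' hn' x l)
      (h.integrableOn_kernel hz hc hn x l)]
    refine integral_congr_ae (Eventually.of_forall fun y => ?_)
    simp only [volterraKernel, Pi.sub_apply, mul_sub, Finset.sum_sub_distrib]
  rw [h2]
  nlinarith

/-- Uniform integrable bound for the integrand near a parameter value. -/
theorem exists_bound_kernel (h : VolterraData D A W M g e) {z₀ : ℂ} (hz₀ : z₀ ∈ D)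
    {n : ℂ → ℝ → Fin 3 → ℂ} (hn : ∀ z ∈ D, ∀ y, ‖n z y‖ ≤ weight M g z y) (x : ℝ) (l : Fin 3) :
    ∃ b : ℝ → ℝ, IntegrableOn b (Ioi x) ∧ ∃ s ∈ 𝓝[D] z₀, ∀ᵐ y ∂volume.restrict (Ioi x),
      ∀ z ∈ s, ‖volterraKernel A W n z x l y‖ ≤ b y := by
  -- Continuity of `M` keeps it below this value near `z₀`, which makes the dominating function
  -- independent of the parameter.
  set M₁ := M z₀ + 1 with hM₁
  have hM₀ := h.bound_nonneg z₀ hz₀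
  have hG := h.tail_nonneg x
  refine ⟨fun y => 3 * M₁ * Real.exp (6 * M₁ * ∫ y in Ioi x, g y) * g y,
    (h.integrable_density x).const_mul _, ?_⟩
  have h1 : ∀ᶠ z in 𝓝[D] z₀, M z < M₁ :=
    (h.continuousOn_bound z₀ hz₀).eventually (gt_mem_nhds (by linarith))
  refine ⟨_, Filter.inter_mem h1 self_mem_nhdsWithin, ?_⟩
  filter_upwards [ae_restrict_mem measurableSet_Ioi] with y hy z ⟨hzM, hzD⟩
  have hzM : M z < M₁ := hzM
  have hM := h.bound_nonneg z hzD
  have hg := h.density_nonneg y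
  refine (h.norm_kernel_le hzD (C := 1) (by simpa using hn z hzD y) (mem_Ioi.1 hy).le l).trans ?_
  have hw : weight M g z y ≤ Real.exp (6 * M₁ * ∫ y in Ioi x, g y) := by
    refine (h.weight_le hzD (mem_Ioi.1 hy).le).trans (Real.exp_le_exp.2 ?_)
    gcongr
  have hw0 : 0 ≤ weight M g z y := (Real.exp_pos _).le
  calc 1 * (3 * M z * g y * weight M g z y)
      ≤ 3 * M₁ * g y * Real.exp (6 * M₁ * ∫ y in Ioi x, g y) := by
        rw [one_mul]; gcongr
    _ = _ := by ring

theorem continuousOn_op (h : VolterraData D A W M g e) {n : ℂ → ℝ → Fin 3 → ℂ}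
    (hc : ∀ z ∈ D, Continuous (n z)) (hn : ∀ z ∈ D, ∀ y, ‖n z y‖ ≤ weight M g z y)
    (hcz : ∀ y l, ContinuousOn (fun z => n z y l) D) (x : ℝ) (l : Fin 3) :
    ContinuousOn (fun z => volterraOp A W e n z x l) D := by
  intro z₀ hz₀
  obtain ⟨b, hb, s, hs, hbound⟩ := h.exists_bound_kernel hz₀ hn x l
  refine continuousWithinAt_const.sub (continuousWithinAt_of_dominated ?_
    (by filter_upwards [hs] with z hz using hbound.mono fun y hy => hy z hz) hb ?_)
  · filter_upwards [self_mem_nhdsWithin] with z hz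
    exact (h.continuous_kernel hz (hc z hz) x l).aestronglyMeasurable
  · refine Eventually.of_forall fun y => ?_
    have h1 : ContinuousOn (fun z => volterraKernel A W n z x l y) D :=
      (((h.continuousOn_exponent l).mul continuousOn_const).cexp).mul
        (continuousOn_finsetSum _ fun i _ => (h.continuousOn_coeff y l i).mul (hcz y i))
    exact h1 z₀ hz₀

theorem differentiableOn_op (h : VolterraData D A W M g e) {n : ℂ → ℝ → Fin 3 → ℂ}
    (hc : ∀ z ∈ D, Continuous (n z)) (hn : ∀ z ∈ D, ∀ y, ‖n z y‖ ≤ weight M g z y)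
    (hdz : ∀ y l, DifferentiableOn ℂ (fun z => n z y l) (interior D)) (x : ℝ) (l : Fin 3) :
    DifferentiableOn ℂ (fun z => volterraOp A W e n z x l) (interior D) := by
  refine (differentiableOn_const _).sub
    (differentiableOn_integral_of_dominated isOpen_interior ?_ ?_ ?_)
  · exact fun z hz => (h.continuous_kernel (interior_subset hz)
      (hc z (interior_subset hz)) x l).aestronglyMeasurable
  · intro y
    exact (((h.differentiableOn_exponent l).mul (differentiableOn_const _)).cexp).mul
      (DifferentiableOn.fun_sum fun i _ => (h.differentiableOn_coeff y l i).mul (hdz y i))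
  · intro z₀ hz₀
    obtain ⟨b, hb, s, hs, hbound⟩ := h.exists_bound_kernel (interior_subset hz₀) hn x l
    rw [nhdsWithin_eq_nhds.2 (mem_interior_iff_mem_nhds.1 hz₀)] at hs
    exact ⟨s, hs, b, hb, hbound⟩

/-- Picard iterates. -/
noncomputable def iter (A : ℂ → Fin 3 → ℂ) (W : ℂ → ℝ → Fin 3 → Fin 3 → ℂ) (e : Fin 3 → ℂ) :
    ℕ → ℂ → ℝ → Fin 3 → ℂ
  | 0 => fun _ _ => 0
  | k + 1 => volterraOp A W e (iter A W e k)

theorem iter_bound (h : VolterraData D A W M g e) (k : ℕ) {z : ℂ} (hz : z ∈ D) :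
    Continuous (iter A W e k z) ∧ ∀ y, ‖iter A W e k z y‖ ≤ weight M g z y := by
  induction k with
  | zero => exact ⟨continuous_const, fun y => by simpa [iter] using zero_le_one.trans (h.one_le_weight hz y)⟩
  | succ k ih =>
    exact ⟨h.continuous_op hz ih.1 (C := 1) (by simpa using ih.2), h.norm_op_le hz ih.2⟩

theorem iter_regular (h : VolterraData D A W M g e) (k : ℕ) (x : ℝ) (l : Fin 3) :
    ContinuousOn (fun z => iter A W e k z x l) D ∧
      DifferentiableOn ℂ (fun z => iter A W e k z x l) (interior D) := by
  induction k generalizing x l with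
  | zero => exact ⟨continuousOn_const, differentiableOn_const _⟩
  | succ k ih =>
    exact ⟨h.continuousOn_op (fun z hz => (h.iter_bound k hz).1)
        (fun z hz => (h.iter_bound k hz).2) (fun y l => (ih y l).1) x l,
      h.differentiableOn_op (fun z hz => (h.iter_bound k hz).1)
        (fun z hz => (h.iter_bound k hz).2) (fun y l => (ih y l).2) x l⟩

theorem norm_iter_succ_sub_le (h : VolterraData D A W M g e) (k : ℕ) {z : ℂ} (hz : z ∈ D) (x : ℝ) :
    ‖iter A W e (k + 1) z x - iter A W e k z x‖ ≤ (1 / 2) ^ k * weight M g z x := by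
  induction k generalizing x with
  | zero => simpa [iter] using (h.iter_bound 1 hz).2 x
  | succ k ih =>
    have := h.norm_op_sub_le hz (h.iter_bound (k + 1) hz).1 (h.iter_bound k hz).1 (C := 1) (C' := 1)
      (by simpa using (h.iter_bound (k + 1) hz).2) (by simpa using (h.iter_bound k hz).2)
      (by positivity) ih x
    refine this.trans (le_of_eq ?_)
    ring

/-- The Volterra equation has a solution which is continuous in the parameter, and holomorphic
in the interior of the parameter set. -/
theorem exists_solution (h : VolterraData D A W M g e) :
    ∃ n : ℂ → ℝ → Fin 3 → ℂ,
      (∀ z ∈ D, ∀ x l, HasDerivAt (fun x => n z x l)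
        (A z l * n z x l + ∑ i, W z x l i * n z x i) x) ∧
      (∀ z ∈ D, Tendsto (n z) atTop (𝓝 e)) ∧
      ∀ x l, ContinuousOn (fun z => n z x l) D ∧
        DifferentiableOn ℂ (fun z => n z x l) (interior D) := by
  -- The membership hypothesis sits inside the existential so that the chosen limit is a total
  -- function of `z`.
  have hlim : ∀ z x, ∃ a, z ∈ D → Tendsto (fun k => iter A W e k z x) atTop (𝓝 a) := by
    intro z x
    by_cases hz : z ∈ D
    · obtain ⟨a, ha⟩ := cauchySeq_tendsto_of_complete
        (cauchySeq_of_le_geometric (1 / 2) (weight M g z x) (by norm_num)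
        (f := fun k => iter A W e k z x) fun k => by
          rw [dist_comm, dist_eq_norm, mul_comm]
          exact h.norm_iter_succ_sub_le k hz x)
      exact ⟨a, fun _ => ha⟩
    · exact ⟨0, fun h => absurd h hz⟩
  choose n hn using hlim
  have hdist : ∀ z ∈ D, ∀ x k, ‖n z x - iter A W e k z x‖ ≤ 2 * (1 / 2) ^ k * weight M g z x := by
    intro z hz x k
    rw [← dist_eq_norm, dist_comm]
    refine (dist_le_of_le_geometric_of_tendsto (1 / 2) (weight M g z x) (by norm_num)
      (f := fun k => iter A W e k z x) (fun k => ?_) (hn z x hz) k).trans (le_of_eq ?_)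
    · rw [dist_comm, dist_eq_norm, mul_comm]
      exact h.norm_iter_succ_sub_le k hz x
    · ring
  have hc2 : Tendsto (fun k : ℕ => 2 * (1 / 2 : ℝ) ^ k) atTop (𝓝 0) := by
    simpa using (tendsto_pow_atTop_nhds_zero_of_lt_one (r := (1 / 2 : ℝ)) (by norm_num)
      (by norm_num)).const_mul 2
  -- Continuity in `x` has to precede the fixed-point identity, since the contraction estimate is
  -- stated for continuous arguments.
  have hcont : ∀ z ∈ D, Continuous (n z) := by
    intro z hz
    rw [← continuousOn_univ]
    refine TendstoLocallyUniformlyOn.continuousOn (p := atTop) (F := fun k => iter A W e k z)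
      (tendstoLocallyUniformlyOn_of_le_mul (h.continuous_weight z).continuousOn hc2
        (fun k => by positivity) fun k x _ => hdist z hz x k)
      (Frequently.of_forall fun k => (h.iter_bound k hz).1.continuousOn)
  have hbd : ∀ z ∈ D, ∀ y, ‖n z y‖ ≤ 1 * weight M g z y := by
    intro z hz y
    rw [one_mul]
    exact le_of_tendsto (hn z y hz).norm (Eventually.of_forall fun k => (h.iter_bound k hz).2 y)
  have hfix : ∀ z ∈ D, ∀ x, n z x = volterraOp A W e n z x := by
    intro z hz x
    refine tendsto_nhds_unique ((tendsto_add_atTop_iff_nat 1).2 (hn z x hz)) ?_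
    rw [tendsto_iff_norm_sub_tendsto_zero]
    refine squeeze_zero (g := fun k : ℕ => 2 * (1 / 2 : ℝ) ^ k * (weight M g z x / 2))
      (fun _ => norm_nonneg _) (fun k => ?_) (by simpa using hc2.mul_const (weight M g z x / 2))
    rw [norm_sub_rev]
    refine (h.norm_op_sub_le hz (hcont z hz) (h.iter_bound k hz).1 (C' := 1) (hbd z hz)
      (by simpa using (h.iter_bound k hz).2) (by positivity) (fun y => hdist z hz y k) x).trans
      (le_of_eq ?_)
    ring
  refine ⟨n, fun z hz x l => ?_, fun z hz => ?_, fun x l => ⟨?_, ?_⟩⟩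
  · have h1 := h.hasDerivAt_op hz (hcont z hz) (hbd z hz) x l
    have h2 : (fun x => n z x l) = fun x => volterraOp A W e n z x l :=
      funext fun x => congrFun (hfix z hz x) l
    rw [h2, hfix z hz x]
    convert! h1 using 1
    rw [hfix z hz x]
  · rw [tendsto_pi_nhds]
    intro l
    rw [tendsto_iff_norm_sub_tendsto_zero]
    have hw : Tendsto (fun x => 1 * ((weight M g z x - 1) / 2)) atTop (𝓝 0) := by
      simpa using (((tendsto_weight M g z).sub_const 1).div_const 2).const_mul 1
    refine squeeze_zero (fun _ => norm_nonneg _) (fun x => ?_) hw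
    rw [hfix z hz x, volterraOp, sub_sub_cancel_left, norm_neg]
    exact h.norm_integral_kernel_le hz (hbd z hz) x l
  · exact TendstoLocallyUniformlyOn.continuousOn (p := atTop) (F := fun k z => iter A W e k z x l)
      (tendstoLocallyUniformlyOn_of_le_mul (h.continuousOn_weight x) hc2 (fun k => by positivity)
        fun k z hz => (norm_le_pi_norm (n z x - iter A W e k z x) l).trans (hdist z hz x k))
      (Frequently.of_forall fun k => (h.iter_regular k x l).1)
  · exact TendstoLocallyUniformlyOn.differentiableOn (φ := atTop)
      (F := fun k z => iter A W e k z x l)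
      (tendstoLocallyUniformlyOn_of_le_mul ((h.continuousOn_weight x).mono interior_subset) hc2
        (fun k => by positivity) fun k z hz =>
        (norm_le_pi_norm (n z x - iter A W e k z x) l).trans (hdist z (interior_subset hz) x k))
      (Eventually.of_forall fun k => (h.iter_regular k x l).2) isOpen_interior

end VolterraData

/-! ### Columns of the Jost eigenfunctions -/

/-- The exponents `λ, -k, -λ`. -/
noncomputable def expo (q₀ : ℝ) (z : ℂ) : Fin 3 → ℂ := ![lamz q₀ z, -kz q₀ z, -lamz q₀ z]

/-- The inverse of `Ŷ`. -/
noncomputable def matYinv (q₀ : ℝ) (v : V2) (z : ℂ) : M3 :=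
  !![-I, I * conj (v 0) / z, I * conj (v 1) / z;
     0, v 1 / q₀, -v 0 / q₀;
     -(q₀ / z), conj (v 0) / q₀, conj (v 1) / q₀]

/-- `m` is the `j`-th column of the Jost eigenfunction normalized at `+∞`, divided by its
exponential factor. -/
def IsColumn (q₀ : ℝ) (u : ℝ → V2) (v : V2) (j : Fin 3) (z : ℂ) (m : ℝ → Fin 3 → ℂ) : Prop :=
  (∀ x i, HasDerivAt (fun y => m y i)
    ((laxX q₀ z (u x)).mulVec (m x) i - I * expo q₀ z j * m x i) x) ∧
  Tendsto m atTop (𝓝 fun i => matY q₀ v z i j)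

/-- The points where `Ŷ` is defined and invertible. -/
def regularSet (q₀ : ℝ) : Set ℂ := {z | z ≠ 0 ∧ z ^ 2 - (q₀ : ℂ) ^ 2 ≠ 0}

theorem mul_conj_add_mul_conj {q₀ : ℝ} {v : V2} (hv : ‖v‖ = q₀) (a b : ℂ) (ha : v 0 = a)
    (hb : v 1 = b) : a * conj a + b * conj b = (q₀ : ℂ) ^ 2 := by
  subst ha hb
  have h := EuclideanSpace.norm_sq_eq v
  rw [hv, Fin.sum_univ_two] at h
  rw [Complex.mul_conj, Complex.mul_conj, Complex.normSq_eq_norm_sq, Complex.normSq_eq_norm_sq]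
  rw [← ofReal_add, ← h, ofReal_pow]

theorem matY_mul_matYinv {q₀ : ℝ} (hq₀ : 0 < q₀) {v : V2} (hv : ‖v‖ = q₀) {z : ℂ}
    (hz : z ∈ regularSet q₀) : matY q₀ v z * matYinv q₀ v z = 1 := by
  have hq : (q₀ : ℂ) ≠ 0 := by exact_mod_cast hq₀.ne'
  have hn := mul_conj_add_mul_conj hv _ _ rfl rfl
  obtain ⟨h0, h1⟩ := hz
  ext i j
  fin_cases i <;> fin_cases j <;>
    simp [matY, matYinv, Matrix.mul_apply, Fin.sum_univ_three, rho, perp] <;>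
    field_simp <;> grind [I_sq]

theorem laxX_mul_matY {q₀ : ℝ} (hq₀ : 0 < q₀) {v : V2} (hv : ‖v‖ = q₀) {z : ℂ}
    (hz : z ∈ regularSet q₀) (i l : Fin 3) :
    (laxX q₀ z v * matY q₀ v z) i l = matY q₀ v z i l * (I * expo q₀ z l) := by
  have hq : (q₀ : ℂ) ≠ 0 := by exact_mod_cast hq₀.ne'
  have hn := mul_conj_add_mul_conj hv _ _ rfl rfl
  obtain ⟨h0, h1⟩ := hz
  fin_cases i <;> fin_cases l <;>
    simp [matY, laxX, matJ, matQ, expo, kz, lamz, Matrix.mul_apply, Fin.sum_univ_three, rho, perp] <;>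
    field_simp <;> grind [I_sq]

theorem differentiableOn_matY (q₀ : ℝ) (v : V2) (i j : Fin 3) :
    DifferentiableOn ℂ (fun z => matY q₀ v z i j) (regularSet q₀) := by
  have h1 : ∀ z ∈ regularSet q₀, z ≠ 0 := fun z hz => hz.1
  have hr : DifferentiableOn ℂ (fun z => rho q₀ z) (regularSet q₀) := by
    unfold rho
    exact DifferentiableOn.div (by fun_prop) (by fun_prop) fun z hz => hz.2
  fin_cases i <;> fin_cases j <;> simp [matY] <;> fun_prop (disch := assumption)

theorem differentiableOn_matYinv (q₀ : ℝ) (v : V2) (i j : Fin 3) :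
    DifferentiableOn ℂ (fun z => matYinv q₀ v z i j) (regularSet q₀) := by
  have h1 : ∀ z ∈ regularSet q₀, z ≠ 0 := fun z hz => hz.1
  fin_cases i <;> fin_cases j <;> simp [matYinv] <;> fun_prop (disch := assumption)

theorem differentiableOn_expo (q₀ : ℝ) (l : Fin 3) :
    DifferentiableOn ℂ (fun z => expo q₀ z l) (regularSet q₀) := by
  have h1 : ∀ z ∈ regularSet q₀, z ≠ 0 := fun z hz => hz.1
  fin_cases l <;> simp [expo, kz, lamz] <;> fun_prop (disch := assumption)

theorem norm_matQ_sub_le (u v : V2) (i j : Fin 3) : ‖(matQ u - matQ v) i j‖ ≤ ‖u - v‖ := by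
  have h0 := PiLp.norm_apply_le (u - v) 0
  have h1 := PiLp.norm_apply_le (u - v) 1
  rw [PiLp.sub_apply] at h0 h1
  have c : ∀ a b : ℂ, ‖-starRingEnd ℂ a + starRingEnd ℂ b‖ = ‖a - b‖ := by
    intro a b
    rw [← norm_conj (a - b), map_sub, ← norm_neg]
    congr 1
    ring
  fin_cases i <;> fin_cases j <;> simp only [Matrix.sub_apply, matQ] <;> simp [c] <;> assumption

/-- In the unknown `n = Ŷ⁻¹ m` the limiting coefficient matrix is diagonal, and only `Q(u) - Q(v)`,
conjugated by `Ŷ`, remains as a perturbation. -/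
theorem isColumn_of_volterra {q₀ : ℝ} (hq₀ : 0 < q₀) {u : ℝ → V2} {v : V2} (hv : ‖v‖ = q₀)
    {j : Fin 3} {z : ℂ} (hz : z ∈ regularSet q₀) {n : ℝ → Fin 3 → ℂ}
    (hn : ∀ x l, HasDerivAt (fun x => n x l) (I * (expo q₀ z l - expo q₀ z j) * n x l +
      ∑ i, (matYinv q₀ v z * (I • (matQ (u x) - matQ v)) * matY q₀ v z) l i * n x i) x)
    (hlim : Tendsto n atTop (𝓝 (Pi.single j 1))) :
    IsColumn q₀ u v j z fun x => (matY q₀ v z).mulVec (n x) := by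
  constructor
  · intro x i
    have h1 : HasDerivAt (fun y => (matY q₀ v z).mulVec (n y) i)
        (∑ l, matY q₀ v z i l * (I * (expo q₀ z l - expo q₀ z j) * n x l +
          ∑ i, (matYinv q₀ v z * (I • (matQ (u x) - matQ v)) * matY q₀ v z) l i * n x i)) x := by
      simp only [Matrix.mulVec, dotProduct]
      exact HasDerivAt.fun_sum fun l _ => (hn x l).const_mul _
    convert! h1 using 1
    have h2 : laxX q₀ z (u x) = laxX q₀ z v + I • (matQ (u x) - matQ v) := by
      simp only [laxX, smul_sub]
      abel
    have h3 : matY q₀ v z * (matYinv q₀ v z * (I • (matQ (u x) - matQ v)) * matY q₀ v z) =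
        (I • (matQ (u x) - matQ v)) * matY q₀ v z := by
      rw [← mul_assoc, ← mul_assoc, matY_mul_matYinv hq₀ hv hz, one_mul]
    have h4 : ∑ l, matY q₀ v z i l *
          ∑ i, (matYinv q₀ v z * (I • (matQ (u x) - matQ v)) * matY q₀ v z) l i * n x i =
        ((I • (matQ (u x) - matQ v)) * matY q₀ v z).mulVec (n x) i := by
      rw [← h3, ← Matrix.mulVec_mulVec]
      rfl
    have h5 : (laxX q₀ z v * matY q₀ v z).mulVec (n x) i =
        ∑ l, matY q₀ v z i l * (I * expo q₀ z l * n x l) := by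
      simp only [Matrix.mulVec, dotProduct, laxX_mul_matY hq₀ hv hz, mul_assoc]
    simp only [mul_add, Finset.sum_add_distrib]
    rw [h4, Matrix.mulVec_mulVec, h2, add_mul, Matrix.add_mulVec, Pi.add_apply, h5]
    simp only [Matrix.mulVec, dotProduct, Finset.mul_sum]
    rw [add_sub_right_comm, ← Finset.sum_sub_distrib]
    congr 1
    exact Finset.sum_congr rfl fun l _ => by ring
  · have h1 : Continuous fun w : Fin 3 → ℂ => (matY q₀ v z).mulVec w := by fun_prop
    convert! (h1.tendsto _).comp hlim using 2
    ext i
    simp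

/-- The sign condition `hre` is the one that selects the region for each column: it keeps all
Volterra kernels bounded by one. -/
theorem exists_columns {q₀ : ℝ} (hq₀ : 0 < q₀) {u : ℝ → V2} {v : V2} (hv : ‖v‖ = q₀)
    (huc : Continuous u) (hui : IntegrableOn (fun x => u x - v) (Ioi 0)) (j : Fin 3)
    {D : Set ℂ} (hD : D ⊆ regularSet q₀)
    (hre : ∀ z ∈ D, ∀ l, 0 ≤ (I * (expo q₀ z l - expo q₀ z j)).re) :
    ∃ m : ℂ → ℝ → Fin 3 → ℂ, (∀ z ∈ D, IsColumn q₀ u v j z (m z)) ∧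
      ∀ x i, ContinuousOn (fun z => m z x i) D ∧
        DifferentiableOn ℂ (fun z => m z x i) (interior D) := by
  have hDi : interior D ⊆ regularSet q₀ := interior_subset.trans hD
  have hWd : ∀ x i l, DifferentiableOn ℂ (fun z => (matYinv q₀ v z *
      (I • (matQ (u x) - matQ v)) * matY q₀ v z) i l) (regularSet q₀) := by
    intro x i l
    simp only [Matrix.mul_apply]
    exact DifferentiableOn.fun_sum fun p _ => DifferentiableOn.mul (DifferentiableOn.fun_sum
      fun s _ => (differentiableOn_matYinv q₀ v i s).mul (differentiableOn_const _))
      (differentiableOn_matY q₀ v p l)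
  have hEd : ∀ l, DifferentiableOn ℂ (fun z => I * (expo q₀ z l - expo q₀ z j)) (regularSet q₀) :=
    fun l => ((differentiableOn_expo q₀ l).sub (differentiableOn_expo q₀ j)).const_mul I
  have hY : ∀ (B : M3) (i l : Fin 3), ‖B i l‖ ≤ ∑ p, ∑ s, ‖B p s‖ := fun B i l =>
    (Finset.single_le_sum (f := fun s => ‖B i s‖) (fun _ _ => norm_nonneg _)
      (Finset.mem_univ l)).trans (Finset.single_le_sum (f := fun p => ∑ s, ‖B p s‖)
        (fun _ _ => Finset.sum_nonneg fun _ _ => norm_nonneg _) (Finset.mem_univ i))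
  have data : VolterraData D (fun z l => I * (expo q₀ z l - expo q₀ z j))
      (fun z x => (matYinv q₀ v z * (I • (matQ (u x) - matQ v)) * matY q₀ v z))
      -- The factor 9 counts the index pairs in an entry of the triple product; each matrix entry is
      -- bounded by the sum of all of them, which is continuous in `z`.
      (fun z => 9 * ((∑ p, ∑ s, ‖matYinv q₀ v z p s‖) * ∑ p, ∑ s, ‖matY q₀ v z p s‖))
      (fun x => ‖u x - v‖) (Pi.single j 1) :=
    { re_nonneg := hre
      mul_eq_zero := by
        intro z _ l
        by_cases h : l = j
        · subst h; simp
        · simp [h]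
      norm_le_one := by
        refine (pi_norm_le_iff_of_nonneg zero_le_one).2 fun l => ?_
        by_cases h : l = j
        · subst h; simp
        · simp [h]
      continuousOn_exponent := fun l => (hEd l).continuousOn.mono hD
      differentiableOn_exponent := fun l => (hEd l).mono hDi
      norm_coeff_le := by
        intro z _ x i l
        have hterm : ∀ p s, ‖matYinv q₀ v z i s * (I * (matQ (u x) - matQ v) s p) *
            matY q₀ v z p l‖ ≤ (∑ p, ∑ s, ‖matYinv q₀ v z p s‖) *
            (∑ p, ∑ s, ‖matY q₀ v z p s‖) * ‖u x - v‖ := by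
          intro p s
          rw [norm_mul, norm_mul, norm_mul, norm_I, one_mul, mul_right_comm]
          have h1 := hY (matYinv q₀ v z) i s
          have h2 := hY (matY q₀ v z) p l
          have h3 := norm_matQ_sub_le (u x) v s p
          have h4 := (norm_nonneg _).trans h1
          gcongr
        have hexp : (matYinv q₀ v z * (I • (matQ (u x) - matQ v)) * matY q₀ v z) i l =
            ∑ p, ∑ s, matYinv q₀ v z i s * (I * (matQ (u x) - matQ v) s p) * matY q₀ v z p l := by
          simp only [Matrix.mul_apply, Matrix.smul_apply, smul_eq_mul, Finset.sum_mul]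
        rw [hexp]
        refine (norm_sum_le _ _).trans ((Finset.sum_le_sum fun p _ => (norm_sum_le _ _).trans
          (Finset.sum_le_sum fun s _ => hterm p s)).trans (le_of_eq ?_))
        simp only [Finset.sum_const, Finset.card_univ, Fintype.card_fin, nsmul_eq_mul]
        push_cast
        ring
      continuous_coeff := by
        intro z _ i l
        have hQ : ∀ s p, Continuous fun x => (matQ (u x) - matQ v) s p := by
          have h0 : Continuous fun x => u x 0 := by fun_prop
          have h1 : Continuous fun x => u x 1 := by fun_prop
          intro s p
          fin_cases s <;> fin_cases p <;> simp [matQ] <;> fun_prop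
        simp only [Matrix.mul_apply, Matrix.smul_apply, smul_eq_mul]
        exact continuous_finsetSum _ fun p _ => (continuous_finsetSum _ fun s _ =>
          continuous_const.mul (continuous_const.mul (hQ s p))).mul continuous_const
      continuousOn_coeff := fun x i l => (hWd x i l).continuousOn.mono hD
      differentiableOn_coeff := fun x i l => (hWd x i l).mono hDi
      continuousOn_bound := by
        refine continuousOn_const.mul (ContinuousOn.mul ?_ ?_)
        · exact continuousOn_finsetSum _ fun p _ => continuousOn_finsetSum _ fun s _ =>
            ((differentiableOn_matYinv q₀ v p s).continuousOn.mono hD).norm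
        · exact continuousOn_finsetSum _ fun p _ => continuousOn_finsetSum _ fun s _ =>
            ((differentiableOn_matY q₀ v p s).continuousOn.mono hD).norm
      bound_nonneg := fun z _ => by positivity
      continuous_density := by fun_prop
      density_nonneg := fun x => norm_nonneg _
      integrable_density := fun x =>
        (integrableOn_Ioi_of_continuous (by fun_prop) hui x).norm }
  obtain ⟨n, hn, hlim, hreg⟩ := data.exists_solution
  refine ⟨fun z x => (matY q₀ v z).mulVec (n z x), fun z hz =>
    isColumn_of_volterra hq₀ hv (hD hz) (hn z hz) (hlim z hz), fun x i => ⟨?_, ?_⟩⟩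
  · simp only [Matrix.mulVec, dotProduct]
    exact continuousOn_finsetSum _ fun l _ =>
      ((differentiableOn_matY q₀ v i l).continuousOn.mono hD).mul (hreg x l).1
  · simp only [Matrix.mulVec, dotProduct]
    exact DifferentiableOn.fun_sum fun l _ =>
      ((differentiableOn_matY q₀ v i l).mono hDi).mul (hreg x l).2

/-! ### A priori estimates for large spectral parameter -/

/-- Estimate for a scalar equation `r' = A r + f` integrated from `+∞`. -/
theorem norm_sub_le_integral_of_hasDerivAt {A e : ℂ} {r f : ℝ → ℂ} {F : ℝ → ℝ}
    (hA : 0 ≤ A.re) (he : A * e = 0) (hr : ∀ x, HasDerivAt r (A * r x + f x) x)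
    (hf : Continuous f) (hlim : Tendsto r atTop (𝓝 e)) (hF : IntegrableOn F (Ioi 0))
    (hfF : ∀ x, 0 ≤ x → ‖f x‖ ≤ F x) {x : ℝ} (hx : 0 ≤ x) :
    ‖r x - e‖ ≤ ∫ y in Ioi 0, F y := by
  have hexp : ∀ y : ℝ, HasDerivAt (fun y : ℝ => exp (A * ((x - y : ℝ) : ℂ)))
      (-A * exp (A * ((x - y : ℝ) : ℂ))) y := by
    intro y
    have h1 := hasDerivAt_exp_mul_sub (-A) x y
    have h2 : ∀ y : ℝ, -A * ((y - x : ℝ) : ℂ) = A * ((x - y : ℝ) : ℂ) := fun y => by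
      push_cast
      ring
    simpa only [h2] using h1
  -- An integrating factor applied to `r - e`, which obeys the same equation as `r` because `A * e =
  -- 0`.
  have hd : ∀ y ∈ Ici x, HasDerivAt (fun y : ℝ => exp (A * ((x - y : ℝ) : ℂ)) * (r y - e))
      (exp (A * ((x - y : ℝ) : ℂ)) * f y) y := by
    intro y _
    convert! (hexp y).mul ((hr y).sub_const e) using 1
    linear_combination exp (A * ((x - y : ℝ) : ℂ)) * -he
  have hle : ∀ y, x ≤ y → ‖exp (A * ((x - y : ℝ) : ℂ))‖ ≤ 1 := fun y hy =>
    norm_exp_mul_le_one hA (by linarith)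
  have hFx : IntegrableOn F (Ioi x) := hF.mono_set (Ioi_subset_Ioi hx)
  have hbd : ∀ᵐ y ∂volume.restrict (Ioi x), ‖exp (A * ((x - y : ℝ) : ℂ)) * f y‖ ≤ F y := by
    filter_upwards [ae_restrict_mem measurableSet_Ioi] with y hy
    have hy : x < y := hy
    rw [norm_mul]
    exact (mul_le_of_le_one_left (norm_nonneg _) (hle y hy.le)).trans (hfF y (hx.trans hy.le))
  have hint : IntegrableOn (fun y : ℝ => exp (A * ((x - y : ℝ) : ℂ)) * f y) (Ioi x) :=
    Integrable.mono' hFx (by fun_prop) hbd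
  have hzero : Tendsto (fun y : ℝ => exp (A * ((x - y : ℝ) : ℂ)) * (r y - e)) atTop (𝓝 0) := by
    refine squeeze_zero_norm' (a := fun y => ‖r y - e‖) ?_
      (tendsto_iff_norm_sub_tendsto_zero.1 hlim)
    filter_upwards [eventually_ge_atTop x] with y hy
    rw [norm_mul]
    exact mul_le_of_le_one_left (norm_nonneg _) (hle y hy)
  have h1 := integral_Ioi_of_hasDerivAt_of_tendsto' hd hint hzero
  simp only [sub_self, ofReal_zero, mul_zero, Complex.exp_zero, one_mul, zero_sub] at h1
  rw [← norm_neg, ← h1]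
  refine (norm_integral_le_of_norm_le hFx hbd).trans ?_
  refine setIntegral_mono_set hF ?_ (Ioi_subset_Ioi hx).eventuallyLE
  filter_upwards [ae_restrict_mem measurableSet_Ioi] with y hy
  exact (norm_nonneg _).trans (hfF y (mem_Ioi.1 hy).le)

/-- Absorbing half of a bounded quantity. -/
theorem le_of_bound_improves {X : Type*} [Nonempty X] {f : X → ℝ} (hb : BddAbove (range f))
    {B : ℝ} (h : ∀ K, (∀ x, f x ≤ K) → ∀ x, f x ≤ B + K / 2) (x : X) : f x ≤ 2 * B := by
  have h1 : ∀ x, f x ≤ ⨆ x, f x := fun x => le_ciSup hb x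
  have h2 : (⨆ x, f x) ≤ B + (⨆ x, f x) / 2 := ciSup_le (h _ h1)
  linarith [h1 x]

/-- `f` is twice continuously differentiable with derivatives `f₁`, `f₂`, tends to `c` at `+∞`,
and `f - c`, `f₁`, `f₂` are integrable at `+∞`. -/
structure IsTail (f f₁ f₂ : ℝ → ℂ) (c : ℂ) : Prop where
  hasDerivAt : ∀ x, HasDerivAt f (f₁ x) x
  hasDerivAt₁ : ∀ x, HasDerivAt f₁ (f₂ x) x
  continuous₂ : Continuous f₂
  tendsto : Tendsto f atTop (𝓝 c)
  integrableOn : IntegrableOn (fun x => f x - c) (Ioi 0)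
  integrableOn₁ : IntegrableOn f₁ (Ioi 0)
  integrableOn₂ : IntegrableOn f₂ (Ioi 0)

theorem exists_norm_le_of_tendsto {E : Type*} [NormedAddCommGroup E] {f : ℝ → E} {c : E}
    (hc : Continuous f) (h : Tendsto f atTop (𝓝 c)) : ∃ C, ∀ x, 0 ≤ x → ‖f x‖ ≤ C := by
  obtain ⟨N, hN⟩ := (h.norm.eventually (gt_mem_nhds (lt_add_one ‖c‖))).exists_forall_of_atTop
  obtain ⟨C, hC⟩ := (isCompact_Icc (a := (0 : ℝ)) (b := N)).exists_bound_of_continuousOn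
    hc.continuousOn
  refine ⟨max C (‖c‖ + 1), fun x hx => ?_⟩
  rcases le_total x N with hxN | hxN
  · exact (hC x ⟨hx, hxN⟩).trans (le_max_left _ _)
  · exact (hN x hxN).le.trans (le_max_right _ _)

namespace IsTail

variable {f f₁ f₂ : ℝ → ℂ} {c : ℂ}

theorem continuous (h : IsTail f f₁ f₂ c) : Continuous f :=
  continuous_iff_continuousAt.2 fun x => (h.hasDerivAt x).continuousAt

theorem continuous₁ (h : IsTail f f₁ f₂ c) : Continuous f₁ :=
  continuous_iff_continuousAt.2 fun x => (h.hasDerivAt₁ x).continuousAt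

/-- An integrable function with integrable derivative vanishes at infinity. Hence the corrections
containing `q_x` do not affect the limits of the diagonal quantities. -/
theorem tendsto₁ (h : IsTail f f₁ f₂ c) : Tendsto f₁ atTop (𝓝 0) :=
  tendsto_zero_of_hasDerivAt_of_integrableOn_Ioi (fun x _ => h.hasDerivAt₁ x) h.integrableOn₂
    h.integrableOn₁

theorem exists_bound (h : IsTail f f₁ f₂ c) : ∃ C, ∀ x, 0 ≤ x → ‖f x‖ ≤ C ∧ ‖f₁ x‖ ≤ C := by
  obtain ⟨C, hC⟩ := exists_norm_le_of_tendsto h.continuous h.tendsto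
  obtain ⟨C₁, hC₁⟩ := exists_norm_le_of_tendsto h.continuous₁ h.tendsto₁
  exact ⟨max C C₁, fun x hx => ⟨(hC x hx).trans (le_max_left _ _),
    (hC₁ x hx).trans (le_max_right _ _)⟩⟩

end IsTail

/-! The quantities in which the system is diagonal up to integrable terms. Here `a`, `b`, `d` are
the components of a column, `p`, `r` those of the potential, and `p'`, `r'` their conjugates. -/

section Diagonal

variable {p p₁ p₂ p' p₁' p₂' r r₁ r₂ r' r₁' r₂' a b d : ℝ → ℂ} {q₀ : ℝ} {z δ : ℂ} {x : ℝ}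

/-- Since `k + λ = z`, the first correction cancels the coupling of `a` to `b`, `d` at order one and
creates a term `-q_x† b / z`, which the second correction removes. The discrepancy `k - λ = q₀²/z`
combines with `|q|²` into an integrable coefficient. -/
theorem hasDerivAt_alpha (hz : z ≠ 0)
    (hp' : HasDerivAt p' (p₁' x) x) (hp₁' : HasDerivAt p₁' (p₂' x) x)
    (hr' : HasDerivAt r' (r₁' x) x) (hr₁' : HasDerivAt r₁' (r₂' x) x)
    (ha : HasDerivAt a (I * (kz q₀ z - δ) * a x - I * (p' x * b x + r' x * d x)) x)
    (hb : HasDerivAt b (-I * (kz q₀ z + δ) * b x + I * p x * a x) x)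
    (hd : HasDerivAt d (-I * (kz q₀ z + δ) * d x + I * r x * a x) x) :
    HasDerivAt (fun x => a x - (p' x * b x + r' x * d x) / z
        + I / z ^ 2 * (p₁' x * b x + r₁' x * d x))
      (I * (lamz q₀ z - δ) * (a x - (p' x * b x + r' x * d x) / z
        + I / z ^ 2 * (p₁' x * b x + r₁' x * d x)) +
        (I / z * (((q₀ : ℂ) ^ 2 - (p x * p' x + r x * r' x)) * a x) +
          I / z ^ 2 * ((p₂' x * b x + r₂' x * d x) +
            I * ((p₁' x * p x + r₁' x * r x) * a x)))) x := by
  have h := (ha.fun_sub (((hp'.fun_mul hb).fun_add (hr'.fun_mul hd)).div_const z)).fun_add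
    (((hp₁'.fun_mul hb).fun_add (hr₁'.fun_mul hd)).const_mul (I / z ^ 2))
  convert! h using 1
  simp only [kz, lamz]
  field_simp
  ring_nf
  simp only [I_sq]
  ring

/-- Here `2 k / z = 1 + q₀²/z²` does the cancelling. The rank-one coupling `q q† β / z` is not
integrable in `x` and has to be kept; it is dealt with by projecting on the limit vector and its
orthogonal complement. -/
theorem hasDerivAt_beta {s s₁ s₂ e : ℝ → ℂ} (hz : z ≠ 0)
    (hs : HasDerivAt s (s₁ x) x) (hs₁ : HasDerivAt s₁ (s₂ x) x)
    (ha : HasDerivAt a (I * (kz q₀ z - δ) * a x - I * (p' x * b x + r' x * d x)) x)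
    (he : HasDerivAt e (-I * (kz q₀ z + δ) * e x + I * s x * a x) x) :
    HasDerivAt (fun x => e x - s x * a x / z - I / z ^ 2 * (s₁ x * a x))
      (-I * (kz q₀ z + δ) * (e x - s x * a x / z - I / z ^ 2 * (s₁ x * a x)) +
        (I / z * (s x * (p' x * (b x - p x * a x / z - I / z ^ 2 * (p₁ x * a x)) +
          r' x * (d x - r x * a x / z - I / z ^ 2 * (r₁ x * a x)))) +
        (-(s x * (p' x * p₁ x + r' x * r₁ x) * a x) / z ^ 3 +
          I / z ^ 2 * (s x * ((p x * p' x + r x * r' x) - (q₀ : ℂ) ^ 2) * a x) +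
          (q₀ : ℂ) ^ 2 * s₁ x * a x / z ^ 3 -
          I / z ^ 2 * (s₂ x * a x - I * s₁ x * (p' x * b x + r' x * d x))))) x := by
  have h := (he.fun_sub ((hs.fun_mul ha).div_const z)).fun_sub
    ((hs₁.fun_mul ha).const_mul (I / z ^ 2))
  convert! h using 1
  simp only [kz]
  field_simp
  ring_nf
  simp only [I_sq]
  ring

end Diagonal

/-! ### Sizes of the forcing terms -/

section Forcing

variable {p p₁ p₂ r r₁ r₂ c₀ c₁ a b d z β₀ β₁ : ℂ} {q₀ U g K : ℝ}

/-- The limit vector has norm `q₀`, so the difference of squares is controlled linearly by the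
distance to the limit and is integrable. -/
theorem norm_sub_mul_conj_le (hn : c₀ * conj c₀ + c₁ * conj c₁ = (q₀ : ℂ) ^ 2)
    (hp : ‖p‖ ≤ U) (hr : ‖r‖ ≤ U) (hc₀ : ‖c₀‖ ≤ U) (hc₁ : ‖c₁‖ ≤ U)
    (hpg : ‖p - c₀‖ ≤ g) (hrg : ‖r - c₁‖ ≤ g) :
    ‖(q₀ : ℂ) ^ 2 - (p * conj p + r * conj r)‖ ≤ 4 * U * g := by
  have h1 : (q₀ : ℂ) ^ 2 - (p * conj p + r * conj r) =
      -(((p - c₀) * conj c₀ + p * conj (p - c₀)) + ((r - c₁) * conj c₁ + r * conj (r - c₁))) := by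
    rw [← hn, map_sub, map_sub]
    ring
  rw [h1, norm_neg]
  have e1 := norm_mul_le_of_le hpg ((norm_conj c₀).trans_le hc₀)
  have e2 := norm_mul_le_of_le hp ((norm_conj (p - c₀)).trans_le hpg)
  have e3 := norm_mul_le_of_le hrg ((norm_conj c₁).trans_le hc₁)
  have e4 := norm_mul_le_of_le hr ((norm_conj (r - c₁)).trans_le hrg)
  exact (norm_add_le_of_le (norm_add_le_of_le e1 e2) (norm_add_le_of_le e3 e4)).trans
    (le_of_eq (by ring))

/-- The pointwise size of `a` is kept apart from the uniform bound `K`, so that once `a` is known to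
be `O(1/z)` the whole forcing becomes `O(1/z²)`. -/
theorem norm_forcing_alpha_le (hn : c₀ * conj c₀ + c₁ * conj c₁ = (q₀ : ℂ) ^ 2)
    (hU : 1 ≤ U) (hp : ‖p‖ ≤ U) (hr : ‖r‖ ≤ U) (hc₀ : ‖c₀‖ ≤ U) (hc₁ : ‖c₁‖ ≤ U)
    (hpg : ‖p - c₀‖ ≤ g) (hrg : ‖r - c₁‖ ≤ g) (hp₁ : ‖p₁‖ ≤ g) (hr₁ : ‖r₁‖ ≤ g) (hp₂ : ‖p₂‖ ≤ g)
    (hr₂ : ‖r₂‖ ≤ g) (ha : ‖a‖ ≤ K) (hb : ‖b‖ ≤ K) (hd : ‖d‖ ≤ K) :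
    ‖I / z * (((q₀ : ℂ) ^ 2 - (p * conj p + r * conj r)) * a) +
      I / z ^ 2 * ((conj p₂ * b + conj r₂ * d) + I * ((conj p₁ * p + conj r₁ * r) * a))‖ ≤
      4 * U * g * (‖a‖ / ‖z‖ + K / ‖z‖ ^ 2) := by
  have hg : 0 ≤ g := (norm_nonneg _).trans hpg
  have hK : 0 ≤ K := (norm_nonneg _).trans ha
  have e1 := norm_mul_le_of_le (norm_sub_mul_conj_le hn hp hr hc₀ hc₁ hpg hrg) (le_refl ‖a‖)
  have e2 := norm_add_le_of_le (norm_mul_le_of_le ((norm_conj p₂).trans_le hp₂) hb)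
    (norm_mul_le_of_le ((norm_conj r₂).trans_le hr₂) hd)
  have e3 := norm_mul_le_of_le norm_I.le (norm_mul_le_of_le (norm_add_le_of_le
    (norm_mul_le_of_le ((norm_conj p₁).trans_le hp₁) hp)
    (norm_mul_le_of_le ((norm_conj r₁).trans_le hr₁) hr)) ha)
  have i1 : ‖I / z‖ = 1 / ‖z‖ := by rw [norm_div, norm_I]
  have i2 : ‖I / z ^ 2‖ = 1 / ‖z‖ ^ 2 := by rw [norm_div, norm_I, norm_pow]
  refine (norm_add_le_of_le (norm_mul_le_of_le i1.le e1)
    (norm_mul_le_of_le i2.le (norm_add_le_of_le e2 e3))).trans ?_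
  have h4 : g * K + g * K + 1 * ((g * U + g * U) * K) ≤ 4 * U * g * K := by
    nlinarith [mul_nonneg (mul_nonneg hg hK) (sub_nonneg.2 hU)]
  calc 1 / ‖z‖ * (4 * U * g * ‖a‖) + 1 / ‖z‖ ^ 2 * (g * K + g * K + 1 * ((g * U + g * U) * K))
      ≤ 1 / ‖z‖ * (4 * U * g * ‖a‖) + 1 / ‖z‖ ^ 2 * (4 * U * g * K) := by gcongr
    _ = _ := by ring

/-- The constant 10 is the sum 2 + 4 + 1 + 3 from the four terms, lower powers of `U` being raised
to `U ^ 2` by `1 ≤ U`. -/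
theorem norm_remainder_beta_le (hn : c₀ * conj c₀ + c₁ * conj c₁ = (q₀ : ℂ) ^ 2)
    (hU : 1 ≤ U) (hq : q₀ ^ 2 ≤ U) (hz : 1 ≤ ‖z‖)
    (hp : ‖p‖ ≤ U) (hr : ‖r‖ ≤ U) (hc₀ : ‖c₀‖ ≤ U) (hc₁ : ‖c₁‖ ≤ U)
    (hpg : ‖p - c₀‖ ≤ g) (hrg : ‖r - c₁‖ ≤ g) (hp₁ : ‖p₁‖ ≤ g) (hr₁ : ‖r₁‖ ≤ g)
    (ha : ‖a‖ ≤ K) (hb : ‖b‖ ≤ K) (hd : ‖d‖ ≤ K) {s s₁ s₂ : ℂ} (hs : ‖s‖ ≤ U) (hs₁ : ‖s₁‖ ≤ g)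
    (hs₂ : ‖s₂‖ ≤ g) :
    ‖-(s * (conj p * p₁ + conj r * r₁) * a) / z ^ 3 +
      I / z ^ 2 * (s * ((p * conj p + r * conj r) - (q₀ : ℂ) ^ 2) * a) +
      (q₀ : ℂ) ^ 2 * s₁ * a / z ^ 3 -
      I / z ^ 2 * (s₂ * a - I * s₁ * (conj p * b + conj r * d))‖ ≤
      10 * U ^ 2 * g * K / ‖z‖ ^ 2 := by
  have hg : 0 ≤ g := (norm_nonneg _).trans hpg
  have hK : 0 ≤ K := (norm_nonneg _).trans ha
  have hz0 : 0 < ‖z‖ := by linarith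
  have i2 : ‖I / z ^ 2‖ = 1 / ‖z‖ ^ 2 := by rw [norm_div, norm_I, norm_pow]
  have i3 : ‖(z ^ 3)⁻¹‖ ≤ 1 / ‖z‖ ^ 2 := by
    rw [norm_inv, norm_pow, ← one_div]
    exact one_div_le_one_div_of_le (by positivity) (pow_le_pow_right₀ hz (by norm_num))
  have e1 : ‖-(s * (conj p * p₁ + conj r * r₁) * a)‖ ≤ U * (U * g + U * g) * K := by
    rw [norm_neg]
    exact norm_mul_le_of_le (norm_mul_le_of_le hs (norm_add_le_of_le
      (norm_mul_le_of_le ((norm_conj p).trans_le hp) hp₁)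
      (norm_mul_le_of_le ((norm_conj r).trans_le hr) hr₁))) ha
  have e2 : ‖s * ((p * conj p + r * conj r) - (q₀ : ℂ) ^ 2) * a‖ ≤ U * (4 * U * g) * K := by
    refine norm_mul_le_of_le (norm_mul_le_of_le hs ?_) ha
    rw [norm_sub_rev]
    exact norm_sub_mul_conj_le hn hp hr hc₀ hc₁ hpg hrg
  have e3 : ‖(q₀ : ℂ) ^ 2 * s₁ * a‖ ≤ U * g * K := by
    refine norm_mul_le_of_le (norm_mul_le_of_le ?_ hs₁) ha
    rw [norm_pow, norm_real, Real.norm_eq_abs, sq_abs]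
    exact hq
  have e4 : ‖s₂ * a - I * s₁ * (conj p * b + conj r * d)‖ ≤
      g * K + 1 * g * (U * K + U * K) :=
    norm_sub_le_of_le (norm_mul_le_of_le hs₂ ha) (norm_mul_le_of_le
      (norm_mul_le_of_le norm_I.le hs₁) (norm_add_le_of_le
      (norm_mul_le_of_le ((norm_conj p).trans_le hp) hb)
      (norm_mul_le_of_le ((norm_conj r).trans_le hr) hd)))
  rw [div_eq_mul_inv, div_eq_mul_inv ((q₀ : ℂ) ^ 2 * s₁ * a)]
  refine (norm_sub_le_of_le (norm_add_le_of_le (norm_add_le_of_le (norm_mul_le_of_le e1 i3)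
    (norm_mul_le_of_le i2.le e2)) (norm_mul_le_of_le e3 i3)) (norm_mul_le_of_le i2.le e4)).trans ?_
  have h4 : U * (U * g + U * g) * K + U * (4 * U * g) * K + U * g * K +
      (g * K + 1 * g * (U * K + U * K)) ≤ 10 * U ^ 2 * g * K := by
    nlinarith [mul_nonneg (mul_nonneg hg hK) (sub_nonneg.2 hU),
      mul_nonneg (mul_nonneg hg hK) (mul_nonneg (by linarith : 0 ≤ U) (sub_nonneg.2 hU))]
  calc _ = (U * (U * g + U * g) * K + U * (4 * U * g) * K + U * g * K +
      (g * K + 1 * g * (U * K + U * K))) / ‖z‖ ^ 2 := by ring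
    _ ≤ _ := by gcongr

/-- The rank-one coupling has range along `q`, and the functional `(c₁, -c₀)` annihilates the limit
of `q`; what survives is proportional to the distance to the limit. -/
theorem norm_forcing_perp_le (hq₀ : 0 < q₀) (hU : 1 ≤ U)
    (hp : ‖p‖ ≤ U) (hr : ‖r‖ ≤ U) (hc₀ : ‖c₀‖ ≤ U) (hc₁ : ‖c₁‖ ≤ U)
    (hpg : ‖p - c₀‖ ≤ g) (hrg : ‖r - c₁‖ ≤ g) {f₀ f₁ : ℂ}
    (hf₀ : ‖f₀‖ ≤ 10 * U ^ 2 * g * K / ‖z‖ ^ 2) (hf₁ : ‖f₁‖ ≤ 10 * U ^ 2 * g * K / ‖z‖ ^ 2) :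
    ‖(c₁ * (I / z * (p * (conj p * β₀ + conj r * β₁)) + f₀) -
      c₀ * (I / z * (r * (conj p * β₀ + conj r * β₁)) + f₁)) / q₀‖ ≤
      20 * U ^ 3 / q₀ * g * ((‖β₀‖ + ‖β₁‖) / ‖z‖ + K / ‖z‖ ^ 2) := by
  have hg : 0 ≤ g := (norm_nonneg _).trans hpg
  have i1 : ‖I / z‖ = 1 / ‖z‖ := by rw [norm_div, norm_I]
  have h1 : c₁ * (I / z * (p * (conj p * β₀ + conj r * β₁)) + f₀) -
      c₀ * (I / z * (r * (conj p * β₀ + conj r * β₁)) + f₁) =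
      I / z * ((c₁ * (p - c₀) - c₀ * (r - c₁)) * (conj p * β₀ + conj r * β₁)) +
        (c₁ * f₀ - c₀ * f₁) := by ring
  rw [h1, norm_div, norm_real, Real.norm_of_nonneg hq₀.le, div_le_iff₀ hq₀]
  refine (norm_add_le_of_le (norm_mul_le_of_le i1.le (norm_mul_le_of_le (norm_sub_le_of_le
    (norm_mul_le_of_le hc₁ hpg) (norm_mul_le_of_le hc₀ hrg)) (norm_add_le_of_le
    (norm_mul_le_of_le ((norm_conj p).trans_le hp) (le_refl ‖β₀‖))
    (norm_mul_le_of_le ((norm_conj r).trans_le hr) (le_refl ‖β₁‖)))))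
    (norm_sub_le_of_le (norm_mul_le_of_le hc₁ hf₀) (norm_mul_le_of_le hc₀ hf₁))).trans ?_
  have hU2 : 2 * U ^ 2 ≤ 20 * U ^ 3 := by nlinarith [sq_nonneg U]
  calc _ = 2 * U ^ 2 * (g * ((‖β₀‖ + ‖β₁‖) / ‖z‖)) + 20 * U ^ 3 * g * (K / ‖z‖ ^ 2) := by ring
    _ ≤ 20 * U ^ 3 * (g * ((‖β₀‖ + ‖β₁‖) / ‖z‖)) + 20 * U ^ 3 * g * (K / ‖z‖ ^ 2) := by gcongr
    _ = _ := by field_simp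

/-- On the limit vector the rank-one coupling acts as multiplication by `q₀²`. This part is
subtracted, to be moved into the exponent; the rest is integrable. -/
theorem norm_forcing_parallel_le (hn : c₀ * conj c₀ + c₁ * conj c₁ = (q₀ : ℂ) ^ 2)
    (hq₀ : 0 < q₀) (hU : 1 ≤ U) (hq : q₀ ^ 2 ≤ U)
    (hp : ‖p‖ ≤ U) (hr : ‖r‖ ≤ U) (hc₀ : ‖c₀‖ ≤ U) (hc₁ : ‖c₁‖ ≤ U)
    (hpg : ‖p - c₀‖ ≤ g) (hrg : ‖r - c₁‖ ≤ g) {f₀ f₁ : ℂ}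
    (hf₀ : ‖f₀‖ ≤ 10 * U ^ 2 * g * K / ‖z‖ ^ 2) (hf₁ : ‖f₁‖ ≤ 10 * U ^ 2 * g * K / ‖z‖ ^ 2) :
    ‖(conj c₀ * (I / z * (p * (conj p * β₀ + conj r * β₁)) + f₀) +
      conj c₁ * (I / z * (r * (conj p * β₀ + conj r * β₁)) + f₁) -
      I * (q₀ : ℂ) ^ 2 / z * (conj c₀ * β₀ + conj c₁ * β₁)) / q₀‖ ≤
      20 * U ^ 3 / q₀ * g * ((‖β₀‖ + ‖β₁‖) / ‖z‖ + K / ‖z‖ ^ 2) := by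
  have hg : 0 ≤ g := (norm_nonneg _).trans hpg
  have i1 : ‖I / z‖ = 1 / ‖z‖ := by rw [norm_div, norm_I]
  have h1 : conj c₀ * (I / z * (p * (conj p * β₀ + conj r * β₁)) + f₀) +
      conj c₁ * (I / z * (r * (conj p * β₀ + conj r * β₁)) + f₁) -
      I * (q₀ : ℂ) ^ 2 / z * (conj c₀ * β₀ + conj c₁ * β₁) =
      I / z * ((conj c₀ * (p - c₀) + conj c₁ * (r - c₁)) * (conj p * β₀ + conj r * β₁) +
        (q₀ : ℂ) ^ 2 * (conj (p - c₀) * β₀ + conj (r - c₁) * β₁)) +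
        (conj c₀ * f₀ + conj c₁ * f₁) := by
    rw [map_sub, map_sub]
    linear_combination (I / z * (conj p * β₀ + conj r * β₁)) * hn
  have hq' : ‖(q₀ : ℂ) ^ 2‖ ≤ U := by
    rw [norm_pow, norm_real, Real.norm_eq_abs, sq_abs]
    exact hq
  rw [h1, norm_div, norm_real, Real.norm_of_nonneg hq₀.le, div_le_iff₀ hq₀]
  have hc₀' := (norm_conj c₀).trans_le hc₀
  have hc₁' := (norm_conj c₁).trans_le hc₁
  refine (norm_add_le_of_le (norm_mul_le_of_le i1.le (norm_add_le_of_le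
    (norm_mul_le_of_le (norm_add_le_of_le
    (norm_mul_le_of_le hc₀' hpg) (norm_mul_le_of_le hc₁' hrg)) (norm_add_le_of_le
    (norm_mul_le_of_le ((norm_conj p).trans_le hp) (le_refl ‖β₀‖))
    (norm_mul_le_of_le ((norm_conj r).trans_le hr) (le_refl ‖β₁‖))))
    (norm_mul_le_of_le hq' (norm_add_le_of_le
      (norm_mul_le_of_le ((norm_conj (p - c₀)).trans_le hpg) (le_refl ‖β₀‖))
      (norm_mul_le_of_le ((norm_conj (r - c₁)).trans_le hrg) (le_refl ‖β₁‖))))))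
    (norm_add_le_of_le (norm_mul_le_of_le hc₀' hf₀) (norm_mul_le_of_le hc₁' hf₁))).trans ?_
  have hU2 : 2 * U ^ 2 + U ≤ 20 * U ^ 3 := by
    nlinarith [mul_nonneg (sub_nonneg.2 hU) (sq_nonneg U), mul_nonneg (sub_nonneg.2 hU) (by linarith : 0 ≤ U)]
  calc _ = (2 * U ^ 2 + U) * (g * ((‖β₀‖ + ‖β₁‖) / ‖z‖)) + 20 * U ^ 3 * g * (K / ‖z‖ ^ 2) := by
        ring
    _ ≤ 20 * U ^ 3 * (g * ((‖β₀‖ + ‖β₁‖) / ‖z‖)) + 20 * U ^ 3 * g * (K / ‖z‖ ^ 2) := by gcongr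
    _ = _ := by field_simp

end Forcing

/-! ### The diagonal quantities of a column and their equations -/

/-- First diagonal quantity of a column `(a, b, d)`. -/
noncomputable def alphaFun (p p₁ r r₁ : ℝ → ℂ) (z : ℂ) (a b d : ℝ → ℂ) (x : ℝ) : ℂ :=
  a x - (conj (p x) * b x + conj (r x) * d x) / z
    + I / z ^ 2 * (conj (p₁ x) * b x + conj (r₁ x) * d x)

/-- A component of the second diagonal quantity of a column. -/
noncomputable def betaFun (p p₁ : ℝ → ℂ) (z : ℂ) (a b : ℝ → ℂ) (x : ℝ) : ℂ :=
  b x - p x * a x / z - I / z ^ 2 * (p₁ x * a x)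

/-- The forcing term in the equation for `alphaFun`. -/
noncomputable def alphaForcing (q₀ : ℝ) (p p₁ p₂ r r₁ r₂ : ℝ → ℂ) (z : ℂ) (a b d : ℝ → ℂ)
    (x : ℝ) : ℂ :=
  I / z * (((q₀ : ℂ) ^ 2 - (p x * conj (p x) + r x * conj (r x))) * a x) +
    I / z ^ 2 * ((conj (p₂ x) * b x + conj (r₂ x) * d x) +
      I * ((conj (p₁ x) * p x + conj (r₁ x) * r x) * a x))

/-- The remainder term in the equation for `betaFun`. -/
noncomputable def betaRemainder (q₀ : ℝ) (p p₁ r r₁ s s₁ s₂ : ℝ → ℂ) (z : ℂ) (a b d : ℝ → ℂ)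
    (x : ℝ) : ℂ :=
  -(s x * (conj (p x) * p₁ x + conj (r x) * r₁ x) * a x) / z ^ 3 +
    I / z ^ 2 * (s x * ((p x * conj (p x) + r x * conj (r x)) - (q₀ : ℂ) ^ 2) * a x) +
    (q₀ : ℂ) ^ 2 * s₁ x * a x / z ^ 3 -
    I / z ^ 2 * (s₂ x * a x - I * s₁ x * (conj (p x) * b x + conj (r x) * d x))

/-- The forcing term in the equation for `betaFun`. -/
noncomputable def betaForcing (q₀ : ℝ) (p p₁ r r₁ s s₁ s₂ : ℝ → ℂ) (z : ℂ) (a b d : ℝ → ℂ)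
    (x : ℝ) : ℂ :=
  I / z * (s x * (conj (p x) * betaFun p p₁ z a b x + conj (r x) * betaFun r r₁ z a d x)) +
    betaRemainder q₀ p p₁ r r₁ s s₁ s₂ z a b d x

/-- The size of the perturbation. -/
noncomputable def tailDensity (p p₁ p₂ r r₁ r₂ : ℝ → ℂ) (c₀ c₁ : ℂ) (x : ℝ) : ℝ :=
  ‖p x - c₀‖ + ‖r x - c₁‖ + ‖p₁ x‖ + ‖r₁ x‖ + ‖p₂ x‖ + ‖r₂ x‖

theorem hasDerivAt_conj {f : ℝ → ℂ} {f' : ℂ} {x : ℝ} (h : HasDerivAt f f' x) :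
    HasDerivAt (fun x => conj (f x)) (conj f') x := h.star

section

variable {p p₁ p₂ r r₁ r₂ a b d : ℝ → ℂ} {c₀ c₁ z δ e₁ e₂ e₃ : ℂ} {q₀ U : ℝ}

theorem integrableOn_tailDensity (hpT : IsTail p p₁ p₂ c₀) (hrT : IsTail r r₁ r₂ c₁) :
    IntegrableOn (tailDensity p p₁ p₂ r r₁ r₂ c₀ c₁) (Ioi 0) :=
  ((((hpT.integrableOn.norm.add hrT.integrableOn.norm).add hpT.integrableOn₁.norm).add
    hrT.integrableOn₁.norm).add hpT.integrableOn₂.norm).add hrT.integrableOn₂.norm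

theorem hasDerivAt_alphaFun (hpT : IsTail p p₁ p₂ c₀) (hrT : IsTail r r₁ r₂ c₁) (hz : z ≠ 0)
    (ha : ∀ x, HasDerivAt a
      (I * (kz q₀ z - δ) * a x - I * (conj (p x) * b x + conj (r x) * d x)) x)
    (hb : ∀ x, HasDerivAt b (-I * (kz q₀ z + δ) * b x + I * p x * a x) x)
    (hd : ∀ x, HasDerivAt d (-I * (kz q₀ z + δ) * d x + I * r x * a x) x) (x : ℝ) :
    HasDerivAt (alphaFun p p₁ r r₁ z a b d) (I * (lamz q₀ z - δ) * alphaFun p p₁ r r₁ z a b d x +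
      alphaForcing q₀ p p₁ p₂ r r₁ r₂ z a b d x) x := by
  unfold alphaFun alphaForcing
  exact hasDerivAt_alpha (p' := fun x => conj (p x)) (p₁' := fun x => conj (p₁ x))
    (p₂' := fun x => conj (p₂ x)) (r' := fun x => conj (r x)) (r₁' := fun x => conj (r₁ x))
    (r₂' := fun x => conj (r₂ x)) hz (hasDerivAt_conj (hpT.hasDerivAt x))
    (hasDerivAt_conj (hpT.hasDerivAt₁ x)) (hasDerivAt_conj (hrT.hasDerivAt x))
    (hasDerivAt_conj (hrT.hasDerivAt₁ x)) (ha x) (hb x) (hd x)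

theorem hasDerivAt_betaFun {s s₁ s₂ e : ℝ → ℂ} {c : ℂ} (hsT : IsTail s s₁ s₂ c) (hz : z ≠ 0)
    (ha : ∀ x, HasDerivAt a
      (I * (kz q₀ z - δ) * a x - I * (conj (p x) * b x + conj (r x) * d x)) x)
    (he : ∀ x, HasDerivAt e (-I * (kz q₀ z + δ) * e x + I * s x * a x) x) (x : ℝ) :
    HasDerivAt (betaFun s s₁ z a e) (-I * (kz q₀ z + δ) * betaFun s s₁ z a e x +
      betaForcing q₀ p p₁ r r₁ s s₁ s₂ z a b d x) x := by
  unfold betaForcing betaRemainder betaFun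
  exact hasDerivAt_beta (p' := fun x => conj (p x)) (r' := fun x => conj (r x)) (s := s) (s₁ := s₁)
    (s₂ := s₂) hz (hsT.hasDerivAt x) (hsT.hasDerivAt₁ x) (ha x) (he x)

theorem continuous_alphaForcing (hpT : IsTail p p₁ p₂ c₀) (hrT : IsTail r r₁ r₂ c₁)
    (ca : Continuous a) (cb : Continuous b) (cd : Continuous d) :
    Continuous (alphaForcing q₀ p p₁ p₂ r r₁ r₂ z a b d) := by
  have cp := hpT.continuous
  have cp₁ := hpT.continuous₁
  have cp₂ := hpT.continuous₂
  have cr := hrT.continuous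
  have cr₁ := hrT.continuous₁
  have cr₂ := hrT.continuous₂
  unfold alphaForcing
  fun_prop

theorem continuous_betaForcing {s s₁ s₂ : ℝ → ℂ} {c : ℂ} (hpT : IsTail p p₁ p₂ c₀)
    (hrT : IsTail r r₁ r₂ c₁) (hsT : IsTail s s₁ s₂ c)
    (ca : Continuous a) (cb : Continuous b) (cd : Continuous d) :
    Continuous (betaForcing q₀ p p₁ r r₁ s s₁ s₂ z a b d) := by
  have cp := hpT.continuous
  have cp₁ := hpT.continuous₁
  have cr := hrT.continuous
  have cr₁ := hrT.continuous₁
  have cs := hsT.continuous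
  have cs₁ := hsT.continuous₁
  have cs₂ := hsT.continuous₂
  unfold betaForcing betaRemainder betaFun
  fun_prop

theorem tailDensity_bounds (x : ℝ) :
    ‖p x - c₀‖ ≤ tailDensity p p₁ p₂ r r₁ r₂ c₀ c₁ x ∧
    ‖r x - c₁‖ ≤ tailDensity p p₁ p₂ r r₁ r₂ c₀ c₁ x ∧
    ‖p₁ x‖ ≤ tailDensity p p₁ p₂ r r₁ r₂ c₀ c₁ x ∧
    ‖r₁ x‖ ≤ tailDensity p p₁ p₂ r r₁ r₂ c₀ c₁ x ∧
    ‖p₂ x‖ ≤ tailDensity p p₁ p₂ r r₁ r₂ c₀ c₁ x ∧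
    ‖r₂ x‖ ≤ tailDensity p p₁ p₂ r r₁ r₂ c₀ c₁ x := by
  have h1 := norm_nonneg (p x - c₀)
  have h2 := norm_nonneg (r x - c₁)
  have h3 := norm_nonneg (p₁ x)
  have h4 := norm_nonneg (r₁ x)
  have h5 := norm_nonneg (p₂ x)
  have h6 := norm_nonneg (r₂ x)
  simp only [tailDensity]
  refine ⟨?_, ?_, ?_, ?_, ?_, ?_⟩ <;> linarith

/-- One pass of the a priori estimate. -/
theorem norm_diagonal_sub_le (hq₀ : 0 < q₀) (hpT : IsTail p p₁ p₂ c₀) (hrT : IsTail r r₁ r₂ c₁)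
    (hn : c₀ * conj c₀ + c₁ * conj c₁ = (q₀ : ℂ) ^ 2)
    (hU : 1 ≤ U) (hq : q₀ ^ 2 ≤ U) (hc₀ : ‖c₀‖ ≤ U) (hc₁ : ‖c₁‖ ≤ U)
    (hpU : ∀ x, 0 ≤ x → ‖p x‖ ≤ U) (hrU : ∀ x, 0 ≤ x → ‖r x‖ ≤ U) (hz : 1 ≤ ‖z‖)
    (ha : ∀ x, HasDerivAt a
      (I * (kz q₀ z - δ) * a x - I * (conj (p x) * b x + conj (r x) * d x)) x)
    (hb : ∀ x, HasDerivAt b (-I * (kz q₀ z + δ) * b x + I * p x * a x) x)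
    (hd : ∀ x, HasDerivAt d (-I * (kz q₀ z + δ) * d x + I * r x * a x) x)
    (hA₁ : 0 ≤ (I * (lamz q₀ z - δ)).re) (hA₂ : 0 ≤ (-I * (kz q₀ z + δ)).re)
    (hA₃ : 0 ≤ (-I * (lamz q₀ z + δ)).re)
    (he₁ : I * (lamz q₀ z - δ) * e₁ = 0) (he₂ : -I * (kz q₀ z + δ) * e₂ = 0)
    (he₃ : -I * (lamz q₀ z + δ) * e₃ = 0)
    (hl₁ : Tendsto (alphaFun p p₁ r r₁ z a b d) atTop (𝓝 e₁))
    (hl₂ : Tendsto (fun x => (c₁ * betaFun p p₁ z a b x - c₀ * betaFun r r₁ z a d x) / q₀)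
      atTop (𝓝 e₂))
    (hl₃ : Tendsto (fun x => (conj c₀ * betaFun p p₁ z a b x + conj c₁ * betaFun r r₁ z a d x) / q₀)
      atTop (𝓝 e₃))
    {A B K : ℝ} (hAx : ∀ x, 0 ≤ x → ‖a x‖ ≤ A)
    (hBx : ∀ x, 0 ≤ x → ‖betaFun p p₁ z a b x‖ + ‖betaFun r r₁ z a d x‖ ≤ B)
    (hKx : ∀ x, 0 ≤ x → ‖a x‖ ≤ K ∧ ‖b x‖ ≤ K ∧ ‖d x‖ ≤ K) {x : ℝ} (hx : 0 ≤ x) :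
    ‖alphaFun p p₁ r r₁ z a b d x - e₁‖ ≤ (4 * U + 20 * U ^ 3 / q₀) *
        (∫ y in Ioi 0, tailDensity p p₁ p₂ r r₁ r₂ c₀ c₁ y) * (A / ‖z‖ + K / ‖z‖ ^ 2) ∧
    ‖(c₁ * betaFun p p₁ z a b x - c₀ * betaFun r r₁ z a d x) / q₀ - e₂‖ ≤
      (4 * U + 20 * U ^ 3 / q₀) *
        (∫ y in Ioi 0, tailDensity p p₁ p₂ r r₁ r₂ c₀ c₁ y) * (B / ‖z‖ + K / ‖z‖ ^ 2) ∧
    ‖(conj c₀ * betaFun p p₁ z a b x + conj c₁ * betaFun r r₁ z a d x) / q₀ - e₃‖ ≤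
      (4 * U + 20 * U ^ 3 / q₀) *
        (∫ y in Ioi 0, tailDensity p p₁ p₂ r r₁ r₂ c₀ c₁ y) * (B / ‖z‖ + K / ‖z‖ ^ 2) := by
  have hz0 : z ≠ 0 := norm_pos_iff.1 (by linarith)
  have hqc : (q₀ : ℂ) ≠ 0 := by exact_mod_cast hq₀.ne'
  have ca : Continuous a := continuous_iff_continuousAt.2 fun x => (ha x).continuousAt
  have cb : Continuous b := continuous_iff_continuousAt.2 fun x => (hb x).continuousAt
  have cd : Continuous d := continuous_iff_continuousAt.2 fun x => (hd x).continuousAt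
  have hgi := integrableOn_tailDensity hpT hrT
  have hgb := tailDensity_bounds (p := p) (p₁ := p₁) (p₂ := p₂) (r := r) (r₁ := r₁) (r₂ := r₂)
    (c₀ := c₀) (c₁ := c₁)
  have hBf := hasDerivAt_betaFun (p₁ := p₁) (r₁ := r₁) hpT hz0 ha hb
  have hDf := hasDerivAt_betaFun (p₁ := p₁) (r₁ := r₁) hrT hz0 ha hd
  have cB := continuous_betaForcing (q₀ := q₀) (z := z) hpT hrT hpT ca cb cd
  have cD := continuous_betaForcing (q₀ := q₀) (z := z) hpT hrT hrT ca cb cd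
  have hR₀ : ∀ y, 0 ≤ y → ‖betaRemainder q₀ p p₁ r r₁ p p₁ p₂ z a b d y‖ ≤
      10 * U ^ 2 * tailDensity p p₁ p₂ r r₁ r₂ c₀ c₁ y * K / ‖z‖ ^ 2 := fun y hy =>
    norm_remainder_beta_le hn hU hq hz (hpU y hy) (hrU y hy) hc₀ hc₁ (hgb y).1 (hgb y).2.1
      (hgb y).2.2.1 (hgb y).2.2.2.1 (hKx y hy).1 (hKx y hy).2.1 (hKx y hy).2.2 (hpU y hy)
      (hgb y).2.2.1 (hgb y).2.2.2.2.1
  have hR₁ : ∀ y, 0 ≤ y → ‖betaRemainder q₀ p p₁ r r₁ r r₁ r₂ z a b d y‖ ≤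
      10 * U ^ 2 * tailDensity p p₁ p₂ r r₁ r₂ c₀ c₁ y * K / ‖z‖ ^ 2 := fun y hy =>
    norm_remainder_beta_le hn hU hq hz (hpU y hy) (hrU y hy) hc₀ hc₁ (hgb y).1 (hgb y).2.1
      (hgb y).2.2.1 (hgb y).2.2.2.1 (hKx y hy).1 (hKx y hy).2.1 (hKx y hy).2.2 (hrU y hy)
      (hgb y).2.2.2.1 (hgb y).2.2.2.2.2
  have hK0 : 0 ≤ K := (norm_nonneg _).trans (hKx 0 le_rfl).1
  -- The common scheme of the three components: `t` is the individual constant, `N` the pointwise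
  -- size multiplying `1/z`, and `T` its uniform bound.
  have hmain : ∀ {A' e : ℂ} {ρ f : ℝ → ℂ} {t T : ℝ}, 0 ≤ A'.re → A' * e = 0 →
      (∀ x, HasDerivAt ρ (A' * ρ x + f x) x) → Continuous f → Tendsto ρ atTop (𝓝 e) →
      t ≤ 4 * U + 20 * U ^ 3 / q₀ → 0 ≤ t → (∀ y, 0 ≤ y → ∃ N, N ≤ T ∧ 0 ≤ N ∧
        ‖f y‖ ≤ t * tailDensity p p₁ p₂ r r₁ r₂ c₀ c₁ y * (N / ‖z‖ + K / ‖z‖ ^ 2)) →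
      ‖ρ x - e‖ ≤ (4 * U + 20 * U ^ 3 / q₀) *
        (∫ y in Ioi 0, tailDensity p p₁ p₂ r r₁ r₂ c₀ c₁ y) * (T / ‖z‖ + K / ‖z‖ ^ 2) := by
    intro A' e ρ f t T h1 h2 h3 h4 h5 h6 h7 h8
    have hF := (hgi.const_mul (4 * U + 20 * U ^ 3 / q₀)).mul_const (T / ‖z‖ + K / ‖z‖ ^ 2)
    refine (norm_sub_le_integral_of_hasDerivAt h1 h2 h3 h4 h5 hF (fun y hy => ?_) hx).trans
      (le_of_eq ?_)
    · obtain ⟨N, hN, hN0, hf⟩ := h8 y hy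
      refine hf.trans ?_
      have := (norm_nonneg _).trans (hgb y).1
      gcongr
    · rw [integral_mul_const, integral_const_mul]
  have hU3 : 0 ≤ 20 * U ^ 3 / q₀ := by positivity
  refine ⟨?_, ?_, ?_⟩
  · exact hmain hA₁ he₁ (hasDerivAt_alphaFun hpT hrT hz0 ha hb hd)
      (continuous_alphaForcing hpT hrT ca cb cd) hl₁ (t := 4 * U) (by linarith) (by linarith)
      fun y hy => ⟨‖a y‖, hAx y hy, norm_nonneg _, norm_forcing_alpha_le hn hU (hpU y hy) (hrU y hy)
        hc₀ hc₁ (hgb y).1 (hgb y).2.1 (hgb y).2.2.1 (hgb y).2.2.2.1 (hgb y).2.2.2.2.1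
        (hgb y).2.2.2.2.2 (hKx y hy).1 (hKx y hy).2.1 (hKx y hy).2.2⟩
  · refine hmain hA₂ he₂ (f := fun y => (c₁ * betaForcing q₀ p p₁ r r₁ p p₁ p₂ z a b d y -
      c₀ * betaForcing q₀ p p₁ r r₁ r r₁ r₂ z a b d y) / q₀) (fun y => ?_) (by fun_prop)
      hl₂ (t := 20 * U ^ 3 / q₀) (by linarith) hU3 fun y hy => ⟨_, hBx y hy, by positivity,
        norm_forcing_perp_le hq₀ hU (hpU y hy) (hrU y hy)
        hc₀ hc₁ (hgb y).1 (hgb y).2.1 (hR₀ y hy) (hR₁ y hy)⟩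
    refine ((((hBf y).const_mul c₁).fun_sub ((hDf y).const_mul c₀)).div_const (q₀ : ℂ)).congr_deriv ?_
    ring
  · refine hmain hA₃ he₃ (f := fun y => (conj c₀ * betaForcing q₀ p p₁ r r₁ p p₁ p₂ z a b d y +
      conj c₁ * betaForcing q₀ p p₁ r r₁ r r₁ r₂ z a b d y - I * (q₀ : ℂ) ^ 2 / z *
        (conj c₀ * betaFun p p₁ z a b y + conj c₁ * betaFun r r₁ z a d y)) / q₀) (fun y => ?_) ?_
      hl₃ (t := 20 * U ^ 3 / q₀) (by linarith) hU3 fun y hy => ⟨_, hBx y hy, by positivity,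
        norm_forcing_parallel_le hn hq₀ hU hq (hpU y hy) (hrU y hy)
        hc₀ hc₁ (hgb y).1 (hgb y).2.1 (hR₀ y hy) (hR₁ y hy)⟩
    · refine ((((hBf y).const_mul (conj c₀)).fun_add ((hDf y).const_mul (conj c₁))).div_const
        (q₀ : ℂ)).congr_deriv ?_
      -- The subtracted term `i q₀²/z` shifts the exponent of the parallel component from `-k` to
      -- `-λ`.
      have hk : kz q₀ z = lamz q₀ z + (q₀ : ℂ) ^ 2 / z := by
        simp only [kz, lamz]
        ring
      rw [hk]
      ring
    · have h1 : Continuous (betaFun p p₁ z a b) :=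
        continuous_iff_continuousAt.2 fun x => (hBf x).continuousAt
      have h2 : Continuous (betaFun r r₁ z a d) :=
        continuous_iff_continuousAt.2 fun x => (hDf x).continuousAt
      fun_prop

end

-- The bootstrap. One pass with a common bound `K` for the column gives back `1 + K / 2` for large
-- `z`, hence the bound `2`. In a second pass, if `β` tends to zero its bound is already `O(1/z)`,
-- and its forcing gains one more power; if `α` tends to zero, the same happens with `a`. All
-- constants depend on the potential only.
set_option maxHeartbeats 2000000 in
theorem exists_column_estimate {p p₁ p₂ r r₁ r₂ : ℝ → ℂ} {c₀ c₁ : ℂ} {q₀ : ℝ} (hq₀ : 0 < q₀)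
    (hpT : IsTail p p₁ p₂ c₀) (hrT : IsTail r r₁ r₂ c₁)
    (hn : c₀ * conj c₀ + c₁ * conj c₁ = (q₀ : ℂ) ^ 2) (hc₀ : ‖c₀‖ ≤ q₀) (hc₁ : ‖c₁‖ ≤ q₀) :
    ∃ C R : ℝ, 0 ≤ C ∧ 1 ≤ R ∧ ∀ (z δ e₁ e₂ e₃ : ℂ) (a b d : ℝ → ℂ), R ≤ ‖z‖ →
    (∀ x, HasDerivAt a
      (I * (kz q₀ z - δ) * a x - I * (conj (p x) * b x + conj (r x) * d x)) x) →
    (∀ x, HasDerivAt b (-I * (kz q₀ z + δ) * b x + I * p x * a x) x) →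
    (∀ x, HasDerivAt d (-I * (kz q₀ z + δ) * d x + I * r x * a x) x) →
    0 ≤ (I * (lamz q₀ z - δ)).re → 0 ≤ (-I * (kz q₀ z + δ)).re →
    0 ≤ (-I * (lamz q₀ z + δ)).re →
    I * (lamz q₀ z - δ) * e₁ = 0 → -I * (kz q₀ z + δ) * e₂ = 0 →
    -I * (lamz q₀ z + δ) * e₃ = 0 →
    Tendsto (alphaFun p p₁ r r₁ z a b d) atTop (𝓝 e₁) →
    Tendsto (fun x => (c₁ * betaFun p p₁ z a b x - c₀ * betaFun r r₁ z a d x) / q₀)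
      atTop (𝓝 e₂) →
    Tendsto (fun x => (conj c₀ * betaFun p p₁ z a b x + conj c₁ * betaFun r r₁ z a d x) / q₀)
      atTop (𝓝 e₃) →
    (∃ K, ∀ x, 0 ≤ x → ‖a x‖ ≤ K ∧ ‖b x‖ ≤ K ∧ ‖d x‖ ≤ K) → ‖e₁‖ ≤ 1 → ‖e₂‖ + ‖e₃‖ ≤ 1 →
    (‖a 0‖ ≤ C ∧ ‖b 0‖ ≤ C ∧ ‖d 0‖ ≤ C) ∧
    (e₂ = 0 → e₃ = 0 → ‖a 0 - e₁‖ ≤ C / ‖z‖ ∧ ‖b 0 - p 0 * a 0 / z‖ ≤ C / ‖z‖ ^ 2 ∧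
      ‖d 0 - r 0 * a 0 / z‖ ≤ C / ‖z‖ ^ 2) ∧
    (e₁ = 0 → ‖a 0‖ ≤ C / ‖z‖ ∧
      ‖a 0 - (conj (p 0) * b 0 + conj (r 0) * d 0) / z‖ ≤ C / ‖z‖ ^ 2 ∧
      ‖b 0 - p 0 * a 0 / z - (conj c₁ * e₂ + c₀ * e₃) / q₀‖ ≤ C / ‖z‖ ∧
      ‖d 0 - r 0 * a 0 / z - (-conj c₀ * e₂ + c₁ * e₃) / q₀‖ ≤ C / ‖z‖) := by
  have hqc : (q₀ : ℂ) ≠ 0 := by exact_mod_cast hq₀.ne'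
  obtain ⟨Up, hUp⟩ := hpT.exists_bound
  obtain ⟨Ur, hUr⟩ := hrT.exists_bound
  obtain ⟨U, hU, hq, hqU, hp, hp₁, hr, hr₁⟩ : ∃ U, 1 ≤ U ∧ q₀ ^ 2 ≤ U ∧ q₀ ≤ U ∧
      (∀ x, 0 ≤ x → ‖p x‖ ≤ U) ∧ (∀ x, 0 ≤ x → ‖p₁ x‖ ≤ U) ∧ (∀ x, 0 ≤ x → ‖r x‖ ≤ U) ∧
      (∀ x, 0 ≤ x → ‖r₁ x‖ ≤ U) := by
    have h1 := (norm_nonneg _).trans (hUp 0 le_rfl).1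
    have h2 := (norm_nonneg _).trans (hUr 0 le_rfl).1
    have h3 := sq_nonneg q₀
    refine ⟨1 + q₀ ^ 2 + q₀ + Up + Ur, by linarith, by linarith, by linarith,
      fun x hx => ?_, fun x hx => ?_, fun x hx => ?_, fun x hx => ?_⟩
    · linarith [(hUp x hx).1]
    · linarith [(hUp x hx).2]
    · linarith [(hUr x hx).1]
    · linarith [(hUr x hx).2]
  obtain ⟨P, hPdef⟩ : ∃ P, P = (4 * U + 20 * U ^ 3 / q₀) *
    (∫ y in Ioi 0, tailDensity p p₁ p₂ r r₁ r₂ c₀ c₁ y) := ⟨_, rfl⟩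
  have hP : 0 ≤ P := by
    rw [hPdef]
    refine mul_nonneg (by positivity) (integral_nonneg fun y => ?_)
    exact (norm_nonneg _).trans (tailDensity_bounds y).1
  -- Six units of `U` bound the two components of `β` by `K`; the seventh takes care of `K / ‖z‖ ^
  -- 2`.
  set L := 7 * U * P with hL
  have hL0 : 0 ≤ L := by positivity
  -- The radius makes `(2 * L + 4 * U) / ‖z‖ ≤ 1 / 2`, which is what absorption needs; the first
  -- constant dominates every bound obtained below.
  refine ⟨2 + 4 * L + 8 * U + P * (16 * L + 8 * U + 4) + 4 * U, 1 + 2 * (2 * L + 4 * U),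
    by positivity, by nlinarith, ?_⟩
  intro z δ e₁ e₂ e₃ a b d hzR ha hb hd hA₁ hA₂ hA₃ he₁ he₂ he₃ hl₁ hl₂ hl₃ hK he1 he23
  have hz : 1 ≤ ‖z‖ := by nlinarith
  have hz0 : 0 < ‖z‖ := by linarith
  have i1 : ‖I / z ^ 2‖ = 1 / ‖z‖ ^ 2 := by rw [norm_div, norm_I, norm_pow]
  have hz2 : 1 / ‖z‖ ^ 2 ≤ 1 / ‖z‖ :=
    one_div_le_one_div_of_le hz0 (by nlinarith)
  have pass := fun {A B K : ℝ} (hAx : ∀ x, 0 ≤ x → ‖a x‖ ≤ A)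
    (hBx : ∀ x, 0 ≤ x → ‖betaFun p p₁ z a b x‖ + ‖betaFun r r₁ z a d x‖ ≤ B)
    (hKx : ∀ x, 0 ≤ x → ‖a x‖ ≤ K ∧ ‖b x‖ ≤ K ∧ ‖d x‖ ≤ K) {x : ℝ} (hx : 0 ≤ x) =>
    norm_diagonal_sub_le hq₀ hpT hrT hn hU hq (hc₀.trans hqU) (hc₁.trans hqU) hp hr hz ha hb hd
      hA₁ hA₂ hA₃ he₁ he₂ he₃ hl₁ hl₂ hl₃ hAx hBx hKx hx
  rw [← hPdef] at pass
  -- reconstruction of the components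
  have hrec : ∀ {s s₁ e : ℝ → ℂ} {K x : ℝ}, ‖s x‖ ≤ U → ‖s₁ x‖ ≤ U → ‖a x‖ ≤ K →
      ‖e x - betaFun s s₁ z a e x‖ ≤ 2 * U * K / ‖z‖ := by
    intro s s₁ e K x hs hs₁ hKa
    have hK0 := (norm_nonneg _).trans hKa
    have h1 : e x - betaFun s s₁ z a e x = s x * a x / z + I / z ^ 2 * (s₁ x * a x) := by
      unfold betaFun
      ring
    rw [h1]
    refine (norm_add_le_of_le ((norm_div _ _).trans_le (div_le_div_of_nonneg_right
      (norm_mul_le_of_le hs hKa) hz0.le)) (norm_mul_le_of_le (i1.trans_le hz2)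
      (norm_mul_le_of_le hs₁ hKa))).trans (le_of_eq ?_)
    ring
  have hrecα : ∀ {K x : ℝ}, 0 ≤ x → ‖b x‖ ≤ K → ‖d x‖ ≤ K →
      ‖a x - alphaFun p p₁ r r₁ z a b d x‖ ≤ 4 * U * K / ‖z‖ := by
    intro K x hx hKb hKd
    have hK0 := (norm_nonneg _).trans hKb
    have h1 : a x - alphaFun p p₁ r r₁ z a b d x = (conj (p x) * b x + conj (r x) * d x) / z -
        I / z ^ 2 * (conj (p₁ x) * b x + conj (r₁ x) * d x) := by
      unfold alphaFun
      ring
    rw [h1]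
    refine (norm_sub_le_of_le ((norm_div _ _).trans_le (div_le_div_of_nonneg_right
      (norm_add_le_of_le (norm_mul_le_of_le ((norm_conj (p x)).trans_le (hp x hx)) hKb)
      (norm_mul_le_of_le ((norm_conj (r x)).trans_le (hr x hx)) hKd)) hz0.le))
      (norm_mul_le_of_le (i1.trans_le hz2)
      (norm_add_le_of_le (norm_mul_le_of_le ((norm_conj (p₁ x)).trans_le (hp₁ x hx)) hKb)
      (norm_mul_le_of_le ((norm_conj (r₁ x)).trans_le (hr₁ x hx)) hKd)))).trans (le_of_eq ?_)
    ring
  -- Reconstruction of the vector `β` from its perpendicular and parallel components, which are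
  -- coordinates in an orthonormal basis.
  have hβ : ∀ {e2 e3 β₀ β₁ : ℂ} {t : ℝ}, ‖(c₁ * β₀ - c₀ * β₁) / q₀ - e2‖ ≤ t →
      ‖(conj c₀ * β₀ + conj c₁ * β₁) / q₀ - e3‖ ≤ t →
      ‖β₀ - (conj c₁ * e2 + c₀ * e3) / q₀‖ ≤ 2 * t ∧
      ‖β₁ - (-conj c₀ * e2 + c₁ * e3) / q₀‖ ≤ 2 * t := by
    intro e2 e3 β₀ β₁ t h2 h3
    have ht := (norm_nonneg _).trans h2
    have hqn : ‖(q₀ : ℂ)‖ = q₀ := by rw [norm_real, Real.norm_of_nonneg hq₀.le]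
    have h4 : β₀ - (conj c₁ * e2 + c₀ * e3) / q₀ =
        (conj c₁ * ((c₁ * β₀ - c₀ * β₁) / q₀ - e2) +
          c₀ * ((conj c₀ * β₀ + conj c₁ * β₁) / q₀ - e3)) / q₀ := by
      field_simp
      linear_combination -β₀ * hn
    have h5 : β₁ - (-conj c₀ * e2 + c₁ * e3) / q₀ =
        (-conj c₀ * ((c₁ * β₀ - c₀ * β₁) / q₀ - e2) +
          c₁ * ((conj c₀ * β₀ + conj c₁ * β₁) / q₀ - e3)) / q₀ := by
      field_simp
      linear_combination -β₁ * hn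
    rw [h4, h5, norm_div, norm_div, hqn, div_le_iff₀ hq₀, div_le_iff₀ hq₀]
    have hc₀' : ‖-conj c₀‖ ≤ q₀ := by rw [norm_neg, norm_conj]; exact hc₀
    exact ⟨(norm_add_le_of_le (norm_mul_le_of_le ((norm_conj c₁).trans_le hc₁) h2)
      (norm_mul_le_of_le hc₀ h3)).trans (le_of_eq (by ring)),
      (norm_add_le_of_le (norm_mul_le_of_le hc₀' h2)
      (norm_mul_le_of_le hc₁ h3)).trans (le_of_eq (by ring))⟩
  -- first pass
  have hpass1 : ∀ {K : ℝ}, (∀ x, 0 ≤ x → ‖a x‖ ≤ K ∧ ‖b x‖ ≤ K ∧ ‖d x‖ ≤ K) → ∀ x, 0 ≤ x →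
      ‖alphaFun p p₁ r r₁ z a b d x - e₁‖ ≤ L * K / ‖z‖ ∧
      ‖(c₁ * betaFun p p₁ z a b x - c₀ * betaFun r r₁ z a d x) / q₀ - e₂‖ ≤ L * K / ‖z‖ ∧
      ‖(conj c₀ * betaFun p p₁ z a b x + conj c₁ * betaFun r r₁ z a d x) / q₀ - e₃‖ ≤
        L * K / ‖z‖ := by
    intro K hKx x hx
    have hK0 := (norm_nonneg _).trans (hKx x hx).1
    have hUKz : 2 * U * K / ‖z‖ ≤ 2 * U * K := div_le_self (by positivity) hz
    have hB : ∀ x, 0 ≤ x → ‖betaFun p p₁ z a b x‖ + ‖betaFun r r₁ z a d x‖ ≤ 6 * U * K := by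
      intro x hx
      have h1 := hrec (e := b) (hp x hx) (hp₁ x hx) (hKx x hx).1
      have h2 := hrec (e := d) (hr x hx) (hr₁ x hx) (hKx x hx).1
      have h3 := norm_sub_norm_le (betaFun p p₁ z a b x) (b x)
      have h4 := norm_sub_norm_le (betaFun r r₁ z a d x) (d x)
      rw [norm_sub_rev] at h3 h4
      nlinarith [(hKx x hx).2.1, (hKx x hx).2.2]
    obtain ⟨h1, h2, h3⟩ := pass (fun x hx => (hKx x hx).1) hB hKx hx
    have hKU : K ≤ U * K := by nlinarith
    have e1 : P * (6 * U * K / ‖z‖ + K / ‖z‖ ^ 2) ≤ L * K / ‖z‖ := by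
      calc P * (6 * U * K / ‖z‖ + K / ‖z‖ ^ 2)
          = P * (6 * U * K * (1 / ‖z‖) + K * (1 / ‖z‖ ^ 2)) := by ring
        _ ≤ P * (6 * U * K * (1 / ‖z‖) + U * K * (1 / ‖z‖)) := by gcongr
        _ = L * K / ‖z‖ := by rw [hL]; ring
    have e2 : P * (K / ‖z‖ + K / ‖z‖ ^ 2) ≤ P * (6 * U * K / ‖z‖ + K / ‖z‖ ^ 2) := by
      gcongr
      nlinarith
    exact ⟨h1.trans (e2.trans e1), h2.trans e1, h3.trans e1⟩
  have hvec : ‖(conj c₁ * e₂ + c₀ * e₃) / q₀‖ ≤ 1 ∧ ‖(-conj c₀ * e₂ + c₁ * e₃) / q₀‖ ≤ 1 := by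
    have hqn : ‖(q₀ : ℂ)‖ = q₀ := by rw [norm_real, Real.norm_of_nonneg hq₀.le]
    have hc₀' : ‖-conj c₀‖ ≤ q₀ := by rw [norm_neg, norm_conj]; exact hc₀
    rw [norm_div, norm_div, hqn, div_le_iff₀ hq₀, div_le_iff₀ hq₀]
    refine ⟨(norm_add_le_of_le (norm_mul_le_of_le ((norm_conj c₁).trans_le hc₁) (le_refl ‖e₂‖))
      (norm_mul_le_of_le hc₀ (le_refl ‖e₃‖))).trans ?_, (norm_add_le_of_le
      (norm_mul_le_of_le hc₀' (le_refl ‖e₂‖)) (norm_mul_le_of_le hc₁ (le_refl ‖e₃‖))).trans ?_⟩ <;>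
      nlinarith
  have hK2 : ∀ x, 0 ≤ x → ‖a x‖ ≤ 2 ∧ ‖b x‖ ≤ 2 ∧ ‖d x‖ ≤ 2 := by
    obtain ⟨K₀, hK₀⟩ := hK
    have hbdd : BddAbove (range fun x : Ici (0 : ℝ) => max ‖a x‖ (max ‖b x‖ ‖d x‖)) := by
      refine ⟨K₀, ?_⟩
      rintro _ ⟨x, rfl⟩
      obtain ⟨h1, h2, h3⟩ := hK₀ x x.2
      exact max_le h1 (max_le h2 h3)
    -- Here 1 bounds the limits: `‖e₁‖ ≤ 1`, and by `hvec` the vectors assembled from `e₂`, `e₃`.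
    have himp := le_of_bound_improves (B := 1) hbdd ?_
    · intro x hx
      have h1 := himp ⟨x, hx⟩
      simp only [mul_one, max_le_iff] at h1
      exact h1
    · intro K hKs x
      have hKx : ∀ x, 0 ≤ x → ‖a x‖ ≤ K ∧ ‖b x‖ ≤ K ∧ ‖d x‖ ≤ K := by
        intro x hx
        have h1 := hKs ⟨x, hx⟩
        simpa only [max_le_iff] using h1
      have hx : (0 : ℝ) ≤ x := x.2
      have hK0 := (norm_nonneg _).trans (hKx x hx).1
      obtain ⟨h1, h2, h3⟩ := hpass1 hKx x hx
      obtain ⟨h4, h5⟩ := hβ h2 h3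
      have h6 := hrec (e := b) (hp x hx) (hp₁ x hx) (hKx x hx).1
      have h7 := hrec (e := d) (hr x hx) (hr₁ x hx) (hKx x hx).1
      have h8 := hrecα hx (hKx x hx).2.1 (hKx x hx).2.2
      have hsmall : (2 * L + 4 * U) * K / ‖z‖ ≤ K / 2 := by
        rw [div_le_iff₀ hz0]
        nlinarith
      have hs1 : L * K / ‖z‖ + 4 * U * K / ‖z‖ ≤ K / 2 := by
        refine le_trans ?_ hsmall
        rw [← add_div]
        gcongr
        nlinarith [mul_nonneg hL0 hK0]
      have hs2 : 2 * (L * K / ‖z‖) + 2 * U * K / ‖z‖ ≤ K / 2 := by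
        refine le_trans ?_ hsmall
        rw [← mul_div_assoc, ← add_div]
        gcongr
        nlinarith
      have n1 := norm_le_norm_add_norm_sub' (a x) (alphaFun p p₁ r r₁ z a b d x)
      have n2 := norm_le_norm_add_norm_sub' (alphaFun p p₁ r r₁ z a b d x) e₁
      have n3 := norm_le_norm_add_norm_sub' (b x) (betaFun p p₁ z a b x)
      have n4 := norm_le_norm_add_norm_sub' (betaFun p p₁ z a b x) ((conj c₁ * e₂ + c₀ * e₃) / q₀)
      have n5 := norm_le_norm_add_norm_sub' (d x) (betaFun r r₁ z a d x)
      have n6 := norm_le_norm_add_norm_sub' (betaFun r r₁ z a d x)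
        ((-conj c₀ * e₂ + c₁ * e₃) / q₀)
      exact max_le (by linarith) (max_le (by linarith) (by linarith))
  have hq1 := hpass1 hK2
  have hz1 : 0 ≤ 1 / ‖z‖ := by positivity
  have hz3 : 0 ≤ 1 / ‖z‖ ^ 2 := by positivity
  have hPU : 0 ≤ P * U := by positivity
  have hPL : 0 ≤ P * L := by positivity
  have hzz : 1 / ‖z‖ ^ 2 = 1 / ‖z‖ * (1 / ‖z‖) := by ring
  refine ⟨?_, ?_, ?_⟩
  · obtain ⟨h1, h2, h3⟩ := hK2 0 le_rfl
    have : (0 : ℝ) ≤ P * (16 * L + 8 * U + 4) := by positivity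
    exact ⟨by linarith, by linarith, by linarith⟩
  · rintro rfl rfl
    have hB : ∀ x, 0 ≤ x → ‖betaFun p p₁ z a b x‖ + ‖betaFun r r₁ z a d x‖ ≤ 8 * L / ‖z‖ := by
      intro x hx
      obtain ⟨h4, h5⟩ := hβ (hq1 x hx).2.1 (hq1 x hx).2.2
      simp only [mul_zero, add_zero, zero_div, sub_zero] at h4 h5
      refine (add_le_add h4 h5).trans (le_of_eq ?_)
      ring
    -- Second pass, with `β` already known to be `O(1/z)`.
    obtain ⟨-, h2, h3⟩ := pass (fun x hx => (hK2 x hx).1) hB hK2 le_rfl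
    obtain ⟨h4, h5⟩ := hβ h2 h3
    simp only [mul_zero, add_zero, zero_div, sub_zero] at h4 h5
    have hlast : ∀ {s s₁ e : ℝ → ℂ}, ‖s₁ 0‖ ≤ U →
        ‖betaFun s s₁ z a e 0‖ ≤ 2 * (P * (8 * L / ‖z‖ / ‖z‖ + 2 / ‖z‖ ^ 2)) →
        ‖e 0 - s 0 * a 0 / z‖ ≤ (2 + 4 * L + 8 * U + P * (16 * L + 8 * U + 4) + 4 * U) /
          ‖z‖ ^ 2 := by
      intro s s₁ e hs₁ hbeta
      have h6 : e 0 - s 0 * a 0 / z = betaFun s s₁ z a e 0 + I / z ^ 2 * (s₁ 0 * a 0) := by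
        unfold betaFun
        ring
      rw [h6]
      refine (norm_add_le_of_le hbeta (norm_mul_le_of_le i1.le
        (norm_mul_le_of_le hs₁ (hK2 0 le_rfl).1))).trans ?_
      calc _ = (2 * U + P * (16 * L + 4)) * (1 / ‖z‖ ^ 2) := by ring
        _ ≤ (2 + 4 * L + 8 * U + P * (16 * L + 8 * U + 4) + 4 * U) * (1 / ‖z‖ ^ 2) := by
          exact mul_le_mul_of_nonneg_right (by linarith) (by positivity)
        _ = _ := by ring
    refine ⟨?_, hlast (hp₁ 0 le_rfl) h4, hlast (hr₁ 0 le_rfl) h5⟩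
    have n1 := norm_sub_le_norm_sub_add_norm_sub (a 0) (alphaFun p p₁ r r₁ z a b d 0) e₁
    refine n1.trans ((add_le_add (hrecα le_rfl (hK2 0 le_rfl).2.1 (hK2 0 le_rfl).2.2)
      (hq1 0 le_rfl).1).trans ?_)
    rw [← add_div]
    exact div_le_div_of_nonneg_right (by nlinarith) hz0.le
  · rintro rfl
    have hA : ∀ x, 0 ≤ x → ‖a x‖ ≤ (2 * L + 8 * U) / ‖z‖ := by
      intro x hx
      have n1 := norm_sub_le_norm_sub_add_norm_sub (a x) (alphaFun p p₁ r r₁ z a b d x) 0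
      rw [sub_zero] at n1
      refine n1.trans ((add_le_add (hrecα hx (hK2 x hx).2.1 (hK2 x hx).2.2)
        (hq1 x hx).1).trans (le_of_eq ?_))
      ring
    have hB : ∀ x, 0 ≤ x → ‖betaFun p p₁ z a b x‖ + ‖betaFun r r₁ z a d x‖ ≤
        2 * (2 + 2 * U * 2 / ‖z‖) := by
      intro x hx
      have h1 := hrec (e := b) (hp x hx) (hp₁ x hx) (hK2 x hx).1
      have h2 := hrec (e := d) (hr x hx) (hr₁ x hx) (hK2 x hx).1
      have h3 := norm_sub_norm_le (betaFun p p₁ z a b x) (b x)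
      have h4 := norm_sub_norm_le (betaFun r r₁ z a d x) (d x)
      rw [norm_sub_rev] at h3 h4
      linarith [(hK2 x hx).2.1, (hK2 x hx).2.2]
    -- Second pass, with `a` already known to be `O(1/z)`.
    obtain ⟨h1, -, -⟩ := pass hA hB hK2 le_rfl
    obtain ⟨h4, h5⟩ := hβ (hq1 0 le_rfl).2.1 (hq1 0 le_rfl).2.2
    have hlast : ∀ {s s₁ e : ℝ → ℂ} {w : ℂ}, ‖s₁ 0‖ ≤ U →
        ‖betaFun s s₁ z a e 0 - w‖ ≤ 2 * (L * 2 / ‖z‖) →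
        ‖e 0 - s 0 * a 0 / z - w‖ ≤ (2 + 4 * L + 8 * U + P * (16 * L + 8 * U + 4) + 4 * U) /
          ‖z‖ := by
      intro s s₁ e w hs₁ hbeta
      have h6 : e 0 - s 0 * a 0 / z - w = (betaFun s s₁ z a e 0 - w) + I / z ^ 2 * (s₁ 0 * a 0) := by
        unfold betaFun
        ring
      rw [h6]
      refine (norm_add_le_of_le hbeta (norm_mul_le_of_le (i1.trans_le hz2)
        (norm_mul_le_of_le hs₁ (hK2 0 le_rfl).1))).trans ?_
      calc _ = (2 * U + 4 * L) * (1 / ‖z‖) := by ring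
        _ ≤ (2 + 4 * L + 8 * U + P * (16 * L + 8 * U + 4) + 4 * U) * (1 / ‖z‖) := by
          exact mul_le_mul_of_nonneg_right (by linarith) (by positivity)
        _ = _ := by ring
    refine ⟨(hA 0 le_rfl).trans ?_, ?_, hlast (hp₁ 0 le_rfl) h4, hlast (hr₁ 0 le_rfl) h5⟩
    · exact div_le_div_of_nonneg_right (by nlinarith) hz0.le
    · rw [sub_zero] at h1
      have h6 : a 0 - (conj (p 0) * b 0 + conj (r 0) * d 0) / z = alphaFun p p₁ r r₁ z a b d 0 -
          I / z ^ 2 * (conj (p₁ 0) * b 0 + conj (r₁ 0) * d 0) := by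
        unfold alphaFun
        ring
      rw [h6]
      refine (norm_sub_le_of_le h1 (norm_mul_le_of_le i1.le (norm_add_le_of_le
        (norm_mul_le_of_le ((norm_conj _).trans_le (hp₁ 0 le_rfl)) (hK2 0 le_rfl).2.1)
        (norm_mul_le_of_le ((norm_conj _).trans_le (hr₁ 0 le_rfl)) (hK2 0 le_rfl).2.2)))).trans ?_
      calc _ = (4 * U + P * (2 * L + 8 * U + 2)) * (1 / ‖z‖ ^ 2) := by ring
        _ ≤ (2 + 4 * L + 8 * U + P * (16 * L + 8 * U + 4) + 4 * U) * (1 / ‖z‖ ^ 2) := by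
          exact mul_le_mul_of_nonneg_right (by linarith) (by positivity)
        _ = _ := by ring

/-! ### Large-parameter form of the columns -/

/-- Both components of `u` are regular at `+∞`, with limit `v`. -/
def IsRightTail (u : ℝ → V2) (v : V2) : Prop :=
  ∃ p₁ p₂ r₁ r₂ : ℝ → ℂ, IsTail (fun x => u x 0) p₁ p₂ (v 0) ∧ IsTail (fun x => u x 1) r₁ r₂ (v 1)

/-- Asymptotic form, for large `z`, of the value `w` at the origin of the first column. -/
structure FirstColumnBound (C : ℝ) (z : ℂ) (s : V2) (w : Fin 3 → ℂ) : Prop where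
  norm_le : ∀ i, ‖w i‖ ≤ C
  zero : ‖w 0 - I‖ ≤ C / ‖z‖
  one : ‖w 1 - s 0 * w 0 / z‖ ≤ C / ‖z‖ ^ 2
  two : ‖w 2 - s 1 * w 0 / z‖ ≤ C / ‖z‖ ^ 2

/-- Asymptotic form, for large `z`, of the value `w` at the origin of the other columns. -/
structure OtherColumnBound (C : ℝ) (z : ℂ) (s y : V2) (w : Fin 3 → ℂ) : Prop where
  norm_le : ∀ i, ‖w i‖ ≤ C
  zero : ‖w 0‖ ≤ C / ‖z‖
  diag : ‖w 0 - (conj (s 0) * w 1 + conj (s 1) * w 2) / z‖ ≤ C / ‖z‖ ^ 2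
  one : ‖w 1 - s 0 * w 0 / z - y 0‖ ≤ C / ‖z‖
  two : ‖w 2 - s 1 * w 0 / z - y 1‖ ≤ C / ‖z‖

theorem mem_regularSet_of_lt_norm {q₀ : ℝ} (hq₀ : 0 < q₀) {z : ℂ} (hz : q₀ < ‖z‖) :
    z ∈ regularSet q₀ := by
  have hz0 : z ≠ 0 := norm_pos_iff.1 (hq₀.trans hz)
  refine ⟨hz0, fun h => ?_⟩
  have h1 : ‖z‖ ^ 2 = q₀ ^ 2 := by
    rw [← norm_pow, sub_eq_zero.1 h, norm_pow, norm_real, Real.norm_of_nonneg hq₀.le]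
  nlinarith [norm_nonneg z]

theorem IsColumn.hasDerivAt_components {q₀ : ℝ} {u : ℝ → V2} {v : V2} {j : Fin 3} {z : ℂ}
    {m : ℝ → Fin 3 → ℂ} (h : IsColumn q₀ u v j z m) (x : ℝ) :
    HasDerivAt (fun x => m x 0) (I * (kz q₀ z - expo q₀ z j) * m x 0 -
      I * (conj (u x 0) * m x 1 + conj (u x 1) * m x 2)) x ∧
    HasDerivAt (fun x => m x 1) (-I * (kz q₀ z + expo q₀ z j) * m x 1 + I * u x 0 * m x 0) x ∧
    HasDerivAt (fun x => m x 2) (-I * (kz q₀ z + expo q₀ z j) * m x 2 + I * u x 1 * m x 0) x := by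
  refine ⟨(h.1 x 0).congr_deriv ?_, (h.1 x 1).congr_deriv ?_, (h.1 x 2).congr_deriv ?_⟩ <;>
    simp [laxX, matJ, matQ, Matrix.mulVec, dotProduct, Fin.sum_univ_three] <;> ring

/-- On the columns of `Ŷ` the diagonal quantities are exactly constant multiples of unit vectors,
independent of `z`: the factor `ρ̂` in `Ŷ` compensates `1 - q₀²/z²`. So the scalar estimate applies
with the same limits for all large `z`. -/
theorem exists_column_bound {q₀ : ℝ} (hq₀ : 0 < q₀) {u : ℝ → V2} {v : V2} (hv : ‖v‖ = q₀)
    (hu : IsRightTail u v) :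
    ∃ C R : ℝ, 0 ≤ C ∧ 1 ≤ R ∧ q₀ < R ∧ ∀ (z : ℂ) (j : Fin 3) (m : ℝ → Fin 3 → ℂ), R ≤ ‖z‖ →
    (∀ l, 0 ≤ (I * (expo q₀ z l - expo q₀ z j)).re) → IsColumn q₀ u v j z m →
    (j = 0 → FirstColumnBound C z (u 0) (m 0)) ∧
    (j = 1 → OtherColumnBound C z (u 0) ((q₀ : ℂ)⁻¹ • perp v) (m 0)) ∧
    (j = 2 → OtherColumnBound C z (u 0) ((q₀ : ℂ)⁻¹ • v) (m 0)) := by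
  obtain ⟨p₁, p₂, r₁, r₂, hpT, hrT⟩ := hu
  have hn := mul_conj_add_mul_conj hv _ _ rfl rfl
  have hqc : (q₀ : ℂ) ≠ 0 := by exact_mod_cast hq₀.ne'
  have hc₀ : ‖v 0‖ ≤ q₀ := hv ▸ PiLp.norm_apply_le v 0
  have hc₁ : ‖v 1‖ ≤ q₀ := hv ▸ PiLp.norm_apply_le v 1
  obtain ⟨C, R, hC, hR, H⟩ := exists_column_estimate hq₀ hpT hrT hn hc₀ hc₁
  refine ⟨C, max R (q₀ + 1), hC, hR.trans (le_max_left _ _),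
    (lt_add_one q₀).trans_le (le_max_right _ _), fun z j m hz hre hm => ?_⟩
  have hzR := (le_max_left _ _).trans hz
  have hzreg := mem_regularSet_of_lt_norm hq₀ ((lt_add_one q₀).trans_le ((le_max_right _ _).trans hz))
  obtain ⟨hz0, hz1⟩ := hzreg
  have hd := fun x => hm.hasDerivAt_components x
  have hl : ∀ i, Tendsto (fun x => m x i) atTop (𝓝 (matY q₀ v z i j)) :=
    fun i => tendsto_pi_nhds.1 hm.2 i
  have hconj : ∀ {f : ℝ → ℂ} {c : ℂ}, Tendsto f atTop (𝓝 c) →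
      Tendsto (fun x => conj (f x)) atTop (𝓝 (conj c)) :=
    fun h => (Complex.continuous_conj.tendsto _).comp h
  have hcont : Continuous m := continuous_pi fun i => continuous_iff_continuousAt.2 fun x =>
    (hm.1 x i).continuousAt
  obtain ⟨K, hK⟩ := exists_norm_le_of_tendsto hcont hm.2
  have hKx : ∃ K, ∀ x, 0 ≤ x → ‖m x 0‖ ≤ K ∧ ‖m x 1‖ ≤ K ∧ ‖m x 2‖ ≤ K :=
    ⟨K, fun x hx => ⟨(norm_le_pi_norm _ _).trans (hK x hx), (norm_le_pi_norm _ _).trans (hK x hx),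
      (norm_le_pi_norm _ _).trans (hK x hx)⟩⟩
  have hl₁ : Tendsto (alphaFun (fun x => u x 0) p₁ (fun x => u x 1) r₁ z (fun x => m x 0)
      (fun x => m x 1) (fun x => m x 2)) atTop (𝓝 (matY q₀ v z 0 j -
        (conj (v 0) * matY q₀ v z 1 j + conj (v 1) * matY q₀ v z 2 j) / z)) := by
    have := ((hl 0).sub ((((hconj hpT.tendsto).mul (hl 1)).add
      ((hconj hrT.tendsto).mul (hl 2))).div_const z)).add ((((hconj hpT.tendsto₁).mul (hl 1)).add
      ((hconj hrT.tendsto₁).mul (hl 2))).const_mul (I / z ^ 2))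
    simpa using! this
  have hlβ : ∀ {s s₁ s₂ : ℝ → ℂ} {c : ℂ} (i : Fin 3), IsTail s s₁ s₂ c →
      Tendsto (betaFun s s₁ z (fun x => m x 0) (fun x => m x i)) atTop
        (𝓝 (matY q₀ v z i j - c * matY q₀ v z 0 j / z)) := by
    intro s s₁ s₂ c i hs
    have := ((hl i).sub ((hs.tendsto.mul (hl 0)).div_const z)).sub
      ((hs.tendsto₁.mul (hl 0)).const_mul (I / z ^ 2))
    simpa using! this
  have hl₂ := (((hlβ 1 hpT).const_mul (v 1)).sub ((hlβ 2 hrT).const_mul (v 0))).div_const (q₀ : ℂ)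
  have hl₃ := (((hlβ 1 hpT).const_mul (conj (v 0))).add
    ((hlβ 2 hrT).const_mul (conj (v 1)))).div_const (q₀ : ℂ)
  have h1 : 0 ≤ (I * (lamz q₀ z - expo q₀ z j)).re := hre 0
  have h2 : 0 ≤ (-I * (kz q₀ z + expo q₀ z j)).re := by
    have := hre 1
    have e : I * (expo q₀ z 1 - expo q₀ z j) = -I * (kz q₀ z + expo q₀ z j) := by
      simp [expo]; ring
    rwa [e] at this
  have h3 : 0 ≤ (-I * (lamz q₀ z + expo q₀ z j)).re := by
    have := hre 2
    have e : I * (expo q₀ z 2 - expo q₀ z j) = -I * (lamz q₀ z + expo q₀ z j) := by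
      simp [expo]; ring
    rwa [e] at this
  have H' := fun e₁ e₂ e₃ => H z (expo q₀ z j) e₁ e₂ e₃ (fun x => m x 0) (fun x => m x 1)
    (fun x => m x 2) hzR (fun x => (hd x).1) (fun x => (hd x).2.1) (fun x => (hd x).2.2) h1 h2 h3
  refine ⟨?_, ?_, ?_⟩
  · rintro rfl
    obtain ⟨⟨b0, b1, b2⟩, hb, -⟩ := H' I 0 0 (by simp [expo]) (mul_zero _) (mul_zero _)
      (by convert hl₁ using 2; simp [matY, rho]; field_simp; grind)
      (by convert hl₂ using 2; simp [matY, rho]; field_simp; grind)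
      (by convert hl₃ using 2; simp [matY, rho]; field_simp; grind) hKx (by simp) (by simp)
    obtain ⟨hb0, hb1, hb2⟩ := hb rfl rfl
    exact ⟨fun i => by fin_cases i <;> assumption, hb0, hb1, hb2⟩
  · rintro rfl
    obtain ⟨⟨b0, b1, b2⟩, -, hb⟩ := H' 0 1 0 (mul_zero _) (by simp [expo]) (mul_zero _)
      (by convert hl₁ using 2; simp [matY, perp]; field_simp; grind)
      (by convert hl₂ using 2; simp [matY, perp]; field_simp; grind)
      (by convert hl₃ using 2; simp [matY, perp]; field_simp; grind) hKx (by simp) (by simp)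
    obtain ⟨hb0, hb1, hb2, hb3⟩ := hb rfl
    refine ⟨fun i => by fin_cases i <;> assumption, hb0, hb1, ?_, ?_⟩
    · convert hb2 using 3; simp [perp]; ring
    · convert hb3 using 3; simp [perp]; ring
  · rintro rfl
    obtain ⟨⟨b0, b1, b2⟩, -, hb⟩ := H' 0 0 1 (mul_zero _) (mul_zero _) (by simp [expo])
      (by convert hl₁ using 2; simp [matY, rho]; field_simp; grind)
      (by convert hl₂ using 2; simp [matY, rho]; field_simp; grind)
      (by convert hl₃ using 2; simp [matY, rho]; field_simp; grind) hKx (by simp) (by simp)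
    obtain ⟨hb0, hb1, hb2, hb3⟩ := hb rfl
    refine ⟨fun i => by fin_cases i <;> assumption, hb0, hb1, ?_, ?_⟩
    · convert hb2 using 3; simp; ring
    · convert hb3 using 3; simp; ring

/-! ### Jost eigenfunctions on the real line -/

/-- The diagonal entries of `exp (i Δ)`. -/
noncomputable def phase (q₀ σ : ℝ) (z : ℂ) (x t : ℝ) : Fin 3 → ℂ :=
  ![exp (I * delta1 q₀ σ z x t), exp (I * delta2 q₀ σ z x t), exp (-I * delta1 q₀ σ z x t)]

/-- The invariant form `Ŷ† J Ŷ`. -/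
noncomputable def formC (q₀ : ℝ) (z : ℂ) : M3 := Matrix.diagonal ![rho q₀ z, -1, -rho q₀ z]

/-- The inverse of `formC`. -/
noncomputable def formCinv (q₀ : ℝ) (z : ℂ) : M3 :=
  Matrix.diagonal ![(rho q₀ z)⁻¹, -1, -(rho q₀ z)⁻¹]

theorem rho_ne_zero {q₀ : ℝ} {z : ℂ} (hz : z ∈ regularSet q₀) : rho q₀ z ≠ 0 :=
  div_ne_zero (pow_ne_zero 2 hz.1) hz.2

theorem formCinv_mul_formC {q₀ : ℝ} {z : ℂ} (hz : z ∈ regularSet q₀) :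
    formCinv q₀ z * formC q₀ z = 1 := by
  have h := rho_ne_zero hz
  rw [formCinv, formC, Matrix.diagonal_mul_diagonal, ← Matrix.diagonal_one]
  congr 1
  ext i
  fin_cases i <;> simp [h]

theorem ofReal_mem_regularSet {q₀ z : ℝ} (h0 : z ≠ 0) (h1 : z ≠ q₀) (h2 : z ≠ -q₀) :
    (z : ℂ) ∈ regularSet q₀ := by
  refine ⟨by exact_mod_cast h0, ?_⟩
  have : z ^ 2 - q₀ ^ 2 ≠ 0 := by
    rw [sq_sub_sq]
    exact mul_ne_zero (fun h => h2 (by linarith)) (sub_ne_zero.2 h1)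
  exact_mod_cast this

theorem conj_kz (q₀ z : ℝ) : conj (kz q₀ z) = kz q₀ z := by
  simp [kz, map_ofNat]

theorem conj_lamz (q₀ z : ℝ) : conj (lamz q₀ z) = lamz q₀ z := by
  simp [lamz, map_ofNat]

theorem conj_rho (q₀ z : ℝ) : conj (rho q₀ z) = rho q₀ z := by simp [rho]

theorem conj_delta1 (q₀ σ z x t : ℝ) : conj (delta1 q₀ σ z x t) = delta1 q₀ σ z x t := by
  simp [delta1, conj_kz, conj_lamz, map_ofNat]

theorem conj_delta2 (q₀ σ z x t : ℝ) : conj (delta2 q₀ σ z x t) = delta2 q₀ σ z x t := by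
  simp [delta2, conj_kz, conj_lamz, map_ofNat]

theorem phase_mul_conj (q₀ σ z x t : ℝ) (j : Fin 3) :
    phase q₀ σ z x t j * conj (phase q₀ σ z x t j) = 1 := by
  fin_cases j <;> simp [phase, ← Complex.exp_conj, ← Complex.exp_add, conj_delta1, conj_delta2]

theorem norm_phase (q₀ σ z x t : ℝ) (j : Fin 3) : ‖phase q₀ σ z x t j‖ = 1 := by
  have h := phase_mul_conj q₀ σ z x t j
  rw [Complex.mul_conj, Complex.normSq_eq_norm_sq] at h
  have h1 : ‖phase q₀ σ z x t j‖ ^ 2 = 1 := by exact_mod_cast h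
  exact (pow_eq_one_iff_of_nonneg (norm_nonneg _) (by norm_num)).1 h1

theorem matY_mul_expDelta_apply (q₀ σ : ℝ) (v : V2) (z : ℂ) (x t : ℝ) (i j : Fin 3) :
    (matY q₀ v z * expDelta q₀ σ z x t) i j = matY q₀ v z i j * phase q₀ σ z x t j := by
  rw [expDelta, Matrix.mul_diagonal]
  rfl

theorem hasDerivAt_phase (q₀ σ : ℝ) (z : ℂ) (x t : ℝ) (j : Fin 3) :
    HasDerivAt (fun x => phase q₀ σ z x t j) (I * expo q₀ z j * phase q₀ σ z x t j) x := by
  have h1 : HasDerivAt (fun x => delta1 q₀ σ z x t) (lamz q₀ z) x := by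
    unfold delta1
    simpa using (((hasDerivAt_id x).ofReal_comp).const_mul (lamz q₀ z)).add_const
      (2 * lamz q₀ z * (kz q₀ z + σ * (3 * kz q₀ z ^ 2 - lamz q₀ z ^ 2)) * t)
  have h2 : HasDerivAt (fun x => delta2 q₀ σ z x t) (-kz q₀ z) x := by
    unfold delta2
    simpa using (((hasDerivAt_id x).ofReal_comp).const_mul (-kz q₀ z)).sub_const
      ((lamz q₀ z ^ 2 + kz q₀ z ^ 2 + 4 * σ * kz q₀ z ^ 3) * t)
  fin_cases j
  · exact ((h1.const_mul I).cexp).congr_deriv (by simp [phase, expo]; ring)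
  · exact ((h2.const_mul I).cexp).congr_deriv (by simp [phase, expo]; ring)
  · exact ((h1.const_mul (-I)).cexp).congr_deriv (by simp [phase, expo]; ring)

variable {q₀ σ t : ℝ} {u : ℝ → V2} {v : V2} {l : Filter ℝ} {z : ℝ} {ψ ψ' : ℝ → M3}

theorem IsJost.hasDerivAt_components (h : IsJost q₀ σ t u v l z ψ) (x : ℝ) (j : Fin 3) :
    HasDerivAt (fun x => ψ x 0 j) (I * kz q₀ z * ψ x 0 j -
      I * (conj (u x 0) * ψ x 1 j + conj (u x 1) * ψ x 2 j)) x ∧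
    HasDerivAt (fun x => ψ x 1 j) (-I * kz q₀ z * ψ x 1 j + I * u x 0 * ψ x 0 j) x ∧
    HasDerivAt (fun x => ψ x 2 j) (-I * kz q₀ z * ψ x 2 j + I * u x 1 * ψ x 0 j) x := by
  refine ⟨(h.1 x 0 j).congr_deriv ?_, (h.1 x 1 j).congr_deriv ?_, (h.1 x 2 j).congr_deriv ?_⟩ <;>
    simp [laxX, matJ, matQ, Matrix.mul_apply, Fin.sum_univ_three] <;> ring

theorem pairing_apply (A B : M3) (i j : Fin 3) : (Aᴴ * matJ * B) i j =
    conj (A 0 i) * B 0 j - conj (A 1 i) * B 1 j - conj (A 2 i) * B 2 j := by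
  simp [matJ, Matrix.mul_apply, Fin.sum_univ_three, Matrix.diagonal_apply]
  ring

/-- For real `z` the Lax matrix satisfies `X† J + J X = 0`, so the form is constant along any two
solutions, whichever end each is normalised at. -/
theorem IsJost.pairing_eq {v' : V2} {l' : Filter ℝ} (h : IsJost q₀ σ t u v l z ψ)
    (h' : IsJost q₀ σ t u v' l' z ψ') (x y : ℝ) :
    (ψ x)ᴴ * matJ * ψ' x = (ψ y)ᴴ * matJ * ψ' y := by
  ext i j
  have hd : ∀ x, HasDerivAt (fun x => ((ψ x)ᴴ * matJ * ψ' x) i j) 0 x := by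
    intro x
    simp only [pairing_apply]
    obtain ⟨a0, a1, a2⟩ := h.hasDerivAt_components x i
    obtain ⟨b0, b1, b2⟩ := h'.hasDerivAt_components x j
    refine ((((hasDerivAt_conj a0).fun_mul b0).fun_sub ((hasDerivAt_conj a1).fun_mul b1)).fun_sub
      ((hasDerivAt_conj a2).fun_mul b2)).congr_deriv ?_
    simp only [map_sub, map_add, map_mul, map_neg, conj_I, conj_kz, conj_conj]
    ring
  exact is_const_of_deriv_eq_zero (fun x => (hd x).differentiableAt) (fun x => (hd x).deriv) x y

theorem IsJost.tendsto_apply (h : IsJost q₀ σ t u v l z ψ) (i j : Fin 3) :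
    Tendsto (fun x => ψ x i j * conj (phase q₀ σ z x t j)) l (𝓝 (matY q₀ v z i j)) := by
  have h1 : Tendsto (fun x => (ψ x - matY q₀ v z * expDelta q₀ σ z x t) i j) l (𝓝 0) :=
    tendsto_pi_nhds.1 (tendsto_pi_nhds.1 h.2 i) j
  rw [tendsto_iff_norm_sub_tendsto_zero]
  refine (tendsto_zero_iff_norm_tendsto_zero.1 h1).congr fun x => ?_
  rw [Matrix.sub_apply, matY_mul_expDelta_apply]
  have h2 : ψ x i j * conj (phase q₀ σ z x t j) - matY q₀ v z i j =
      (ψ x i j - matY q₀ v z i j * phase q₀ σ z x t j) * conj (phase q₀ σ z x t j) := by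
    linear_combination matY q₀ v z i j * phase_mul_conj q₀ σ z x t j
  rw [h2, norm_mul, norm_conj, norm_phase, mul_one]

theorem matY_pairing (hq₀ : 0 < q₀) (hv : ‖v‖ = q₀) (hz : (z : ℂ) ∈ regularSet q₀) :
    (matY q₀ v z)ᴴ * matJ * matY q₀ v z = formC q₀ z := by
  have hqc : (q₀ : ℂ) ≠ 0 := by exact_mod_cast hq₀.ne'
  have hn := mul_conj_add_mul_conj hv _ _ rfl rfl
  obtain ⟨h0, h1⟩ := hz
  ext i j
  rw [pairing_apply]
  fin_cases i <;> fin_cases j <;> simp [matY, formC, perp, conj_rho] <;> try simp only [rho]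
  all_goals try field_simp
  all_goals grind [I_sq]

/-- The constant value, multiplied by unimodular phases, tends to an entry of `Ŷ† J Ŷ`. On the
diagonal the phases cancel; off the diagonal the limit is zero, which forces the constant to vanish.
-/
theorem IsJost.pairing [l.NeBot] (hq₀ : 0 < q₀) (hv : ‖v‖ = q₀) (hz : (z : ℂ) ∈ regularSet q₀)
    (h : IsJost q₀ σ t u v l z ψ) (h' : IsJost q₀ σ t u v l z ψ') (x : ℝ) :
    (ψ x)ᴴ * matJ * ψ' x = formC q₀ z := by
  ext i j
  have hlim : Tendsto (fun y => ((ψ x)ᴴ * matJ * ψ' x) i j *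
      (phase q₀ σ z y t i * conj (phase q₀ σ z y t j))) l (𝓝 (formC q₀ z i j)) := by
    have e : formC q₀ z i j = conj (matY q₀ v z 0 i) * matY q₀ v z 0 j -
        conj (matY q₀ v z 1 i) * matY q₀ v z 1 j - conj (matY q₀ v z 2 i) * matY q₀ v z 2 j := by
      rw [← matY_pairing hq₀ hv hz, pairing_apply]
    rw [e]
    have hc : ∀ p i, Tendsto (fun x => conj (ψ x p i * conj (phase q₀ σ z x t i))) l
        (𝓝 (conj (matY q₀ v z p i))) := fun p i =>
      (Complex.continuous_conj.tendsto _).comp (h.tendsto_apply p i)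
    refine ((((hc 0 i).mul (h'.tendsto_apply 0 j)).sub
      ((hc 1 i).mul (h'.tendsto_apply 1 j))).sub ((hc 2 i).mul (h'.tendsto_apply 2 j))).congr
      fun y => ?_
    rw [h.pairing_eq h' x y, pairing_apply]
    simp only [map_mul, conj_conj]
    ring
  by_cases hij : i = j
  · subst hij
    simp only [phase_mul_conj, mul_one] at hlim
    exact tendsto_nhds_unique tendsto_const_nhds hlim
  · have h0 : formC q₀ z i j = 0 := Matrix.diagonal_apply_ne _ hij
    rw [h0] at hlim ⊢
    have hn := hlim.norm
    simp only [norm_mul, norm_conj, norm_phase, mul_one, norm_zero] at hn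
    exact norm_eq_zero.1 (tendsto_nhds_unique tendsto_const_nhds hn)

theorem IsJost.unique [l.NeBot] (hq₀ : 0 < q₀) (hv : ‖v‖ = q₀) (hz : (z : ℂ) ∈ regularSet q₀)
    (h : IsJost q₀ σ t u v l z ψ) (h' : IsJost q₀ σ t u v l z ψ') : ψ = ψ' := by
  ext1 x
  have h1 : (formCinv q₀ z * (ψ x)ᴴ * matJ) * ψ x = 1 := by
    rw [← formCinv_mul_formC hz, ← h.pairing hq₀ hv hz h x]
    simp only [mul_assoc]
  have h2 : (formCinv q₀ z * (ψ x)ᴴ * matJ) * ψ' x = 1 := by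
    rw [← formCinv_mul_formC hz, ← h.pairing hq₀ hv hz h' x]
    simp only [mul_assoc]
  exact (left_inv_eq_right_inv (mul_eq_one_comm.1 h1) h2)

/-- The eigenfunction with given columns. -/
noncomputable def ofColumns (q₀ σ t : ℝ) (z : ℂ) (m : Fin 3 → ℝ → Fin 3 → ℂ) (x : ℝ) : M3 :=
  fun i j => m j x i * phase q₀ σ z x t j

theorem isJost_ofColumns {m : Fin 3 → ℝ → Fin 3 → ℂ} (h : ∀ j, IsColumn q₀ u v j z (m j)) :
    IsJost q₀ σ t u v atTop z (ofColumns q₀ σ t z m) := by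
  constructor
  · intro x i j
    refine (((h j).1 x i).mul (hasDerivAt_phase q₀ σ z x t j)).congr_deriv ?_
    simp only [Matrix.mulVec, dotProduct, Matrix.mul_apply, ofColumns, Fin.sum_univ_three]
    ring
  · refine tendsto_pi_nhds.2 fun i => tendsto_pi_nhds.2 fun j => ?_
    have h1 := tendsto_iff_norm_sub_tendsto_zero.1 (tendsto_pi_nhds.1 (h j).2 i)
    refine tendsto_zero_iff_norm_tendsto_zero.2 (h1.congr fun x => ?_)
    rw [Matrix.sub_apply, matY_mul_expDelta_apply, ofColumns, ← sub_mul, norm_mul, norm_phase,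
      mul_one]

/-! ### Reflection -/

/-- The map `v ↦ -v̄`. -/
noncomputable def negConj (v : V2) : V2 := !₂[-conj (v 0), -conj (v 1)]

/-- The diagonal entries of `J`. -/
def signJ : Fin 3 → ℂ := ![1, -1, -1]

theorem norm_negConj (v : V2) : ‖negConj v‖ = ‖v‖ := by
  simp [negConj, EuclideanSpace.norm_eq]

/-- The reflected eigenfunction. -/
noncomputable def reflect (ψ : ℝ → M3) (x : ℝ) : M3 :=
  Matrix.of fun i j => -(signJ i * conj (ψ (-x) i j) * signJ j)

theorem reflect_apply (ψ : ℝ → M3) (x : ℝ) (i j : Fin 3) :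
    reflect ψ x i j = -(signJ i * conj (ψ (-x) i j) * signJ j) := rfl

/-- Conjugation combined with `x ↦ -x` preserves `i ∂ₓ` and `k`; it turns the potential `-q̄` into
`-q`, and conjugation by `J` restores the sign. Reversing `t` matches the phases. Thus only
solutions normalised at `+∞` need be constructed and estimated. -/
theorem IsJost.reflect
    (h : IsJost q₀ σ (-t) (fun x => negConj (u (-x))) (negConj v) atTop z ψ) :
    IsJost q₀ σ t u v atBot z (reflect ψ) := by
  have hneg : ∀ x : ℝ, HasDerivAt (fun x : ℝ => -x) (-1) x := fun x => hasDerivAt_neg x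
  constructor
  · intro x i j
    obtain ⟨a0, a1, a2⟩ := h.hasDerivAt_components (-x) j
    have b0 := hasDerivAt_conj (a0.scomp x (hneg x))
    have b1 := hasDerivAt_conj (a1.scomp x (hneg x))
    have b2 := hasDerivAt_conj (a2.scomp x (hneg x))
    simp only [Function.comp_def] at b0 b1 b2
    simp only [reflect_apply, Matrix.mul_apply, Fin.sum_univ_three]
    fin_cases i
    · refine (((b0.const_mul (signJ 0)).mul_const (signJ j)).fun_neg).congr_deriv ?_
      simp [laxX, matJ, matQ, conj_kz, signJ, negConj]
      ring
    · refine (((b1.const_mul (signJ 1)).mul_const (signJ j)).fun_neg).congr_deriv ?_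
      simp [laxX, matJ, matQ, conj_kz, signJ, negConj]
      ring
    · refine (((b2.const_mul (signJ 2)).mul_const (signJ j)).fun_neg).congr_deriv ?_
      simp [laxX, matJ, matQ, conj_kz, signJ, negConj]
      ring
  · refine tendsto_pi_nhds.2 fun i => tendsto_pi_nhds.2 fun j => ?_
    have h1 := (tendsto_pi_nhds.1 (tendsto_pi_nhds.1 h.2 i) j).comp tendsto_neg_atBot_atTop
    refine tendsto_zero_iff_norm_tendsto_zero.2
      ((tendsto_zero_iff_norm_tendsto_zero.1 h1).congr fun x => ?_)
    simp only [Function.comp_apply]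
    rw [Matrix.sub_apply, matY_mul_expDelta_apply, Matrix.sub_apply, matY_mul_expDelta_apply,
      reflect_apply]
    have hs : ∀ i, signJ i = 1 ∨ signJ i = -1 := by intro i; fin_cases i <;> simp [signJ]
    have hsn : ∀ i, ‖signJ i‖ = 1 := fun i => by rcases hs i with h | h <;> simp [h]
    have hY : matY q₀ v z i j = -(signJ i * conj (matY q₀ (negConj v) z i j) * signJ j) := by
      fin_cases i <;> fin_cases j <;> simp [matY, signJ, negConj, perp, conj_rho] <;> ring
    have hp : phase q₀ σ z x t j = conj (phase q₀ σ z (-x) (-t) j) := by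
      have e1 : delta1 q₀ σ z (-x) (-t) = -delta1 q₀ σ z x t := by
        simp [delta1]; ring
      have e2 : delta2 q₀ σ z (-x) (-t) = -delta2 q₀ σ z x t := by
        simp [delta2]; ring
      fin_cases j <;> simp [phase, ← Complex.exp_conj, e1, e2, conj_delta1, conj_delta2]
    have h2 : -(signJ i * conj (ψ (-x) i j) * signJ j) - matY q₀ v z i j * phase q₀ σ z x t j =
        -(signJ i * conj (ψ (-x) i j - matY q₀ (negConj v) z i j * phase q₀ σ z (-x) (-t) j) *
          signJ j) := by
      rw [hY, hp, map_sub, map_mul]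
      ring
    rw [h2, norm_neg, norm_mul, norm_mul, hsn, hsn, norm_conj]
    ring

/-! ### The scattering matrix -/

/-- The scattering matrix of two eigenfunctions. -/
noncomputable def scat (q₀ : ℝ) (z : ℂ) (ψm ψp : ℝ → M3) : M3 :=
  formCinv q₀ z * ((ψm 0)ᴴ * matJ * ψp 0)

/-- The inverse of the scattering matrix `H`. -/
noncomputable def scatInv (q₀ : ℝ) (z : ℂ) (H : M3) : M3 := formCinv q₀ z * (Hᴴ * formC q₀ z)

section

variable {q₀ σ t z : ℝ} {u : ℝ → V2} {vm vp : V2} {ψm ψp : ℝ → M3}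

theorem eq_mul_scat (hq₀ : 0 < q₀) (hvm : ‖vm‖ = q₀) (hz : (z : ℂ) ∈ regularSet q₀)
    (hm : IsJost q₀ σ t u vm atBot z ψm) (hp : IsJost q₀ σ t u vp atTop z ψp) (x : ℝ) :
    ψp x = ψm x * scat q₀ z ψm ψp := by
  have h1 : (formCinv q₀ z * ((ψm x)ᴴ * matJ)) * ψm x = 1 := by
    rw [← formCinv_mul_formC hz, ← hm.pairing hq₀ hvm hz hm x]
    simp only [mul_assoc]
  have h2 := mul_eq_one_comm.1 h1
  rw [scat, hm.pairing_eq hp 0 x, ← mul_assoc (formCinv q₀ z), ← mul_assoc (ψm x), h2, one_mul]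

theorem isScatteringMatrix_scat (hq₀ : 0 < q₀) (hvm : ‖vm‖ = q₀) (hz : (z : ℂ) ∈ regularSet q₀)
    (hm : IsJost q₀ σ t u vm atBot z ψm) (hp : IsJost q₀ σ t u vp atTop z ψp) :
    IsScatteringMatrix q₀ σ t u vm vp z (scat q₀ z ψm ψp) :=
  ⟨ψm, ψp, hm, hp, eq_mul_scat hq₀ hvm hz hm hp⟩

/-- Both Jost matrices have the same form `C`, which does not involve the boundary vector, so `H`
preserves it. This provides the inverse of `H` explicitly. -/
theorem IsScatteringMatrix.conjTranspose_mul_mul (hq₀ : 0 < q₀) (hvm : ‖vm‖ = q₀)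
    (hvp : ‖vp‖ = q₀) (hz : (z : ℂ) ∈ regularSet q₀) {H : M3}
    (h : IsScatteringMatrix q₀ σ t u vm vp z H) : Hᴴ * formC q₀ z * H = formC q₀ z := by
  obtain ⟨ψm, ψp, hm, hp, hH⟩ := h
  rw [← hm.pairing hq₀ hvm hz hm 0]
  conv_rhs => rw [hm.pairing hq₀ hvm hz hm 0, ← hp.pairing hq₀ hvp hz hp 0, hH]
  rw [Matrix.conjTranspose_mul]
  simp only [mul_assoc]

theorem IsScatteringMatrix.eq (hq₀ : 0 < q₀) (hvm : ‖vm‖ = q₀) (hvp : ‖vp‖ = q₀)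
    (hz : (z : ℂ) ∈ regularSet q₀) {H H' : M3} (h : IsScatteringMatrix q₀ σ t u vm vp z H)
    (h' : IsScatteringMatrix q₀ σ t u vm vp z H') : H = H' := by
  obtain ⟨ψm, ψp, hm, hp, hH⟩ := h
  obtain ⟨ψm', ψp', hm', hp', hH'⟩ := h'
  obtain rfl := hm.unique hq₀ hvm hz hm'
  obtain rfl := hp.unique hq₀ hvp hz hp'
  have h1 : (formCinv q₀ z * ((ψm 0)ᴴ * matJ)) * ψm 0 = 1 := by
    rw [← formCinv_mul_formC hz, ← hm.pairing hq₀ hvm hz hm 0]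
    simp only [mul_assoc]
  rw [← one_mul H, ← one_mul H', ← h1, mul_assoc _ _ H, mul_assoc _ _ H', ← hH, ← hH']

theorem IsScatteringMatrix.scatInv_mul (hq₀ : 0 < q₀) (hvm : ‖vm‖ = q₀)
    (hvp : ‖vp‖ = q₀) (hz : (z : ℂ) ∈ regularSet q₀) {H : M3}
    (h : IsScatteringMatrix q₀ σ t u vm vp z H) : scatInv q₀ z H * H = 1 := by
  rw [scatInv, mul_assoc, h.conjTranspose_mul_mul hq₀ hvm hvp hz, formCinv_mul_formC hz]

end

/-! ### Symmetry under `z ↦ q₀² / z` -/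

section

variable {q₀ : ℝ} {z : ℂ}

theorem kz_sq_div (hq₀ : 0 < q₀) (hz : z ≠ 0) : kz q₀ ((q₀ : ℂ) ^ 2 / z) = kz q₀ z := by
  have hq : (q₀ : ℂ) ≠ 0 := by exact_mod_cast hq₀.ne'
  simp only [kz]
  field_simp
  ring

theorem lamz_sq_div (hq₀ : 0 < q₀) (hz : z ≠ 0) : lamz q₀ ((q₀ : ℂ) ^ 2 / z) = -lamz q₀ z := by
  have hq : (q₀ : ℂ) ≠ 0 := by exact_mod_cast hq₀.ne'
  simp only [lamz]
  field_simp
  ring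

theorem sq_div_mem_regularSet (hq₀ : 0 < q₀) (hz : z ∈ regularSet q₀) :
    (q₀ : ℂ) ^ 2 / z ∈ regularSet q₀ := by
  have hq : (q₀ : ℂ) ≠ 0 := by exact_mod_cast hq₀.ne'
  obtain ⟨h0, h1⟩ := hz
  refine ⟨by positivity, ?_⟩
  have : ((q₀ : ℂ) ^ 2 / z) ^ 2 - (q₀ : ℂ) ^ 2 = -((q₀ : ℂ) ^ 2 / z ^ 2) * (z ^ 2 - q₀ ^ 2) := by
    field_simp
    ring
  rw [this]
  exact mul_ne_zero (neg_ne_zero.2 (by positivity)) h1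

theorem rho_sq_div (hq₀ : 0 < q₀) (hz : z ∈ regularSet q₀) :
    rho q₀ ((q₀ : ℂ) ^ 2 / z) = -(rho q₀ z * (q₀ : ℂ) ^ 2 / z ^ 2) := by
  have hq : (q₀ : ℂ) ≠ 0 := by exact_mod_cast hq₀.ne'
  have h := (sq_div_mem_regularSet hq₀ hz).2
  obtain ⟨h0, h1⟩ := hz
  simp only [rho]
  field_simp
  field_simp at h
  grind

/-- The change of basis in the symmetry under `z ↦ q₀² / z`. -/
noncomputable def symm (q₀ : ℝ) (z : ℂ) : M3 :=
  !![0, 0, I * (q₀ / z); 0, 1, 0; -I * (q₀ / z), 0, 0]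

/-- The inverse of `symm`. -/
noncomputable def symmInv (q₀ : ℝ) (z : ℂ) : M3 :=
  !![0, 0, I * (z / q₀); 0, 1, 0; -I * (z / q₀), 0, 0]

theorem symm_mul_symmInv (hq₀ : 0 < q₀) (hz : z ≠ 0) : symm q₀ z * symmInv q₀ z = 1 := by
  have hq : (q₀ : ℂ) ≠ 0 := by exact_mod_cast hq₀.ne'
  ext i j
  fin_cases i <;> fin_cases j <;>
    simp [symm, symmInv, Matrix.mul_apply, Fin.sum_univ_three] <;> field_simp <;> grind [I_sq]

theorem matY_sq_div (hq₀ : 0 < q₀) (v : V2) (hz : z ∈ regularSet q₀) :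
    matY q₀ v ((q₀ : ℂ) ^ 2 / z) = matY q₀ v z * symm q₀ z := by
  have hq : (q₀ : ℂ) ≠ 0 := by exact_mod_cast hq₀.ne'
  obtain ⟨h0, h1⟩ := id hz
  ext i j
  fin_cases i <;> fin_cases j <;>
    simp [symm, matY, Matrix.mul_apply, Fin.sum_univ_three, rho_sq_div hq₀ hz] <;>
    field_simp <;> grind [I_sq]

theorem expDelta_sq_div (hq₀ : 0 < q₀) (hz : z ≠ 0) (σ x t : ℝ) :
    symm q₀ z * expDelta q₀ σ ((q₀ : ℂ) ^ 2 / z) x t = expDelta q₀ σ z x t * symm q₀ z := by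
  have h1 : delta1 q₀ σ ((q₀ : ℂ) ^ 2 / z) x t = -delta1 q₀ σ z x t := by
    simp only [delta1, kz_sq_div hq₀ hz, lamz_sq_div hq₀ hz]
    ring
  have h2 : delta2 q₀ σ ((q₀ : ℂ) ^ 2 / z) x t = delta2 q₀ σ z x t := by
    simp only [delta2, kz_sq_div hq₀ hz, lamz_sq_div hq₀ hz]
    ring
  simp only [expDelta, h1, h2]
  ext i j
  rw [Matrix.mul_diagonal, Matrix.diagonal_mul]
  fin_cases i <;> fin_cases j <;> simp [symm] <;> ring

end

section

variable {q₀ σ t z : ℝ} {u : ℝ → V2} {v vm vp : V2} {l : Filter ℝ} {ψ : ℝ → M3}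

/-- The Lax matrix depends on `z` only through `k`, which is invariant; `λ` changes sign, and `symm`
records the resulting exchange of columns. -/
theorem IsJost.symm_mul (hq₀ : 0 < q₀) (hz : (z : ℂ) ∈ regularSet q₀)
    (h : IsJost q₀ σ t u v l z ψ) :
    IsJost q₀ σ t u v l (q₀ ^ 2 / z) fun x => ψ x * symm q₀ z := by
  have e : ((q₀ ^ 2 / z : ℝ) : ℂ) = (q₀ : ℂ) ^ 2 / z := by push_cast; rfl
  constructor
  · intro x i j
    have h1 : laxX q₀ ((q₀ ^ 2 / z : ℝ) : ℂ) (u x) = laxX q₀ z (u x) := by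
      rw [laxX, laxX, e, kz_sq_div hq₀ hz.1]
    rw [h1, ← mul_assoc]
    simp only [Matrix.mul_apply (M := ψ _), Matrix.mul_apply (M := laxX q₀ z (u x) * ψ x)]
    exact HasDerivAt.fun_sum fun p _ => (h.1 x i p).mul_const _
  · rw [e]
    have h1 : ∀ x, ψ x * symm q₀ z - matY q₀ v ((q₀ : ℂ) ^ 2 / z) *
        expDelta q₀ σ ((q₀ : ℂ) ^ 2 / z) x t =
        (ψ x - matY q₀ v z * expDelta q₀ σ z x t) * symm q₀ z := by
      intro x
      rw [matY_sq_div hq₀ v hz, mul_assoc, expDelta_sq_div hq₀ hz.1, sub_mul, mul_assoc]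
    simp only [h1]
    have h2 : Continuous fun A : M3 => A * symm q₀ z := continuous_id.mul continuous_const
    have h3 := (h2.tendsto 0).comp h.2
    rwa [zero_mul] at h3

theorem IsScatteringMatrix.symm_mul (hq₀ : 0 < q₀) (hz : (z : ℂ) ∈ regularSet q₀) {H : M3}
    (h : IsScatteringMatrix q₀ σ t u vm vp z H) :
    IsScatteringMatrix q₀ σ t u vm vp (q₀ ^ 2 / z) (symmInv q₀ z * (H * symm q₀ z)) := by
  obtain ⟨ψm, ψp, hm, hp, hH⟩ := h
  refine ⟨_, _, hm.symm_mul hq₀ hz, hp.symm_mul hq₀ hz, fun x => ?_⟩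
  rw [mul_assoc, ← mul_assoc (symm q₀ z), symm_mul_symmInv hq₀ hz.1, one_mul, hH, mul_assoc]

end

/-! ### The columns of the Jost eigenfunction in the half-planes -/

section

variable {q₀ : ℝ} {z : ℂ}

theorem inv_im_nonneg_iff : 0 ≤ (z⁻¹).im ↔ z.im ≤ 0 := by
  by_cases hz : z = 0
  · simp [hz]
  · rw [Complex.inv_im, le_div_iff₀ (Complex.normSq_pos.2 hz)]
    simp

theorem inv_im_nonpos_iff : (z⁻¹).im ≤ 0 ↔ 0 ≤ z.im := by
  rw [← inv_im_nonneg_iff, inv_inv]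

theorem sq_div_im (q₀ : ℝ) (z : ℂ) : ((q₀ : ℂ) ^ 2 / z).im = q₀ ^ 2 * (z⁻¹).im := by
  rw [div_eq_mul_inv, ← ofReal_pow, Complex.im_ofReal_mul]

/-- The nonzero exponent differences are `-z` and `-(z - q₀²/z)`, and `Im (q₀²/z)` has the sign
opposite to `Im z`. -/
theorem expo_zero_re_nonneg (hz : 0 ≤ z.im) (l : Fin 3) :
    0 ≤ (I * (expo q₀ z l - expo q₀ z 0)).re := by
  have h := sq_div_im q₀ z
  have h1 := mul_nonpos_of_nonneg_of_nonpos (sq_nonneg q₀) (inv_im_nonpos_iff.2 hz)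
  have e1 : -kz q₀ z - lamz q₀ z = -z := by simp only [kz, lamz]; ring
  have e2 : -lamz q₀ z - lamz q₀ z = -(z - (q₀ : ℂ) ^ 2 / z) := by simp only [lamz]; ring
  fin_cases l
  · simp
  · simp [expo, e1, hz]
  · simp only [expo, Fin.reduceFinMk, Matrix.cons_val, e2, Complex.I_mul_re, Complex.neg_im,
      Complex.sub_im]
    linarith

theorem expo_two_re_nonneg (hz : z.im ≤ 0) (l : Fin 3) :
    0 ≤ (I * (expo q₀ z l - expo q₀ z 2)).re := by
  have h := sq_div_im q₀ z
  have h1 := mul_nonneg (sq_nonneg q₀) (inv_im_nonneg_iff.2 hz)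
  have e1 : -kz q₀ z - -lamz q₀ z = -((q₀ : ℂ) ^ 2 / z) := by simp only [kz, lamz]; ring
  have e2 : lamz q₀ z - -lamz q₀ z = z - (q₀ : ℂ) ^ 2 / z := by simp only [lamz]; ring
  fin_cases l
  · simp only [expo, Matrix.cons_val, Fin.zero_eta, e2, Complex.I_mul_re,
      Complex.sub_im]
    linarith
  · simp only [expo, Matrix.cons_val, Fin.mk_one, e1, Complex.I_mul_re,
      Complex.neg_im]
    linarith
  · simp

/-- The differences are `z` and `q₀²/z`, whose imaginary parts have opposite signs; this confines
the second column to the real line. -/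
theorem expo_one_re_nonneg (hz : z.im = 0) (l : Fin 3) :
    0 ≤ (I * (expo q₀ z l - expo q₀ z 1)).re := by
  have h := sq_div_im q₀ z
  have e1 : lamz q₀ z - -kz q₀ z = z := by simp only [kz, lamz]; ring
  have e2 : -lamz q₀ z - -kz q₀ z = (q₀ : ℂ) ^ 2 / z := by simp only [kz, lamz]; ring
  fin_cases l
  · simp [expo, e1, hz, -sub_neg_eq_add]
  · simp
  · simp only [expo, Fin.reduceFinMk, Matrix.cons_val, e2, Complex.I_mul_re, h]
    simp [hz]

theorem IsColumn.sq_div (hq₀ : 0 < q₀) {u : ℝ → V2} {v : V2} (hz : z ∈ regularSet q₀)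
    {m : ℝ → Fin 3 → ℂ} (h : IsColumn q₀ u v 0 ((q₀ : ℂ) ^ 2 / z) m) :
    IsColumn q₀ u v 2 z fun x i => I * z / q₀ * m x i := by
  have hq : (q₀ : ℂ) ≠ 0 := by exact_mod_cast hq₀.ne'
  constructor
  · intro x i
    refine ((h.1 x i).const_mul (I * z / q₀)).congr_deriv ?_
    have h1 : laxX q₀ ((q₀ : ℂ) ^ 2 / z) (u x) = laxX q₀ z (u x) := by
      rw [laxX, laxX, kz_sq_div hq₀ hz.1]
    have h2 : expo q₀ ((q₀ : ℂ) ^ 2 / z) 0 = expo q₀ z 2 := by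
      simp [expo, lamz_sq_div hq₀ hz.1]
    rw [h1, h2]
    simp only [Matrix.mulVec, dotProduct, Fin.sum_univ_three]
    ring
  · refine tendsto_pi_nhds.2 fun i => ?_
    have h1 := (tendsto_pi_nhds.1 h.2 i).const_mul (I * z / q₀)
    have h2 : I * z / q₀ * matY q₀ v ((q₀ : ℂ) ^ 2 / z) i 0 = matY q₀ v z i 2 := by
      have h3 := hz.1
      rw [matY_sq_div hq₀ v hz]
      simp only [Matrix.mul_apply, Fin.sum_univ_three, symm]
      simp
      field_simp
      grind [I_sq]
    rwa [h2] at h1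

/-- The columns of the Jost eigenfunction normalized at `+∞`, without exponential factors: the
first in the upper, the third in the lower half-plane, the second on the real line. -/
structure IsColumnFamily (q₀ : ℝ) (u : ℝ → V2) (v : V2) (m : Fin 3 → ℂ → ℝ → Fin 3 → ℂ) :
    Prop where
  zero : ∀ z ∈ regularSet q₀, 0 ≤ z.im → IsColumn q₀ u v 0 z (m 0 z)
  one : ∀ z ∈ regularSet q₀, z.im = 0 → IsColumn q₀ u v 1 z (m 1 z)
  two : ∀ z ∈ regularSet q₀, z.im ≤ 0 → IsColumn q₀ u v 2 z (m 2 z)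
  two_eq : ∀ z x i, m 2 z x i = I * z / q₀ * m 0 ((q₀ : ℂ) ^ 2 / z) x i
  continuousOn : ∀ x i, ContinuousOn (fun z => m 0 z x i) (upperHalf ∩ regularSet q₀)
  differentiableOn : ∀ x i, DifferentiableOn ℂ (fun z => m 0 z x i) (interior upperHalf)

theorem interior_upperHalf : interior upperHalf = {z : ℂ | 0 < z.im} :=
  Complex.interior_setOfPred_le_im 0

theorem interior_lowerHalf : interior lowerHalf = {z : ℂ | z.im < 0} :=
  Complex.interior_setOfPred_im_le 0

theorem mem_regularSet_of_im_ne_zero (hz : z.im ≠ 0) : z ∈ regularSet q₀ := by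
  refine ⟨fun h => hz (by simp [h]), fun h => ?_⟩
  rw [sub_eq_zero, sq_eq_sq_iff_eq_or_eq_neg] at h
  rcases h with h | h <;> simp [h] at hz

theorem exists_isColumnFamily (hq₀ : 0 < q₀) {u : ℝ → V2} {v : V2} (hv : ‖v‖ = q₀)
    (huc : Continuous u) (hui : IntegrableOn (fun x => u x - v) (Ioi 0)) :
    ∃ m, IsColumnFamily q₀ u v m := by
  obtain ⟨m0, h0, h0'⟩ := exists_columns hq₀ hv huc hui 0 (D := upperHalf ∩ regularSet q₀)
    inter_subset_right fun z hz => expo_zero_re_nonneg hz.1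
  obtain ⟨m1, h1, -⟩ := exists_columns hq₀ hv huc hui 1 (D := {z | z.im = 0} ∩ regularSet q₀)
    inter_subset_right fun z hz => expo_one_re_nonneg hz.1
  -- The third column is defined from the first by symmetry instead of by its own Volterra equation,
  -- so the symmetry relation holds by definition and regularity carries over.
  refine ⟨![m0, m1, fun z x i => I * z / q₀ * m0 ((q₀ : ℂ) ^ 2 / z) x i],
    fun z hz hi => h0 z ⟨hi, hz⟩, fun z hz hi => h1 z ⟨hi, hz⟩, fun z hz hi => ?_,
    fun z x i => rfl, fun x i => (h0' x i).1, fun x i => (h0' x i).2.mono ?_⟩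
  · refine (h0 _ ⟨?_, sq_div_mem_regularSet hq₀ hz⟩).sq_div hq₀ hz
    change 0 ≤ ((q₀ : ℂ) ^ 2 / z).im
    rw [sq_div_im]
    exact mul_nonneg (sq_nonneg _) (inv_im_nonneg_iff.2 hi)
  · refine interior_maximal (fun z hz => ⟨interior_subset hz, ?_⟩) isOpen_interior
    rw [interior_upperHalf] at hz
    exact mem_regularSet_of_im_ne_zero (ne_of_gt hz)

end

/-! ### The entries of the scattering matrix -/

/-- The bilinear pairing of the columns at the origin, with the factor that makes it an entry of
the scattering matrix. -/
noncomputable def colPair (q₀ : ℝ) (m' m : Fin 3 → ℂ → ℝ → Fin 3 → ℂ) (i j : Fin 3) (z : ℂ) : ℂ :=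
  -(![(rho q₀ z)⁻¹, 1, (rho q₀ z)⁻¹] i * ∑ p, m' i z 0 p * m j z 0 p)

/-- The conjugation in the Hermitian pairing undoes that of the reflection, and the signs of `J`
cancel. What is left is bilinear in the columns and so holomorphic wherever both are. -/
theorem scat_reflect_apply (q₀ σ t : ℝ) (z : ℂ) (m' m : Fin 3 → ℂ → ℝ → Fin 3 → ℂ)
    (i j : Fin 3) :
    scat q₀ z (reflect (ofColumns q₀ σ (-t) z fun i => m' i z))
      (ofColumns q₀ σ t z fun i => m i z) i j =
    phase q₀ σ z 0 (-t) i * phase q₀ σ z 0 t j * colPair q₀ m' m i j z := by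
  rw [scat, formCinv, Matrix.diagonal_mul, pairing_apply]
  simp only [reflect_apply, ofColumns, colPair, Fin.sum_univ_three, neg_zero]
  fin_cases i <;> simp [signJ] <;> ring

theorem phase_neg (q₀ σ : ℝ) (z : ℂ) (t : ℝ) (i : Fin 3) :
    phase q₀ σ z 0 (-t) i * phase q₀ σ z 0 t i = 1 := by
  fin_cases i <;> simp [phase, ← Complex.exp_add, delta1, delta2]

theorem scat_reflect_apply_self (q₀ σ t : ℝ) (z : ℂ) (m' m : Fin 3 → ℂ → ℝ → Fin 3 → ℂ)
    (i : Fin 3) :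
    scat q₀ z (reflect (ofColumns q₀ σ (-t) z fun i => m' i z))
      (ofColumns q₀ σ t z fun i => m i z) i i = colPair q₀ m' m i i z := by
  rw [scat_reflect_apply, phase_neg, one_mul]

/-- The two factors `i z / q₀` are compensated by the transformation of `ρ̂`. Continuation and
limits of the `33` entry thereby come from the `11` entry. -/
theorem colPair_two_two {q₀ : ℝ} (hq₀ : 0 < q₀) {u u' : ℝ → V2} {v v' : V2}
    {m m' : Fin 3 → ℂ → ℝ → Fin 3 → ℂ} (h : IsColumnFamily q₀ u v m)
    (h' : IsColumnFamily q₀ u' v' m') {z : ℂ} (hz : z ∈ regularSet q₀) :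
    colPair q₀ m' m 2 2 z = colPair q₀ m' m 0 0 ((q₀ : ℂ) ^ 2 / z) := by
  have hq : (q₀ : ℂ) ≠ 0 := by exact_mod_cast hq₀.ne'
  have hr := rho_ne_zero hz
  have h0 := hz.1
  simp only [colPair, h.two_eq, h'.two_eq, Fin.sum_univ_three, rho_sq_div hq₀ hz]
  simp
  field_simp
  grind [I_sq]

/-! ### The two ends of the potential -/

namespace IsPotential

variable {u : ℝ → V2} {vm vp : V2}

theorem hasDerivAt (h : IsPotential u vm vp) (x : ℝ) : HasDerivAt u (deriv u x) x :=
  (h.contDiff.differentiable (by norm_num) x).hasDerivAt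

theorem contDiff_deriv (h : IsPotential u vm vp) : ContDiff ℝ 1 (deriv u) :=
  ((contDiff_succ_iff_deriv (n := 1)).1 (one_add_one_eq_two (R := WithTop ℕ∞) ▸ h.contDiff)).2.2

theorem hasDerivAt_deriv (h : IsPotential u vm vp) (x : ℝ) :
    HasDerivAt (deriv u) (deriv (deriv u) x) x :=
  (h.contDiff_deriv.differentiable one_ne_zero x).hasDerivAt

theorem continuous_deriv2 (h : IsPotential u vm vp) : Continuous (deriv (deriv u)) :=
  h.contDiff_deriv.continuous_deriv le_rfl

theorem isTail_apply (h : IsPotential u vm vp) (i : Fin 2) :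
    IsTail (fun x => u x i) (fun x => deriv u x i) (fun x => deriv (deriv u) x i) (vp i) := by
  obtain ⟨L, hp⟩ : ∃ L : V2 →L[ℝ] ℂ, ∀ w : V2, w i = L w :=
    ⟨(EuclideanSpace.proj i : V2 →L[ℂ] ℂ).restrictScalars ℝ, fun w => rfl⟩
  simp only [hp]
  refine ⟨fun x => ?_, fun x => ?_, ?_, ?_, ?_, ?_, ?_⟩
  · exact L.hasFDerivAt.comp_hasDerivAt x (h.hasDerivAt x)
  · exact L.hasFDerivAt.comp_hasDerivAt x
      (h.hasDerivAt_deriv x)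
  · exact L.continuous.comp h.continuous_deriv2
  · exact (L.continuous.tendsto _).comp h.tendsto_right
  · simpa only [map_sub] using! L.integrable_comp h.integrable_right
  · exact L.integrable_comp h.integrable_deriv.integrableOn
  · exact L.integrable_comp h.integrable_deriv2.integrableOn

theorem isRightTail (h : IsPotential u vm vp) : IsRightTail u vp :=
  ⟨_, _, _, _, h.isTail_apply 0, h.isTail_apply 1⟩

end IsPotential

/-- The real-linear isometry `v ↦ -v̄`. -/
noncomputable def negConjL : V2 →L[ℝ] V2 :=
  LinearMap.mkContinuous
    { toFun := negConj
      map_add' := fun v w => by ext i; fin_cases i <;> simp [negConj] <;> ring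
      map_smul' := fun c v => by ext i; fin_cases i <;> simp [negConj] }
    1 fun v => by simp [norm_negConj]

theorem negConjL_apply (v : V2) : negConjL v = negConj v := rfl

theorem IsPotential.reflect {u : ℝ → V2} {vm vp : V2} (h : IsPotential u vm vp) :
    IsPotential (fun x => negConj (u (-x))) (negConj vp) (negConj vm) := by
  have hd : deriv (fun x => negConj (u (-x))) = fun x => negConjL (-deriv u (-x)) := by
    ext1 x
    have h1 := (h.hasDerivAt (-x)).scomp x (hasDerivAt_neg x)
    have h2 := negConjL.hasFDerivAt.comp_hasDerivAt x h1
    simpa using! h2.deriv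
  have hd2 : deriv (deriv fun x => negConj (u (-x))) =
      fun x => negConjL (deriv (deriv u) (-x)) := by
    rw [hd]
    ext1 x
    have h1 := ((h.hasDerivAt_deriv (-x)).scomp x (hasDerivAt_neg x)).fun_neg
    have h2 := negConjL.hasFDerivAt.comp_hasDerivAt x h1
    refine h2.deriv.trans ?_
    simp
  refine ⟨?_, ?_, ?_, ?_, ?_, ?_, ?_⟩
  · exact (negConjL.continuous.tendsto _).comp (h.tendsto_right.comp tendsto_neg_atBot_atTop)
  · exact (negConjL.continuous.tendsto _).comp (h.tendsto_left.comp tendsto_neg_atTop_atBot)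
  -- Indicator functions move the question to the whole line, where integrability is invariant under
  -- `x ↦ -x`.
  · have h1 := negConjL.integrable_comp h.integrable_right
    have h2 := (integrable_indicator_iff measurableSet_Ioi).2 h1
    have h3 := h2.comp_neg
    refine (integrable_indicator_iff measurableSet_Iio).1 (h3.congr (ae_of_all _ fun x => ?_))
    simp only [indicator, mem_Ioi, mem_Iio, neg_pos, map_sub, negConjL_apply]
  · have h1 := negConjL.integrable_comp h.integrable_left
    have h2 := (integrable_indicator_iff measurableSet_Iio).2 h1
    have h3 := h2.comp_neg
    refine (integrable_indicator_iff measurableSet_Ioi).1 (h3.congr (ae_of_all _ fun x => ?_))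
    simp only [indicator, mem_Ioi, mem_Iio, neg_lt_zero, map_sub, negConjL_apply]
  · exact negConjL.contDiff.comp (h.contDiff.comp contDiff_neg)
  · rw [hd]
    exact negConjL.integrable_comp h.integrable_deriv.comp_neg.neg
  · rw [hd2]
    exact negConjL.integrable_comp h.integrable_deriv2.comp_neg

/-! ### Pairing of the asymptotic forms -/

section

variable {C : ℝ} {z : ℂ} {s y y' : V2} {w w' : Fin 3 → ℂ}

theorem norm_le_of_norm_sub_div_le {a b c d : ℂ} {N : ℝ} (hN : 0 ≤ N)
    (h : ‖a - b * c / z - d‖ ≤ C / ‖z‖) (hb : ‖b‖ ≤ N) (hc : ‖c‖ ≤ C) :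
    ‖a - d‖ ≤ (C + N * C) / ‖z‖ := by
  have e : a - d = (a - b * c / z - d) + b * c / z := by ring
  have h1 : ‖b * c / z‖ ≤ N * C / ‖z‖ := by
    rw [norm_div, norm_mul]
    gcongr
  rw [e, add_div]
  exact norm_add_le_of_le h h1

/-- The leading entries contribute `i · i = -1`; the lower components are `O(1/z)`. -/
theorem FirstColumnBound.pairing (hC : 0 ≤ C) (h : FirstColumnBound C z s w)
    (h' : FirstColumnBound C z (negConj s) w') (hz : 1 ≤ ‖z‖) :
    ‖∑ p, w' p * w p + 1‖ ≤ (C * C + C + 2 * (C * (C + ‖s‖ * C))) / ‖z‖ := by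
  have h4 : C / ‖z‖ ^ 2 ≤ C / ‖z‖ := by
    gcongr
    exact le_self_pow₀ hz two_ne_zero
  have k1 := norm_le_of_norm_sub_div_le (d := 0) (norm_nonneg s)
    (by rw [sub_zero]; exact h.one.trans h4) (PiLp.norm_apply_le s 0) (h.norm_le 0)
  have k2 := norm_le_of_norm_sub_div_le (d := 0) (norm_nonneg s)
    (by rw [sub_zero]; exact h.two.trans h4) (PiLp.norm_apply_le s 1) (h.norm_le 0)
  rw [sub_zero] at k1 k2
  have e : ∑ p, w' p * w p + 1 =
      w' 0 * (w 0 - I) + I * (w' 0 - I) + w' 1 * w 1 + w' 2 * w 2 := by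
    rw [Fin.sum_univ_three]
    linear_combination I_sq
  rw [e]
  refine (norm_add_le_of_le (norm_add_le_of_le (norm_add_le_of_le
    (norm_mul_le_of_le (h'.norm_le 0) h.zero) (norm_mul_le_of_le norm_I.le h'.zero))
    (norm_mul_le_of_le (h'.norm_le 1) k1)) (norm_mul_le_of_le (h'.norm_le 2) k2)).trans_eq ?_
  ring

/-- Regrouping is an exact identity: the corrections of order `1/z` cancel because the reflected
potential at the origin is `-s̄`. Each remaining term has a factor `O(1/z²)`. -/
theorem FirstColumnBound.pairing_other (h : FirstColumnBound C z (negConj s) w')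
    (h' : OtherColumnBound C z s y w) : ‖∑ p, w' p * w p‖ ≤ 3 * (C * C) / ‖z‖ ^ 2 := by
  have e : ∑ p, w' p * w p = w' 0 * (w 0 - (conj (s 0) * w 1 + conj (s 1) * w 2) / z) +
      w 1 * (w' 1 - negConj s 0 * w' 0 / z) + w 2 * (w' 2 - negConj s 1 * w' 0 / z) := by
    simp [Fin.sum_univ_three, negConj]
    ring
  rw [e]
  refine (norm_add_le_of_le (norm_add_le_of_le (norm_mul_le_of_le (h.norm_le 0) h'.diag)
    (norm_mul_le_of_le (h'.norm_le 1) h.one)) (norm_mul_le_of_le (h'.norm_le 2) h.two)).trans_eq ?_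
  ring

theorem OtherColumnBound.pairing_first (h : OtherColumnBound C z (negConj s) y w')
    (h' : FirstColumnBound C z s w) : ‖∑ p, w' p * w p‖ ≤ 3 * (C * C) / ‖z‖ ^ 2 := by
  have e : ∑ p, w' p * w p =
      w 0 * (w' 0 - (conj (negConj s 0) * w' 1 + conj (negConj s 1) * w' 2) / z) +
      w' 1 * (w 1 - s 0 * w 0 / z) + w' 2 * (w 2 - s 1 * w 0 / z) := by
    simp [Fin.sum_univ_three, negConj]
    ring
  rw [e]
  refine (norm_add_le_of_le (norm_add_le_of_le (norm_mul_le_of_le (h'.norm_le 0) h.diag)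
    (norm_mul_le_of_le (h.norm_le 1) h'.one)) (norm_mul_le_of_le (h.norm_le 2) h'.two)).trans_eq ?_
  ring

theorem OtherColumnBound.pairing (h : OtherColumnBound C z s y w)
    (h' : OtherColumnBound C z (negConj s) y' w') :
    ‖∑ p, w' p * w p - (y' 0 * y 0 + y' 1 * y 1)‖ ≤
      (C * C + 2 * ((C + ‖y‖) * (C + ‖s‖ * C))) / ‖z‖ := by
  have k1 := norm_le_of_norm_sub_div_le (norm_nonneg s) h.one (PiLp.norm_apply_le s 0)
    (h.norm_le 0)
  have k2 := norm_le_of_norm_sub_div_le (norm_nonneg s) h.two (PiLp.norm_apply_le s 1)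
    (h.norm_le 0)
  have l1 := norm_le_of_norm_sub_div_le (norm_nonneg s) h'.one
    ((PiLp.norm_apply_le _ 0).trans (norm_negConj s).le) (h'.norm_le 0)
  have l2 := norm_le_of_norm_sub_div_le (norm_nonneg s) h'.two
    ((PiLp.norm_apply_le _ 1).trans (norm_negConj s).le) (h'.norm_le 0)
  have e : ∑ p, w' p * w p - (y' 0 * y 0 + y' 1 * y 1) = w' 0 * w 0 +
      (w' 1 * (w 1 - y 0) + y 0 * (w' 1 - y' 0)) +
      (w' 2 * (w 2 - y 1) + y 1 * (w' 2 - y' 1)) := by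
    rw [Fin.sum_univ_three]
    ring
  rw [e]
  refine (norm_add_le_of_le (norm_add_le_of_le (norm_mul_le_of_le (h'.norm_le 0) h.zero)
    (norm_add_le_of_le (norm_mul_le_of_le (h'.norm_le 1) k1)
      (norm_mul_le_of_le (PiLp.norm_apply_le y 0) l1)))
    (norm_add_le_of_le (norm_mul_le_of_le (h'.norm_le 2) k2)
      (norm_mul_le_of_le (PiLp.norm_apply_le y 1) l2))).trans_eq ?_
  ring

theorem FirstColumnBound.mono {C' : ℝ} (h : FirstColumnBound C z s w) (hC : C ≤ C') :
    FirstColumnBound C' z s w :=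
  ⟨fun i => (h.norm_le i).trans hC, h.zero.trans (by gcongr), h.one.trans (by gcongr),
    h.two.trans (by gcongr)⟩

theorem OtherColumnBound.mono {C' : ℝ} (h : OtherColumnBound C z s y w) (hC : C ≤ C') :
    OtherColumnBound C' z s y w :=
  ⟨fun i => (h.norm_le i).trans hC, h.zero.trans (by gcongr), h.diag.trans (by gcongr),
    h.one.trans (by gcongr), h.two.trans (by gcongr)⟩

end

/-! ### Entries of the scattering matrix for large `z` -/

/-- The limits of the second and third columns at infinity. -/
noncomputable def limCol (q₀ : ℝ) (v : V2) : Fin 3 → V2 :=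
  ![0, (q₀ : ℂ)⁻¹ • perp v, (q₀ : ℂ)⁻¹ • v]

theorem rho_inv_sub_one {q₀ : ℝ} {z : ℂ} (hz : z ≠ 0) :
    (rho q₀ z)⁻¹ - 1 = -((q₀ : ℂ) ^ 2 / z ^ 2) := by
  rw [rho, inv_div]
  field_simp
  ring

theorem norm_factor_sub_one_le {q₀ : ℝ} {z : ℂ} (hz : z ≠ 0) (i : Fin 3) :
    ‖(![(rho q₀ z)⁻¹, 1, (rho q₀ z)⁻¹] : Fin 3 → ℂ) i - 1‖ ≤ q₀ ^ 2 / ‖z‖ ^ 2 := by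
  have h : ‖(rho q₀ z)⁻¹ - 1‖ ≤ q₀ ^ 2 / ‖z‖ ^ 2 := by
    rw [rho_inv_sub_one hz]
    simp
  have h0 : 0 ≤ q₀ ^ 2 / ‖z‖ ^ 2 := by positivity
  fin_cases i
  · simpa using h
  · simpa using h0
  · simpa using h

theorem norm_factor_le {q₀ : ℝ} {z : ℂ} (hz : 1 ≤ ‖z‖) (i : Fin 3) :
    ‖(![(rho q₀ z)⁻¹, 1, (rho q₀ z)⁻¹] : Fin 3 → ℂ) i‖ ≤ 1 + q₀ ^ 2 := by
  have hz0 : z ≠ 0 := norm_pos_iff.1 (by linarith)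
  have h1 : q₀ ^ 2 / ‖z‖ ^ 2 ≤ q₀ ^ 2 := div_le_self (sq_nonneg _) (one_le_pow₀ hz)
  have h := norm_add_le_of_le (norm_factor_sub_one_le (q₀ := q₀) hz0 i) (norm_one (α := ℂ)).le
  rw [sub_add_cancel] at h
  linarith

theorem norm_colPair_sub_le {q₀ : ℝ} {z : ℂ} (hz : 1 ≤ ‖z‖)
    {m' m : Fin 3 → ℂ → ℝ → Fin 3 → ℂ} {i j : Fin 3} {c : ℂ} {K : ℝ}
    (h : ‖∑ p, m' i z 0 p * m j z 0 p + c‖ ≤ K / ‖z‖) :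
    ‖colPair q₀ m' m i j z - c‖ ≤ ((1 + q₀ ^ 2) * K + q₀ ^ 2 * ‖c‖) / ‖z‖ := by
  have hz0 : z ≠ 0 := norm_pos_iff.1 (by linarith)
  have h2 : q₀ ^ 2 / ‖z‖ ^ 2 ≤ q₀ ^ 2 / ‖z‖ := by
    gcongr
    exact le_self_pow₀ hz two_ne_zero
  have e : ∀ r P : ℂ, -(r * P) - c = -(r * (P + c)) + (r - 1) * c := fun r P => by ring
  rw [colPair, e]
  refine (norm_add_le_of_le ((norm_neg _).trans_le (norm_mul_le_of_le (norm_factor_le hz i) h))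
    (norm_mul_le_of_le ((norm_factor_sub_one_le hz0 i).trans h2) le_rfl)).trans_eq ?_
  ring

theorem norm_colPair_le {q₀ : ℝ} {z : ℂ} (hz : 1 ≤ ‖z‖)
    {m' m : Fin 3 → ℂ → ℝ → Fin 3 → ℂ} {i j : Fin 3} {K : ℝ}
    (h : ‖∑ p, m' i z 0 p * m j z 0 p‖ ≤ K / ‖z‖ ^ 2) :
    ‖colPair q₀ m' m i j z‖ ≤ ((1 + q₀ ^ 2) * K) / ‖z‖ ^ 2 := by
  rw [colPair, norm_neg]
  refine (norm_mul_le_of_le (norm_factor_le hz i) h).trans_eq ?_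
  ring

/-- The limits of the entries of the lower right block of the scattering matrix. -/
noncomputable def limBlock (q₀ : ℝ) (vm vp : V2) (i j : Fin 3) : ℂ :=
  -(limCol q₀ (negConj vm) i 0 * limCol q₀ vp j 0 + limCol q₀ (negConj vm) i 1 * limCol q₀ vp j 1)

/-- The column forms of both ends are paired at the origin, each in the region where its columns
live. The prefactor `ρ̂⁻¹ = 1 - q₀²/z²` only affects the constants. -/
theorem exists_colPair_bound {q₀ : ℝ} (hq₀ : 0 < q₀) {u : ℝ → V2} {vm vp : V2} (hvm : ‖vm‖ = q₀)
    (hvp : ‖vp‖ = q₀) (hu : IsPotential u vm vp) {m m' : Fin 3 → ℂ → ℝ → Fin 3 → ℂ}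
    (hm : IsColumnFamily q₀ u vp m)
    (hm' : IsColumnFamily q₀ (fun x => negConj (u (-x))) (negConj vm) m') :
    ∃ K R : ℝ, 0 ≤ K ∧ 1 ≤ R ∧ q₀ < R ∧ ∀ z : ℂ, R ≤ ‖z‖ →
      (0 ≤ z.im → ‖colPair q₀ m' m 0 0 z - 1‖ ≤ K / ‖z‖) ∧
      (z.im ≤ 0 → ‖colPair q₀ m' m 2 2 z - limBlock q₀ vm vp 2 2‖ ≤ K / ‖z‖) ∧
      (z.im = 0 → ∀ j ≠ 0, ‖colPair q₀ m' m 0 j z‖ ≤ K / ‖z‖ ^ 2 ∧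
        ‖colPair q₀ m' m j 0 z‖ ≤ K / ‖z‖ ^ 2 ∧
        ∀ i ≠ 0, ‖colPair q₀ m' m i j z - limBlock q₀ vm vp i j‖ ≤ K / ‖z‖) := by
  obtain ⟨C₁, R₁, hC₁, hR₁, hqR₁, h₁⟩ := exists_column_bound hq₀ hvp hu.isRightTail
  obtain ⟨C₂, R₂, hC₂, hR₂, hqR₂, h₂⟩ := exists_column_bound hq₀ ((norm_negConj vm).trans hvm)
    hu.reflect.isRightTail
  have e0 : negConj (u (-0)) = negConj (u 0) := by rw [neg_zero]
  obtain ⟨C, hC₁C, hC₂C⟩ : ∃ C, C₁ ≤ C ∧ C₂ ≤ C := ⟨_, le_max_left _ _, le_max_right _ _⟩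
  have hC : 0 ≤ C := hC₁.trans hC₁C
  obtain ⟨N, hN⟩ : ∃ N, ∀ j, ‖limCol q₀ vp j‖ ≤ N := ⟨∑ j, ‖limCol q₀ vp j‖, fun j =>
    Finset.single_le_sum (f := fun j => ‖limCol q₀ vp j‖) (fun _ _ => norm_nonneg _)
      (Finset.mem_univ j)⟩
  obtain ⟨M, hM⟩ : ∃ M, ∀ i j, ‖limBlock q₀ vm vp i j‖ ≤ M :=
    ⟨∑ i, ∑ j, ‖limBlock q₀ vm vp i j‖, fun i j =>
      (Finset.single_le_sum (f := fun j => ‖limBlock q₀ vm vp i j‖) (fun _ _ => norm_nonneg _)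
        (Finset.mem_univ j)).trans (Finset.single_le_sum
          (f := fun i => ∑ j, ‖limBlock q₀ vm vp i j‖)
          (fun _ _ => Finset.sum_nonneg fun _ _ => norm_nonneg _) (Finset.mem_univ i))⟩
  have hN0 : 0 ≤ N := (norm_nonneg _).trans (hN 0)
  have hM0 : 0 ≤ M := (norm_nonneg _).trans (hM 0 0)
  generalize u 0 = s at *
  obtain ⟨K₁, hK₁, hK₁e⟩ : ∃ K, 0 ≤ K ∧ K = C * C + C + 2 * (C * (C + ‖s‖ * C)) :=
    ⟨_, by positivity, rfl⟩
  obtain ⟨K₂, hK₂, hK₂e⟩ : ∃ K, 0 ≤ K ∧ K = C * C + 2 * ((C + N) * (C + ‖s‖ * C)) :=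
    ⟨_, by positivity, rfl⟩
  have hK₃ : 0 ≤ 3 * (C * C) := by positivity
  obtain ⟨K, hK, hKle⟩ : ∃ K, 0 ≤ K ∧ ∀ a b, a ≤ K₁ + K₂ + 3 * (C * C) → b ≤ 1 + M →
      (1 + q₀ ^ 2) * a + q₀ ^ 2 * b ≤ K :=
    ⟨(1 + q₀ ^ 2) * (K₁ + K₂ + 3 * (C * C)) + q₀ ^ 2 * (1 + M), by positivity,
      fun a b ha hb => add_le_add (mul_le_mul_of_nonneg_left ha (by positivity))
        (mul_le_mul_of_nonneg_left hb (by positivity))⟩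
  refine ⟨K, max R₁ R₂, hK, hR₁.trans (le_max_left _ _),
    hqR₁.trans_le (le_max_left _ _), fun z hz => ?_⟩
  have hz₁ := (le_max_left _ _).trans hz
  have hz₂ := (le_max_right _ _).trans hz
  have hz1 := hR₁.trans hz₁
  have hreg := mem_regularSet_of_lt_norm hq₀ (hqR₁.trans_le hz₁)
  have hf : 0 ≤ z.im → FirstColumnBound C z s (m 0 z 0) := fun hi =>
    ((h₁ z 0 _ hz₁ (expo_zero_re_nonneg hi) (hm.zero z hreg hi)).1 rfl).mono hC₁C
  have hf' : 0 ≤ z.im → FirstColumnBound C z (negConj s) (m' 0 z 0) := fun hi =>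
    e0 ▸ ((h₂ z 0 _ hz₂ (expo_zero_re_nonneg hi) (hm'.zero z hreg hi)).1 rfl).mono hC₂C
  have ho2 : z.im ≤ 0 → OtherColumnBound C z s (limCol q₀ vp 2) (m 2 z 0) := fun hi =>
    ((h₁ z 2 _ hz₁ (expo_two_re_nonneg hi) (hm.two z hreg hi)).2.2 rfl).mono hC₁C
  have ho2' : z.im ≤ 0 →
      OtherColumnBound C z (negConj s) (limCol q₀ (negConj vm) 2) (m' 2 z 0) := fun hi =>
    e0 ▸ ((h₂ z 2 _ hz₂ (expo_two_re_nonneg hi) (hm'.two z hreg hi)).2.2 rfl).mono hC₂C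
  have ho : z.im = 0 → ∀ j ≠ 0, OtherColumnBound C z s (limCol q₀ vp j) (m j z 0) := by
    intro hi j hj
    fin_cases j
    · exact absurd rfl hj
    · exact ((h₁ z 1 _ hz₁ (expo_one_re_nonneg hi) (hm.one z hreg hi)).2.1 rfl).mono hC₁C
    · exact ho2 hi.le
  have ho' : z.im = 0 → ∀ j ≠ 0,
      OtherColumnBound C z (negConj s) (limCol q₀ (negConj vm) j) (m' j z 0) := by
    intro hi j hj
    fin_cases j
    · exact absurd rfl hj
    · exact e0 ▸ ((h₂ z 1 _ hz₂ (expo_one_re_nonneg hi) (hm'.one z hreg hi)).2.1 rfl).mono hC₂C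
    · exact ho2' hi.le
  have hblock : ∀ i j, OtherColumnBound C z s (limCol q₀ vp j) (m j z 0) →
      OtherColumnBound C z (negConj s) (limCol q₀ (negConj vm) i) (m' i z 0) →
      ‖colPair q₀ m' m i j z - limBlock q₀ vm vp i j‖ ≤ K / ‖z‖ := by
    intro i j h h'
    have h3 : (C * C + 2 * ((C + ‖limCol q₀ vp j‖) * (C + ‖s‖ * C))) / ‖z‖ ≤ K₂ / ‖z‖ := by
      rw [hK₂e]
      gcongr
      exact hN j
    refine (norm_colPair_sub_le hz1 (c := limBlock q₀ vm vp i j)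
      (((h.pairing h').trans h3).trans_eq' ?_)).trans ?_
    · rw [limBlock, ← sub_eq_add_neg]
    · gcongr
      exact hKle _ _ (by linarith) (by linarith [hM i j])
  refine ⟨fun hi => ?_, fun hi => hblock 2 2 (ho2 hi) (ho2' hi), fun hi j hj => ⟨?_, ?_,
    fun i hi' => hblock i j (ho hi j hj) (ho' hi i hi')⟩⟩
  · refine (norm_colPair_sub_le hz1 ((hf hi).pairing hC (hf' hi) hz1)).trans ?_
    gcongr
    exact hKle _ _ (by linarith) (by rw [norm_one]; linarith)
  · refine (norm_colPair_le hz1 ((hf' hi.ge).pairing_other (ho hi j hj))).trans ?_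
    gcongr
    have := hKle (3 * (C * C)) 0 (by linarith) (by linarith)
    linarith
  · refine (norm_colPair_le hz1 ((ho' hi j hj).pairing_first (hf hi.ge))).trans ?_
    gcongr
    have := hKle (3 * (C * C)) 0 (by linarith) (by linarith)
    linarith

/-- The off-diagonal entries of the lower block carry the phases `exp (± i (δ₁ + δ₂))`. The
polynomially growing parts of `δ₁` and `δ₂` cancel, leaving a factor `q₀²/z`, so the limits at
infinity do not see `t`. -/
theorem delta_add_delta {q₀ σ : ℝ} {z : ℂ} (hz : z ≠ 0) (t : ℝ) :
    delta1 q₀ σ z 0 t + delta2 q₀ σ z 0 t = -((q₀ : ℂ) ^ 2 / z) *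
      (t * ((q₀ : ℂ) ^ 2 / z + σ * (3 * (q₀ : ℂ) ^ 2 + ((q₀ : ℂ) ^ 2 / z) ^ 2))) := by
  simp only [delta1, delta2, kz, lamz]
  field_simp
  push_cast
  ring

theorem exists_norm_phase_sub_one_le (q₀ σ t : ℝ) (hq₀ : 0 < q₀) :
    ∃ L : ℝ, 0 ≤ L ∧ ∀ z : ℝ, q₀ < |z| → ∀ i ≠ 0, ∀ j ≠ 0,
      ‖phase q₀ σ z 0 (-t) i * phase q₀ σ z 0 t j - 1‖ ≤ L / |z| := by
  refine ⟨q₀ ^ 2 * (|t| * (q₀ + |σ| * (3 * q₀ ^ 2 + q₀ ^ 2))), by positivity,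
    fun z hz i hi j hj => ?_⟩
  have hz0 : 0 < |z| := hq₀.trans hz
  have hz0' : z ≠ 0 := abs_pos.1 hz0
  set θ : ℝ := -(q₀ ^ 2 / z) * (t * (q₀ ^ 2 / z + σ * (3 * q₀ ^ 2 + (q₀ ^ 2 / z) ^ 2)))
  have hθ : delta1 q₀ σ z 0 t + delta2 q₀ σ z 0 t = θ := by
    rw [delta_add_delta (by exact_mod_cast hz0')]
    simp only [θ]
    push_cast
    rfl
  have hε : |q₀ ^ 2 / z| ≤ q₀ := by
    rw [abs_div, abs_of_nonneg (sq_nonneg q₀), div_le_iff₀ hz0]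
    nlinarith
  have hε2 : |(q₀ ^ 2 / z) ^ 2| ≤ q₀ ^ 2 := by
    rw [abs_pow]
    gcongr
  have hθn : |θ| ≤ q₀ ^ 2 * (|t| * (q₀ + |σ| * (3 * q₀ ^ 2 + q₀ ^ 2))) / |z| := by
    have h1 : |q₀ ^ 2 / z + σ * (3 * q₀ ^ 2 + (q₀ ^ 2 / z) ^ 2)| ≤
        q₀ + |σ| * (3 * q₀ ^ 2 + q₀ ^ 2) := by
      refine (abs_add_le _ _).trans (add_le_add hε ?_)
      rw [abs_mul]
      refine mul_le_mul_of_nonneg_left ((abs_add_le _ _).trans (add_le_add ?_ hε2)) (abs_nonneg _)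
      rw [abs_of_nonneg (by positivity)]
    simp only [θ]
    rw [abs_mul, abs_neg, abs_div, abs_of_nonneg (sq_nonneg q₀), abs_mul, div_mul_eq_mul_div]
    gcongr
  have hneg1 : delta1 q₀ σ z 0 (-t) = -delta1 q₀ σ z 0 t := by simp [delta1]
  have hneg2 : delta2 q₀ σ z 0 (-t) = -delta2 q₀ σ z 0 t := by simp [delta2]
  have h0 : 0 ≤ q₀ ^ 2 * (|t| * (q₀ + |σ| * (3 * q₀ ^ 2 + q₀ ^ 2))) / |z| := by positivity
  fin_cases i <;> fin_cases j
  · exact absurd rfl hi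
  · exact absurd rfl hi
  · exact absurd rfl hi
  · exact absurd rfl hj
  · rw [phase_neg, sub_self, norm_zero]
    exact h0
  · have e : phase q₀ σ z 0 (-t) 1 * phase q₀ σ z 0 t 2 = exp (I * (-θ : ℝ)) := by
      rw [ofReal_neg, ← hθ]
      simp only [phase, Matrix.cons_val, ← Complex.exp_add, hneg2]
      congr 1
      ring
    refine (congrArg (fun c => ‖c - 1‖) e).trans_le
      ((Real.norm_exp_I_mul_ofReal_sub_one_le).trans ?_)
    rwa [norm_neg, Real.norm_eq_abs]
  · exact absurd rfl hj
  · have e : phase q₀ σ z 0 (-t) 2 * phase q₀ σ z 0 t 1 = exp (I * (θ : ℝ)) := by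
      rw [← hθ]
      simp only [phase, Matrix.cons_val, ← Complex.exp_add, hneg1]
      congr 1
      ring
    refine (congrArg (fun c => ‖c - 1‖) e).trans_le
      ((Real.norm_exp_I_mul_ofReal_sub_one_le).trans ?_)
    rwa [Real.norm_eq_abs]
  · rw [phase_neg, sub_self, norm_zero]
    exact h0

/-! ### The scattering matrix at infinity -/

/-- The behaviour of the scattering matrix and of its inverse at infinity. -/
structure InftyBound (M : ℝ → M3) (c : Fin 3 → Fin 3 → ℂ) : Prop where
  zero_zero : (fun z => M z 0 0 - 1) =O[cobounded ℝ] fun z : ℝ => z⁻¹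
  row : ∀ j ≠ 0, (fun z => M z 0 j) =O[cobounded ℝ] fun z : ℝ => (z ^ 2)⁻¹
  col : ∀ j ≠ 0, (fun z => M z j 0) =O[cobounded ℝ] fun z : ℝ => (z ^ 2)⁻¹
  block : ∀ i ≠ 0, ∀ j ≠ 0, (fun z => M z i j - c i j) =O[cobounded ℝ] fun z : ℝ => z⁻¹

/-- The scattering matrix computed from the columns. -/
noncomputable def scatMatrix (q₀ σ t : ℝ) (m' m : Fin 3 → ℂ → ℝ → Fin 3 → ℂ) (z : ℝ) : M3 :=
  scat q₀ z (reflect (ofColumns q₀ σ (-t) z fun i => m' i z)) (ofColumns q₀ σ t z fun i => m i z)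

/-- In the first row and column off the corner only moduli matter, and the phases have modulus one;
the block has nonzero limits in general, so there the phases themselves must tend to one. -/
theorem inftyBound_scatMatrix {q₀ : ℝ} (hq₀ : 0 < q₀) (σ t : ℝ) {u : ℝ → V2} {vm vp : V2}
    (hvm : ‖vm‖ = q₀) (hvp : ‖vp‖ = q₀) (hu : IsPotential u vm vp)
    {m m' : Fin 3 → ℂ → ℝ → Fin 3 → ℂ} (hm : IsColumnFamily q₀ u vp m)
    (hm' : IsColumnFamily q₀ (fun x => negConj (u (-x))) (negConj vm) m') :
    InftyBound (scatMatrix q₀ σ t m' m) (limBlock q₀ vm vp) := by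
  obtain ⟨K, R, hK, hR, hqR, h⟩ := exists_colPair_bound hq₀ hvm hvp hu hm hm'
  obtain ⟨L, hL, hphase⟩ := exists_norm_phase_sub_one_le q₀ σ t hq₀
  have hev := eventually_cobounded_le_norm (E := ℝ) R
  have hn : ∀ z : ℝ, ‖(z : ℂ)‖ = ‖z‖ := fun z => norm_real z
  refine ⟨.of_bound K (hev.mono fun z hz => ?_), fun j hj => .of_bound K (hev.mono fun z hz => ?_),
    fun j hj => .of_bound K (hev.mono fun z hz => ?_),
    fun i hi j hj => .of_bound (K + L * ‖limBlock q₀ vm vp i j‖) (hev.mono fun z hz => ?_)⟩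
  · rw [scatMatrix, scat_reflect_apply_self, norm_inv, ← div_eq_mul_inv, ← hn]
    exact (h z ((hn z).symm ▸ hz)).1 (ofReal_im z).ge
  · rw [scatMatrix, scat_reflect_apply, norm_mul, norm_mul, norm_phase, norm_phase, one_mul,
      one_mul, norm_inv, ← div_eq_mul_inv, norm_pow, ← hn]
    exact ((h z ((hn z).symm ▸ hz)).2.2 (ofReal_im z) j hj).1
  · rw [scatMatrix, scat_reflect_apply, norm_mul, norm_mul, norm_phase, norm_phase, one_mul,
      one_mul, norm_inv, ← div_eq_mul_inv, norm_pow, ← hn]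
    exact ((h z ((hn z).symm ▸ hz)).2.2 (ofReal_im z) j hj).2.1
  · have h1 := ((h z ((hn z).symm ▸ hz)).2.2 (ofReal_im z) j hj).2.2 i hi
    rw [hn] at h1
    have h2 := hphase z (hqR.trans_le hz) i hi j hj
    rw [← Real.norm_eq_abs] at h2
    have h3 : ‖phase q₀ σ z 0 (-t) i * phase q₀ σ z 0 t j‖ ≤ 1 := by
      rw [norm_mul, norm_phase, norm_phase, one_mul]
    have e : ∀ p b c : ℂ, p * b - c = p * (b - c) + (p - 1) * c := fun p b c => by ring
    rw [scatMatrix, scat_reflect_apply, e, norm_inv, ← div_eq_mul_inv]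
    refine (norm_add_le_of_le (norm_mul_le_of_le h3 h1)
      (norm_mul_le_of_le h2 le_rfl)).trans_eq ?_
    ring

theorem rho_inv_sub_one_isBigO (q₀ : ℝ) :
    (fun z : ℝ => (rho q₀ z)⁻¹ - 1) =O[cobounded ℝ] fun z : ℝ => z⁻¹ := by
  refine .of_bound (q₀ ^ 2) ((eventually_cobounded_le_norm (E := ℝ) 1).mono fun z hz => ?_)
  have hz0 : z ≠ 0 := norm_pos_iff.1 (one_pos.trans_le hz)
  rw [rho_inv_sub_one (by exact_mod_cast hz0), norm_neg, norm_div, norm_pow, norm_pow, norm_real,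
    norm_real, norm_inv, ← div_eq_mul_inv, Real.norm_eq_abs q₀, sq_abs]
  gcongr
  exact le_self_pow₀ hz two_ne_zero

theorem inv_isBigO_one : (fun z : ℝ => z⁻¹) =O[cobounded ℝ] fun _ : ℝ => (1 : ℝ) :=
  tendsto_inv₀_cobounded.isBigO_one ℝ

theorem eventually_mem_regularSet {q₀ : ℝ} (hq₀ : 0 < q₀) :
    ∀ᶠ z : ℝ in cobounded ℝ, (z : ℂ) ∈ regularSet q₀ :=
  (eventually_cobounded_le_norm (E := ℝ) (q₀ + 1)).mono fun z hz =>
    mem_regularSet_of_lt_norm hq₀ (by rw [norm_real]; linarith)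

theorem rho_sub_one_isBigO {q₀ : ℝ} (hq₀ : 0 < q₀) :
    (fun z : ℝ => rho q₀ z - 1) =O[cobounded ℝ] fun z : ℝ => z⁻¹ := by
  have h1 := rho_inv_sub_one_isBigO q₀
  have h2 : Tendsto (fun z : ℝ => (rho q₀ z)⁻¹) (cobounded ℝ) (𝓝 1) := by
    have h3 := (h1.trans_tendsto tendsto_inv₀_cobounded).add_const 1
    simpa using h3
  have h3 : Tendsto (fun z : ℝ => rho q₀ z) (cobounded ℝ) (𝓝 1) := by
    simpa using h2.inv₀ one_ne_zero
  have h4 := (h3.isBigO_one ℝ).mul h1.neg_left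
  refine (h4.congr' ((eventually_mem_regularSet hq₀).mono fun z hz => ?_)
    (.of_forall fun z => one_mul _))
  have := rho_ne_zero hz
  field_simp
  ring

theorem isBigO_conj {α : Type*} {l : Filter α} {f : α → ℂ} {g : α → ℝ} (h : f =O[l] g) :
    (fun z => conj (f z)) =O[l] g := by
  refine isBigO_norm_left.1 ?_
  simp only [norm_conj]
  exact h.norm_left

theorem scatInv_apply (q₀ : ℝ) (z : ℂ) (H : M3) (i j : Fin 3) :
    scatInv q₀ z H i j = ![(rho q₀ z)⁻¹, -1, -(rho q₀ z)⁻¹] i * ![rho q₀ z, -1, -rho q₀ z] j *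
      conj (H j i) := by
  rw [scatInv, formCinv, formC, Matrix.diagonal_mul, Matrix.mul_diagonal,
    Matrix.conjTranspose_apply]
  simp only [RCLike.star_def]
  ring

theorem scatInv_apply_self {q₀ : ℝ} {z : ℂ} (hz : z ∈ regularSet q₀) (H : M3) (i : Fin 3) :
    scatInv q₀ z H i i = conj (H i i) := by
  have := rho_ne_zero hz
  rw [scatInv_apply]
  fin_cases i <;> simp [this]

/-- An entry of `C⁻¹ H† C` is the conjugate of the transposed entry of `H` times a bounded ratio of
form coefficients, and within the block that ratio is `1 + O(1/z)`. -/
theorem InftyBound.scatInv {q₀ : ℝ} (hq₀ : 0 < q₀) {H : ℝ → M3} {c : Fin 3 → Fin 3 → ℂ}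
    (h : InftyBound H c) :
    InftyBound (fun z => scatInv q₀ z (H z)) fun i j => conj (c j i) := by
  have h1 := rho_sub_one_isBigO hq₀
  have h2 := rho_inv_sub_one_isBigO q₀
  have hc : ∀ a : ℂ, (fun _ : ℝ => a) =O[cobounded ℝ] fun _ : ℝ => (1 : ℝ) := fun a =>
    isBigO_const_const a one_ne_zero _
  have h3 : (fun z : ℝ => rho q₀ z) =O[cobounded ℝ] fun _ : ℝ => (1 : ℝ) := by
    simpa using (h1.trans inv_isBigO_one).add (hc 1)
  have h4 : (fun z : ℝ => (rho q₀ z)⁻¹) =O[cobounded ℝ] fun _ : ℝ => (1 : ℝ) := by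
    simpa using (h2.trans inv_isBigO_one).add (hc 1)
  have hf : ∀ i, (fun z : ℝ => (![(rho q₀ z)⁻¹, -1, -(rho q₀ z)⁻¹] : Fin 3 → ℂ) i)
      =O[cobounded ℝ] fun _ : ℝ => (1 : ℝ) := by
    intro i
    fin_cases i
    · exact h4
    · exact hc (-1)
    · exact h4.neg_left
  have hg : ∀ i, (fun z : ℝ => (![rho q₀ z, -1, -rho q₀ z] : Fin 3 → ℂ) i)
      =O[cobounded ℝ] fun _ : ℝ => (1 : ℝ) := by
    intro i
    fin_cases i
    · exact h3
    · exact hc (-1)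
    · exact h3.neg_left
  have hfg : ∀ i ≠ 0, ∀ j ≠ 0, (fun z : ℝ => (![(rho q₀ z)⁻¹, -1, -(rho q₀ z)⁻¹] : Fin 3 → ℂ) i *
      (![rho q₀ z, -1, -rho q₀ z] : Fin 3 → ℂ) j - 1) =O[cobounded ℝ] fun z : ℝ => z⁻¹ := by
    intro i hi j hj
    fin_cases i <;> fin_cases j
    · exact absurd rfl hi
    · exact absurd rfl hi
    · exact absurd rfl hi
    · exact absurd rfl hj
    · simpa using isBigO_zero (fun z : ℝ => z⁻¹) (cobounded ℝ)
    · simpa using h1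
    · exact absurd rfl hj
    · simpa using h2
    · refine (isBigO_zero _ _).congr' ((eventually_mem_regularSet hq₀).mono fun z hz => ?_) .rfl
      simp [rho_ne_zero hz]
  refine ⟨?_, fun j hj => ?_, fun j hj => ?_, fun i hi j hj => ?_⟩
  · refine (isBigO_conj h.zero_zero).congr'
      ((eventually_mem_regularSet hq₀).mono fun z hz => ?_) .rfl
    dsimp only
    rw [scatInv_apply_self hz, map_sub, map_one]
  · simp only [scatInv_apply]
    simpa using ((hf 0).mul (hg j)).mul (isBigO_conj (h.col j hj))
  · simp only [scatInv_apply]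
    simpa using ((hf j).mul (hg 0)).mul (isBigO_conj (h.row j hj))
  · have h5 := ((hf i).mul (hg j)).mul (isBigO_conj (h.block j hj i hi))
    have h6 := (hfg i hi j hj).mul (hc (conj (c j i)))
    simp only [one_mul, mul_one] at h5 h6
    refine (h5.add h6).congr_left fun z => ?_
    rw [scatInv_apply, map_sub]
    ring

theorem inv_sq_isBigO_inv : (fun z : ℝ => (z ^ 2)⁻¹) =O[cobounded ℝ] fun z : ℝ => z⁻¹ := by
  refine .of_bound 1 ((eventually_cobounded_le_norm (E := ℝ) 1).mono fun z hz => ?_)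
  rw [norm_inv, norm_inv, norm_pow, one_mul]
  gcongr
  exact le_self_pow₀ hz two_ne_zero

/-! ### The scattering matrix at the origin -/

theorem symmInv_mul_mul_symm (q₀ : ℝ) (z : ℂ) (M : M3) : symmInv q₀ z * (M * symm q₀ z) =
    !![(z / q₀) * M 2 2 * (q₀ / z), I * (z / q₀) * M 2 1, -((z / q₀) * M 2 0 * (q₀ / z));
       -I * (q₀ / z) * M 1 2, M 1 1, I * (q₀ / z) * M 1 0;
       -((z / q₀) * M 0 2 * (q₀ / z)), -I * (z / q₀) * M 0 1,
         (z / q₀) * M 0 0 * (q₀ / z)] := by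
  ext i j
  fin_cases i <;> fin_cases j <;>
    simp [symm, symmInv, Matrix.mul_apply, Fin.sum_univ_three] <;> grind [I_sq]

theorem tendsto_sq_div {𝕜 : Type*} [NormedField 𝕜] {a : 𝕜} (ha : a ≠ 0) :
    Tendsto (fun z : 𝕜 => a ^ 2 / z) (𝓝[≠] 0) (cobounded 𝕜) := by
  have h1 : Tendsto (fun z : 𝕜 => (a ^ 2)⁻¹ * z) (𝓝[≠] 0) (𝓝[≠] 0) := by
    refine tendsto_nhdsWithin_iff.2 ⟨?_, eventually_mem_nhdsWithin.mono fun z hz =>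
      mul_ne_zero (inv_ne_zero (pow_ne_zero 2 ha)) hz⟩
    have h2 : Continuous fun z : 𝕜 => (a ^ 2)⁻¹ * z := continuous_const_mul _
    simpa using (h2.tendsto 0).mono_left nhdsWithin_le_nhds
  refine (tendsto_inv₀_nhdsNE_zero.comp h1).congr fun z => ?_
  simp [div_eq_mul_inv, mul_comm]

/-- The map `z ↦ q₀²/z` exchanges the origin and infinity, and the indices one and three. Entries of
the middle column in an outer row acquire `q₀/z`, whence the pole of the `12` entry; the `32` entry
stays bounded as its source decays. Entries of the middle row in an outer column acquire `z/q₀`. -/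
theorem InftyBound.isBigO_zero {q₀ : ℝ} (hq₀ : 0 < q₀) {M : ℝ → M3} {c : Fin 3 → Fin 3 → ℂ}
    (h : InftyBound M c) (hM : ∀ z : ℝ, (z : ℂ) ∈ regularSet q₀ →
      M (q₀ ^ 2 / z) = symmInv q₀ z * (M z * symm q₀ z)) :
    ((fun z => M z 0 0 - c 2 2) =O[𝓝[≠] 0] fun z : ℝ => z) ∧
    ((fun z => M z 0 1 - I * (q₀ / (z : ℂ)) * c 2 1) =O[𝓝[≠] 0] fun _ : ℝ => (1 : ℝ)) ∧
    ((fun z => M z 0 2) =O[𝓝[≠] 0] fun z : ℝ => z) ∧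
    ((fun z => M z 1 0) =O[𝓝[≠] 0] fun z : ℝ => z) ∧
    ((fun z => M z 1 1 - c 1 1) =O[𝓝[≠] 0] fun z : ℝ => z) ∧
    ((fun z => M z 1 2) =O[𝓝[≠] 0] fun z : ℝ => z) ∧
    ((fun z => M z 2 0) =O[𝓝[≠] 0] fun z : ℝ => z) ∧
    ((fun z => M z 2 1) =O[𝓝[≠] 0] fun _ : ℝ => (1 : ℝ)) ∧
    ((fun z => M z 2 2 - 1) =O[𝓝[≠] 0] fun z : ℝ => z) := by
  have hq : (q₀ : ℂ) ≠ 0 := by exact_mod_cast hq₀.ne'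
  have hT := tendsto_sq_div hq₀.ne'
  have hz0 : ∀ᶠ z : ℝ in 𝓝[≠] 0, z ≠ 0 := eventually_mem_nhdsWithin
  have hid : (fun z : ℝ => z) =O[𝓝[≠] 0] fun _ : ℝ => (1 : ℝ) :=
    (tendsto_id.mono_left nhdsWithin_le_nhds).isBigO_one ℝ
  have hO : ∀ {f : ℝ → ℂ}, f =O[cobounded ℝ] (fun z : ℝ => z⁻¹) →
      (fun z => f (q₀ ^ 2 / z)) =O[𝓝[≠] 0] fun z : ℝ => z := by
    intro f hf
    refine (hf.comp_tendsto hT).trans ?_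
    refine ((isBigO_refl (fun z : ℝ => z) _).const_mul_left (q₀ ^ 2)⁻¹).congr_left fun z => ?_
    simp [div_eq_mul_inv, mul_comm]
  have hO2 : ∀ {f : ℝ → ℂ}, f =O[cobounded ℝ] (fun z : ℝ => (z ^ 2)⁻¹) →
      (fun z => f (q₀ ^ 2 / z)) =O[𝓝[≠] 0] fun z : ℝ => z := fun hf =>
    hO (hf.trans inv_sq_isBigO_inv)
  have hzO : (fun z : ℝ => (z : ℂ) / q₀) =O[𝓝[≠] 0] fun z : ℝ => z := by
    refine .of_bound ‖(q₀ : ℂ)‖⁻¹ (.of_forall fun z => ?_)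
    rw [norm_div, norm_real, div_eq_inv_mul]
  have hzI : (fun z : ℝ => (q₀ : ℂ) / z) =O[𝓝[≠] 0] fun z : ℝ => z⁻¹ := by
    refine .of_bound ‖(q₀ : ℂ)‖ (.of_forall fun z => ?_)
    rw [norm_div, norm_real z, norm_inv, div_eq_mul_inv]
  have hinv : ∀ {f : ℝ → ℂ}, f =O[𝓝[≠] 0] (fun z : ℝ => z) →
      (fun z : ℝ => (q₀ : ℂ) / z * f z) =O[𝓝[≠] 0] fun _ : ℝ => (1 : ℝ) := by
    intro f hf
    refine (hzI.mul hf).trans_eventuallyEq (hz0.mono fun z hz => ?_)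
    exact inv_mul_cancel₀ hz
  -- The symmetry is applied at `q₀²/z`, the map being an involution, so that entries near the
  -- origin are expressed through entries near infinity.
  have hMz : ∀ᶠ z : ℝ in 𝓝[≠] 0, M z =
      !![M (q₀ ^ 2 / z) 2 2, I * (q₀ / z * M (q₀ ^ 2 / z) 2 1), -M (q₀ ^ 2 / z) 2 0;
         -I * (z / q₀ * M (q₀ ^ 2 / z) 1 2), M (q₀ ^ 2 / z) 1 1,
           I * (z / q₀ * M (q₀ ^ 2 / z) 1 0);
         -M (q₀ ^ 2 / z) 0 2, -I * (q₀ / z * M (q₀ ^ 2 / z) 0 1), M (q₀ ^ 2 / z) 0 0] := by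
    filter_upwards [hz0, hT.eventually (eventually_mem_regularSet hq₀)] with z hz hr
    have hzc : (z : ℂ) ≠ 0 := by exact_mod_cast hz
    have e1 : q₀ ^ 2 / (q₀ ^ 2 / z) = z := by
      field_simp
    have e2 := hM _ hr
    rw [e1, symmInv_mul_mul_symm] at e2
    rw [e2]
    have e3 : ((q₀ ^ 2 / z : ℝ) : ℂ) / q₀ = q₀ / z := by
      push_cast
      field_simp
    have e4 : (q₀ : ℂ) / ((q₀ ^ 2 / z : ℝ) : ℂ) = z / q₀ := by
      push_cast
      field_simp
    have e5 : ∀ a : ℂ, (q₀ : ℂ) / z * a * (z / q₀) = a := fun a => by field_simp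
    simp only [e3, e4, e5, mul_assoc]
  refine ⟨?_, ?_, ?_, ?_, ?_, ?_, ?_, ?_, ?_⟩
  · exact (hO (h.block 2 (by decide) 2 (by decide))).congr'
      (hMz.mono fun z hz => by dsimp only; rw [hz]; simp) .rfl
  · refine ((hinv (hO (h.block 2 (by decide) 1 (by decide)))).const_mul_left I).congr'
      (hMz.mono fun z hz => ?_) .rfl
    dsimp only
    rw [hz]
    simp
    ring
  · exact (hO2 (h.col 2 (by decide))).neg_left.congr'
      (hMz.mono fun z hz => by dsimp only; rw [hz]; simp) .rfl
  · have h1 := (hO (h.block 1 (by decide) 2 (by decide))).trans hid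
    have h2 := h1.add (isBigO_const_const (c 1 2) one_ne_zero _)
    have h3 := (hzO.mul h2).const_mul_left (-I)
    simp only [sub_add_cancel, mul_one] at h3
    exact h3.congr'
      (hMz.mono fun z hz => by dsimp only; rw [hz]; simp) .rfl
  · exact (hO (h.block 1 (by decide) 1 (by decide))).congr'
      (hMz.mono fun z hz => by dsimp only; rw [hz]; simp) .rfl
  · have h3 := (hzO.mul ((hO2 (h.col 1 (by decide))).trans hid)).const_mul_left I
    simp only [mul_one] at h3
    exact h3.congr'
      (hMz.mono fun z hz => by dsimp only; rw [hz]; simp) .rfl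
  · exact (hO2 (h.row 2 (by decide))).neg_left.congr'
      (hMz.mono fun z hz => by dsimp only; rw [hz]; simp) .rfl
  · exact ((hinv (hO2 (h.row 1 (by decide)))).const_mul_left (-I)).congr'
      (hMz.mono fun z hz => by dsimp only; rw [hz]; simp) .rfl
  · exact (hO h.zero_zero).congr'
      (hMz.mono fun z hz => by dsimp only; rw [hz]; simp) .rfl

/-! ### Continuation to the half-planes -/

theorem conj_mem_upperHalf {z : ℂ} : conj z ∈ upperHalf ↔ z ∈ lowerHalf := by
  change 0 ≤ (conj z).im ↔ z.im ≤ 0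
  rw [conj_im, neg_nonneg]

theorem conj_mem_lowerHalf {z : ℂ} : conj z ∈ lowerHalf ↔ z ∈ upperHalf := by
  rw [← conj_mem_upperHalf, conj_conj]

theorem mem_diff_iff {q₀ : ℝ} {D : Set ℂ} {z : ℂ} :
    z ∈ D \ {0, (q₀ : ℂ), -(q₀ : ℂ)} ↔ z ∈ D ∧ z ∈ regularSet q₀ := by
  simp only [Set.mem_sdiff, mem_insert_iff, mem_singleton_iff, not_or, regularSet, mem_ofPred_eq,
    sub_ne_zero, ne_eq, sq_eq_sq_iff_eq_or_eq_neg]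

/-- Schwarz reflection: on the real line the diagonal entries of `S` are the conjugates of those of
`H`, so they continue to the opposite half-planes. -/
theorem IsContinuation.conj {q₀ : ℝ} {D D' : Set ℂ} {f g : ℝ → ℂ} {F : ℂ → ℂ}
    (h : IsContinuation q₀ D f F) (hD : ∀ z, conj z ∈ D ↔ z ∈ D')
    (hg : ∀ z : ℝ, (z : ℂ) ∈ regularSet q₀ → g z = conj (f z)) :
    IsContinuation q₀ D' g fun z => conj (F (conj z)) := by
  have hDi : ∀ z ∈ interior D', conj z ∈ interior D := by
    intro z hz
    have h1 : IsOpen (conj ⁻¹' interior D' : Set ℂ) :=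
      isOpen_interior.preimage Complex.continuous_conj
    refine interior_maximal (fun w hw => ?_) h1 (?_ : conj (conj z) ∈ interior D')
    · have := (hD _).2 (interior_subset hw)
      rwa [conj_conj] at this
    · rwa [conj_conj]
  refine ⟨fun z hz => ?_, ?_, fun z h0 h1 h2 => ?_⟩
  · have h1 : DifferentiableAt ℂ F (conj z) :=
      h.1.differentiableAt (isOpen_interior.mem_nhds (hDi z hz))
    have h2 := h1.conj_conj
    rw [conj_conj] at h2
    exact h2.differentiableWithinAt
  · refine Complex.continuous_conj.comp_continuousOn
      (h.2.1.comp Complex.continuous_conj.continuousOn fun z hz => ?_)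
    rw [mem_diff_iff] at hz ⊢
    refine ⟨(hD z).2 hz.1, fun h0 => hz.2.1 (by simpa using h0), fun h0 => hz.2.2 ?_⟩
    have h1 := congrArg conj h0
    simpa using h1
  · dsimp only
    rw [hg z (ofReal_mem_regularSet h0 h1 h2), conj_ofReal, h.2.2 z h0 h1 h2]

theorem limitsIn_of_bound {D : Set ℂ} {F : ℂ → ℂ} {a b : ℂ} {K K' R r : ℝ} (hr : 0 < r)
    (h₁ : ∀ z ∈ D, R ≤ ‖z‖ → ‖F z - a‖ ≤ K / ‖z‖)
    (h₂ : ∀ z ∈ D, z ≠ 0 → ‖z‖ ≤ r → ‖F z - b‖ ≤ K' * ‖z‖) : LimitsIn D F a b := by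
  refine ⟨.of_bound K ?_, .of_bound K' ?_⟩
  · filter_upwards [mem_inf_of_left (eventually_cobounded_le_norm (E := ℂ) R),
      mem_inf_of_right (mem_principal_self D)] with z hz hD
    rw [norm_inv, ← div_eq_mul_inv]
    exact h₁ z hD hz
  · filter_upwards [self_mem_nhdsWithin, mem_nhdsWithin_of_mem_nhds
      (Metric.closedBall_mem_nhds (0 : ℂ) hr)] with z hz hzr
    exact h₂ z hz.1 hz.2 (mem_closedBall_zero_iff.1 hzr)

theorem LimitsIn.conj {D D' : Set ℂ} {F : ℂ → ℂ} {a b a' b' : ℂ} (h : LimitsIn D F a b)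
    (hD : ∀ z, conj z ∈ D ↔ z ∈ D') (ha : conj a = a') (hb : conj b = b') :
    LimitsIn D' (fun z => conj (F (conj z))) a' b' := by
  subst ha hb
  have h1 : Tendsto (fun z : ℂ => conj z) (cobounded ℂ ⊓ 𝓟 D') (cobounded ℂ ⊓ 𝓟 D) := by
    refine tendsto_inf.2 ⟨?_, tendsto_principal.2 (mem_inf_of_right fun z hz => (hD z).2 hz)⟩
    refine Tendsto.mono_left ?_ inf_le_left
    rw [← tendsto_norm_atTop_iff_cobounded]
    simpa using tendsto_norm_cobounded_atTop
  have h2 : Tendsto (fun z : ℂ => conj z) (𝓝[D' \ {0}] 0) (𝓝[D \ {0}] 0) := by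
    refine tendsto_nhdsWithin_iff.2 ⟨?_, eventually_mem_nhdsWithin.mono fun z hz =>
      ⟨(hD z).2 hz.1, fun h0 => hz.2 (by simpa using h0)⟩⟩
    have h3 := Complex.continuous_conj.tendsto 0
    rw [map_zero] at h3
    exact h3.mono_left nhdsWithin_le_nhds
  refine ⟨isBigO_norm_norm.1 ((h.1.comp_tendsto h1).norm_norm.congr (fun z => ?_) fun z => ?_),
    isBigO_norm_norm.1 ((h.2.comp_tendsto h2).norm_norm.congr (fun z => ?_) fun z => ?_)⟩
  · simp only [Function.comp_apply]
    rw [← norm_conj, map_sub]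
  · simp
  · simp only [Function.comp_apply]
    rw [← norm_conj, map_sub]
  · simp

section

variable {q₀ : ℝ} {u u' : ℝ → V2} {v v' vm vp : V2} {m m' : Fin 3 → ℂ → ℝ → Fin 3 → ℂ}

theorem sq_div_mem_upperHalf {z : ℂ} (hz : z ∈ lowerHalf) : (q₀ : ℂ) ^ 2 / z ∈ upperHalf := by
  change 0 ≤ ((q₀ : ℂ) ^ 2 / z).im
  rw [sq_div_im]
  exact mul_nonneg (sq_nonneg _) (inv_im_nonneg_iff.2 hz)

theorem sq_div_mem_lowerHalf {z : ℂ} (hz : z ∈ upperHalf) : (q₀ : ℂ) ^ 2 / z ∈ lowerHalf := by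
  change ((q₀ : ℂ) ^ 2 / z).im ≤ 0
  rw [sq_div_im]
  exact mul_nonpos_of_nonneg_of_nonpos (sq_nonneg _) (inv_im_nonpos_iff.2 hz)

theorem isContinuation_colPair_zero (hm : IsColumnFamily q₀ u v m)
    (hm' : IsColumnFamily q₀ u' v' m') :
    IsContinuation q₀ upperHalf (fun z => colPair q₀ m' m 0 0 z) (colPair q₀ m' m 0 0) := by
  have hr : DifferentiableOn ℂ (fun z => (rho q₀ z)⁻¹) (regularSet q₀) := by
    simp only [rho, inv_div]
    exact DifferentiableOn.div (by fun_prop) (by fun_prop) fun z hz => pow_ne_zero 2 hz.1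
  have hi : interior upperHalf ⊆ regularSet q₀ := by
    intro z hz
    rw [interior_upperHalf] at hz
    exact mem_regularSet_of_im_ne_zero (ne_of_gt hz)
  refine ⟨?_, ?_, fun z _ _ _ => rfl⟩
  · exact ((hr.mono hi).mul (DifferentiableOn.fun_sum fun p _ =>
      (hm'.differentiableOn 0 p).mul (hm.differentiableOn 0 p))).neg
  · have hs : upperHalf \ {0, (q₀ : ℂ), -(q₀ : ℂ)} = upperHalf ∩ regularSet q₀ :=
      Set.ext fun z => mem_diff_iff
    rw [hs]
    exact ((hr.continuousOn.mono inter_subset_right).mul (continuousOn_finsetSum _ fun p _ =>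
      (hm'.continuousOn 0 p).mul (hm.continuousOn 0 p))).neg

theorem isContinuation_colPair_two (hq₀ : 0 < q₀) (hm : IsColumnFamily q₀ u v m)
    (hm' : IsColumnFamily q₀ u' v' m') :
    IsContinuation q₀ lowerHalf (fun z => colPair q₀ m' m 2 2 z) (colPair q₀ m' m 2 2) := by
  have hq : (q₀ : ℂ) ≠ 0 := by exact_mod_cast hq₀.ne'
  have h := isContinuation_colPair_zero hm hm'
  have hd : DifferentiableOn ℂ (fun z => (q₀ : ℂ) ^ 2 / z) (regularSet q₀) :=
    DifferentiableOn.div (by fun_prop) (by fun_prop) fun z hz => hz.1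
  have hi : interior lowerHalf ⊆ regularSet q₀ := by
    intro z hz
    rw [interior_lowerHalf] at hz
    exact mem_regularSet_of_im_ne_zero (ne_of_lt hz)
  refine ⟨?_, ?_, fun z _ _ _ => rfl⟩
  · refine (h.1.comp (hd.mono hi) fun z hz => ?_).congr fun z hz =>
      colPair_two_two hq₀ hm hm' (hi hz)
    rw [interior_lowerHalf] at hz
    rw [interior_upperHalf]
    change 0 < ((q₀ : ℂ) ^ 2 / z).im
    rw [sq_div_im]
    refine mul_pos (by positivity) (lt_of_not_ge fun h1 => ?_)
    exact absurd (inv_im_nonpos_iff.1 h1) (not_le.2 hz)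
  · have hs : ∀ z, z ∈ lowerHalf \ {0, (q₀ : ℂ), -(q₀ : ℂ)} → z ∈ regularSet q₀ := fun z hz =>
      (mem_diff_iff.1 hz).2
    refine (h.2.1.comp (hd.continuousOn.mono hs) fun z hz => ?_).congr fun z hz =>
      colPair_two_two hq₀ hm hm' (hs z hz)
    exact mem_diff_iff.2 ⟨sq_div_mem_upperHalf hz.1, sq_div_mem_regularSet hq₀ (hs z hz)⟩

/-- Each corner entry near the origin is the other one near infinity, in the other half-plane, by
`colPair_two_two`; so two estimates at infinity give all four limits. -/
theorem limitsIn_colPair (hq₀ : 0 < q₀) (hvm : ‖vm‖ = q₀)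
    (hvp : ‖vp‖ = q₀) (hu : IsPotential u vm vp) (hm : IsColumnFamily q₀ u vp m)
    (hm' : IsColumnFamily q₀ (fun x => negConj (u (-x))) (negConj vm) m') :
    LimitsIn upperHalf (colPair q₀ m' m 0 0) 1 (limBlock q₀ vm vp 2 2) ∧
    LimitsIn lowerHalf (colPair q₀ m' m 2 2) (limBlock q₀ vm vp 2 2) 1 := by
  have hq : (q₀ : ℂ) ≠ 0 := by exact_mod_cast hq₀.ne'
  obtain ⟨K, R, hK, hR, hqR, h⟩ := exists_colPair_bound hq₀ hvm hvp hu hm hm'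
  have hR0 : 0 < R := by linarith
  have hn : ∀ z : ℂ, ‖(q₀ : ℂ) ^ 2 / z‖ = q₀ ^ 2 / ‖z‖ := fun z => by simp
  have hbig : ∀ z : ℂ, z ≠ 0 → ‖z‖ ≤ q₀ ^ 2 / R → R ≤ ‖(q₀ : ℂ) ^ 2 / z‖ := by
    intro z hz hzr
    rw [hn, le_div_iff₀ (norm_pos_iff.2 hz)]
    rwa [le_div_iff₀' hR0] at hzr
  have hdiv : ∀ z : ℂ, K / ‖(q₀ : ℂ) ^ 2 / z‖ = K / q₀ ^ 2 * ‖z‖ := by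
    intro z
    rw [hn, div_div_eq_mul_div, div_mul_eq_mul_div]
  have hz2 : ∀ z : ℂ, (q₀ : ℂ) ^ 2 / ((q₀ : ℂ) ^ 2 / z) = z := fun z =>
    div_div_cancel₀ (pow_ne_zero 2 hq)
  refine ⟨limitsIn_of_bound (R := R) (K' := K / q₀ ^ 2) (r := q₀ ^ 2 / R) (by positivity)
    (fun z hz hzR => (h z hzR).1 hz) fun z hz hz0 hzr => ?_,
    limitsIn_of_bound (R := R) (K' := K / q₀ ^ 2) (r := q₀ ^ 2 / R) (by positivity)
    (fun z hz hzR => (h z hzR).2.1 hz) fun z hz hz0 hzr => ?_⟩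
  · have h1 := (h _ (hbig z hz0 hzr)).2.1 (sq_div_mem_lowerHalf hz)
    have hreg := mem_regularSet_of_lt_norm hq₀ (hqR.trans_le (hbig z hz0 hzr))
    rwa [hdiv, colPair_two_two hq₀ hm hm' hreg, hz2] at h1
  · have h1 := (h _ (hbig z hz0 hzr)).1 (sq_div_mem_upperHalf hz)
    have hreg := mem_regularSet_of_lt_norm hq₀ (hqR.trans_le (hbig z hz0 hzr))
    have hreg' := sq_div_mem_regularSet hq₀ hreg
    rw [hz2] at hreg'
    rwa [hdiv, ← colPair_two_two hq₀ hm hm' hreg'] at h1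

theorem limBlock_eq (q₀ : ℝ) (vm vp : V2) :
    limBlock q₀ vm vp 1 1 = inner ℂ vp vm / (q₀ : ℂ) ^ 2 ∧
    limBlock q₀ vm vp 1 2 = inner ℂ (perp vm) vp / (q₀ : ℂ) ^ 2 ∧
    limBlock q₀ vm vp 2 1 = inner ℂ vm (perp vp) / (q₀ : ℂ) ^ 2 ∧
    limBlock q₀ vm vp 2 2 = inner ℂ vm vp / (q₀ : ℂ) ^ 2 := by
  refine ⟨?_, ?_, ?_, ?_⟩ <;>
    simp [limBlock, limCol, negConj, perp, PiLp.inner_apply, Fin.sum_univ_two] <;> ring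

end

end CoupledHirota

/-! ### The main theorem -/

theorem proposition13 (q₀ σ t : ℝ) (hq₀ : 0 < q₀)
    (q : ℝ → ℝ → CoupledHirota.V2) (qm qp : CoupledHirota.V2)
    (hqm : ‖qm‖ = q₀) (hqp : ‖qp‖ = q₀)
    (hq : CoupledHirota.IsPotential (fun x => q x t) qm qp) :
    ∃ H S : ℝ → CoupledHirota.M3,
      -- `H` is the scattering matrix, uniquely determined, and `S` is its inverse
      (∀ z : ℝ, z ≠ 0 → z ≠ q₀ → z ≠ -q₀ →
        CoupledHirota.IsScatteringMatrix q₀ σ t (fun x => q x t) qm qp z (H z) ∧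
        (∀ H' : CoupledHirota.M3,
          CoupledHirota.IsScatteringMatrix q₀ σ t (fun x => q x t) qm qp z H' → H' = H z) ∧
        H z * S z = 1 ∧ S z * H z = 1) ∧
      -- entries of `S` on the real line as `z → ∞`
      (((fun z => S z 0 0 - 1) =O[cobounded ℝ] fun z : ℝ => z⁻¹) ∧
       ((fun z => S z 0 1) =O[cobounded ℝ] fun z : ℝ => z⁻¹) ∧
       ((fun z => S z 0 2) =O[cobounded ℝ] fun z : ℝ => z⁻¹) ∧
       ((fun z => S z 1 0) =O[cobounded ℝ] fun z : ℝ => (z ^ 2)⁻¹) ∧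
       ((fun z => S z 1 1 - inner ℂ qm qp / (q₀ : ℂ) ^ 2) =O[cobounded ℝ] fun z : ℝ => z⁻¹) ∧
       ((fun z => S z 1 2 - inner ℂ (CoupledHirota.perp qp) qm / (q₀ : ℂ) ^ 2)
          =O[cobounded ℝ] fun z : ℝ => z⁻¹) ∧
       ((fun z => S z 2 0) =O[cobounded ℝ] fun z : ℝ => (z ^ 2)⁻¹) ∧
       ((fun z => S z 2 1 - inner ℂ qp (CoupledHirota.perp qm) / (q₀ : ℂ) ^ 2)
          =O[cobounded ℝ] fun z : ℝ => z⁻¹) ∧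
       ((fun z => S z 2 2 - inner ℂ qp qm / (q₀ : ℂ) ^ 2) =O[cobounded ℝ] fun z : ℝ => z⁻¹)) ∧
      -- entries of `H` on the real line as `z → ∞`
      (((fun z => H z 0 0 - 1) =O[cobounded ℝ] fun z : ℝ => z⁻¹) ∧
       ((fun z => H z 0 1) =O[cobounded ℝ] fun z : ℝ => z⁻¹) ∧
       ((fun z => H z 0 2) =O[cobounded ℝ] fun z : ℝ => z⁻¹) ∧
       ((fun z => H z 1 0) =O[cobounded ℝ] fun z : ℝ => (z ^ 2)⁻¹) ∧
       ((fun z => H z 1 1 - inner ℂ qp qm / (q₀ : ℂ) ^ 2) =O[cobounded ℝ] fun z : ℝ => z⁻¹) ∧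
       ((fun z => H z 1 2 - inner ℂ (CoupledHirota.perp qm) qp / (q₀ : ℂ) ^ 2)
          =O[cobounded ℝ] fun z : ℝ => z⁻¹) ∧
       ((fun z => H z 2 0) =O[cobounded ℝ] fun z : ℝ => (z ^ 2)⁻¹) ∧
       ((fun z => H z 2 1 - inner ℂ qm (CoupledHirota.perp qp) / (q₀ : ℂ) ^ 2)
          =O[cobounded ℝ] fun z : ℝ => z⁻¹) ∧
       ((fun z => H z 2 2 - inner ℂ qm qp / (q₀ : ℂ) ^ 2) =O[cobounded ℝ] fun z : ℝ => z⁻¹)) ∧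
      -- entries of `S` on the real line as `z → 0`
      (((fun z => S z 0 0 - inner ℂ qp qm / (q₀ : ℂ) ^ 2) =O[𝓝[≠] 0] fun z : ℝ => z) ∧
       ((fun z => S z 0 1 - I * inner ℂ qp (CoupledHirota.perp qm) / ((q₀ : ℂ) * (z : ℂ)))
          =O[𝓝[≠] 0] fun _ : ℝ => (1 : ℝ)) ∧
       ((fun z => S z 0 2) =O[𝓝[≠] 0] fun z : ℝ => z) ∧
       ((fun z => S z 1 0) =O[𝓝[≠] 0] fun z : ℝ => z) ∧
       ((fun z => S z 1 1 - inner ℂ qm qp / (q₀ : ℂ) ^ 2) =O[𝓝[≠] 0] fun z : ℝ => z) ∧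
       ((fun z => S z 1 2) =O[𝓝[≠] 0] fun z : ℝ => z) ∧
       ((fun z => S z 2 0) =O[𝓝[≠] 0] fun z : ℝ => z) ∧
       ((fun z => S z 2 1) =O[𝓝[≠] 0] fun _ : ℝ => (1 : ℝ)) ∧
       ((fun z => S z 2 2 - 1) =O[𝓝[≠] 0] fun z : ℝ => z)) ∧
      -- entries of `H` on the real line as `z → 0`
      (((fun z => H z 0 0 - inner ℂ qm qp / (q₀ : ℂ) ^ 2) =O[𝓝[≠] 0] fun z : ℝ => z) ∧
       ((fun z => H z 0 1 - I * inner ℂ qm (CoupledHirota.perp qp) / ((q₀ : ℂ) * (z : ℂ)))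
          =O[𝓝[≠] 0] fun _ : ℝ => (1 : ℝ)) ∧
       ((fun z => H z 0 2) =O[𝓝[≠] 0] fun z : ℝ => z) ∧
       ((fun z => H z 1 0) =O[𝓝[≠] 0] fun z : ℝ => z) ∧
       ((fun z => H z 1 1 - inner ℂ qp qm / (q₀ : ℂ) ^ 2) =O[𝓝[≠] 0] fun z : ℝ => z) ∧
       ((fun z => H z 1 2) =O[𝓝[≠] 0] fun z : ℝ => z) ∧
       ((fun z => H z 2 0) =O[𝓝[≠] 0] fun z : ℝ => z) ∧
       ((fun z => H z 2 1) =O[𝓝[≠] 0] fun _ : ℝ => (1 : ℝ)) ∧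
       ((fun z => H z 2 2 - 1) =O[𝓝[≠] 0] fun z : ℝ => z)) ∧
      -- the analytic entries, in the closed half-planes to which they extend
      (∃ s₁₁ s₃₃ h₁₁ h₃₃ : ℂ → ℂ,
        CoupledHirota.IsContinuation q₀ CoupledHirota.lowerHalf (fun z => S z 0 0) s₁₁ ∧
        CoupledHirota.IsContinuation q₀ CoupledHirota.upperHalf (fun z => S z 2 2) s₃₃ ∧
        CoupledHirota.IsContinuation q₀ CoupledHirota.upperHalf (fun z => H z 0 0) h₁₁ ∧
        CoupledHirota.IsContinuation q₀ CoupledHirota.lowerHalf (fun z => H z 2 2) h₃₃ ∧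
        CoupledHirota.LimitsIn CoupledHirota.lowerHalf s₁₁
          1 (inner ℂ qp qm / (q₀ : ℂ) ^ 2) ∧
        CoupledHirota.LimitsIn CoupledHirota.upperHalf s₃₃
          (inner ℂ qp qm / (q₀ : ℂ) ^ 2) 1 ∧
        CoupledHirota.LimitsIn CoupledHirota.upperHalf h₁₁
          1 (inner ℂ qm qp / (q₀ : ℂ) ^ 2) ∧
        CoupledHirota.LimitsIn CoupledHirota.lowerHalf h₃₃
          (inner ℂ qm qp / (q₀ : ℂ) ^ 2) 1) := by

  open CoupledHirota in
  have hc := hq.contDiff.continuous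
  have hr := hq.reflect
  obtain ⟨m, hm⟩ := exists_isColumnFamily hq₀ hqp hc hq.integrable_right
  obtain ⟨m', hm'⟩ := exists_isColumnFamily hq₀ ((norm_negConj qm).trans hqm)
    hr.contDiff.continuous hr.integrable_right
  set u := fun x => q x t
  have hH : ∀ z : ℝ, (z : ℂ) ∈ regularSet q₀ →
      IsScatteringMatrix q₀ σ t u qm qp z (scatMatrix q₀ σ t m' m z) := by
    intro z hz
    refine isScatteringMatrix_scat hq₀ hqm hz (IsJost.reflect (isJost_ofColumns fun j => ?_))
      (isJost_ofColumns fun j => ?_)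
    · fin_cases j
      · exact hm'.zero z hz (ofReal_im z).ge
      · exact hm'.one z hz (ofReal_im z)
      · exact hm'.two z hz (ofReal_im z).le
    · fin_cases j
      · exact hm.zero z hz (ofReal_im z).ge
      · exact hm.one z hz (ofReal_im z)
      · exact hm.two z hz (ofReal_im z).le
  have hI := inftyBound_scatMatrix hq₀ σ t hqm hqp hq hm hm'
  have hI' := hI.scatInv hq₀
  have hS : ∀ z : ℝ, (z : ℂ) ∈ regularSet q₀ →
      scatInv q₀ z (scatMatrix q₀ σ t m' m z) * scatMatrix q₀ σ t m' m z = 1 := fun z hz =>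
    (hH z hz).scatInv_mul hq₀ hqm hqp hz
  have hcast : ∀ z : ℝ, ((q₀ ^ 2 / z : ℝ) : ℂ) = (q₀ : ℂ) ^ 2 / z := fun z => by push_cast; rfl
  have hreg : ∀ z : ℝ, (z : ℂ) ∈ regularSet q₀ → ((q₀ ^ 2 / z : ℝ) : ℂ) ∈ regularSet q₀ :=
    fun z hz => hcast z ▸ sq_div_mem_regularSet hq₀ hz
  have hHsymm : ∀ z : ℝ, (z : ℂ) ∈ regularSet q₀ → scatMatrix q₀ σ t m' m (q₀ ^ 2 / z) =
      symmInv q₀ z * (scatMatrix q₀ σ t m' m z * symm q₀ z) := fun z hz =>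
    (hH _ (hreg z hz)).eq hq₀ hqm hqp (hreg z hz) ((hH z hz).symm_mul hq₀ hz)
  -- The symmetry passes to `S` because both sides invert the transformed `H`.
  have hSsymm : ∀ z : ℝ, (z : ℂ) ∈ regularSet q₀ →
      scatInv q₀ (q₀ ^ 2 / z : ℝ) (scatMatrix q₀ σ t m' m (q₀ ^ 2 / z)) =
      symmInv q₀ z * (scatInv q₀ z (scatMatrix q₀ σ t m' m z) * symm q₀ z) := by
    intro z hz
    refine left_inv_eq_right_inv (hS _ (hreg z hz)) (mul_eq_one_comm.1 ?_)
    rw [hHsymm z hz]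
    calc _ = symmInv q₀ z * (scatInv q₀ z (scatMatrix q₀ σ t m' m z) *
          (symm q₀ z * symmInv q₀ z) * scatMatrix q₀ σ t m' m z) * symm q₀ z := by
          simp only [mul_assoc]
      _ = 1 := by
          rw [symm_mul_symmInv hq₀ hz.1, mul_one, hS z hz, mul_one]
          exact mul_eq_one_comm.1 (symm_mul_symmInv hq₀ hz.1)
  obtain ⟨e11, e12, e21, e22⟩ := limBlock_eq q₀ qm qp
  have hconj : ∀ v w : V2, conj (inner ℂ v w / (q₀ : ℂ) ^ 2) = inner ℂ w v / (q₀ : ℂ) ^ 2 := by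
    intro v w
    rw [map_div₀, inner_conj_symm, map_pow, conj_ofReal]
  have c11 := (congrArg conj e11).trans (hconj _ _)
  have c12 := (congrArg conj e12).trans (hconj _ _)
  have c21 := (congrArg conj e21).trans (hconj _ _)
  have c22 := (congrArg conj e22).trans (hconj _ _)
  have hpole : ∀ (z : ℝ) (a : ℂ), I * (q₀ / (z : ℂ)) * (a / (q₀ : ℂ) ^ 2) = I * a / (q₀ * z) := by
    intro z a
    have hq : (q₀ : ℂ) ≠ 0 := by exact_mod_cast hq₀.ne'
    field_simp
  have hH0 := hI.isBigO_zero hq₀ hHsymm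
  have hS0 := hI'.isBigO_zero hq₀ hSsymm
  simp only [e11, e21, e22, hpole] at hH0
  simp only [c11, c12, c22, hpole] at hS0
  have n1 : (1 : Fin 3) ≠ 0 := by decide
  have n2 : (2 : Fin 3) ≠ 0 := by decide
  obtain ⟨hl, hl'⟩ := limitsIn_colPair hq₀ hqm hqp hq hm hm'
  have hz11 := isContinuation_colPair_zero hm hm'
  have hz33 := isContinuation_colPair_two hq₀ hm hm'
  have hd : ∀ i, (fun z : ℝ => scatMatrix q₀ σ t m' m z i i) =
      fun z : ℝ => colPair q₀ m' m i i z := fun i =>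
    funext fun z => scat_reflect_apply_self q₀ σ t z m' m i
  rw [← hd] at hz11 hz33
  refine ⟨scatMatrix q₀ σ t m' m, fun z => scatInv q₀ z (scatMatrix q₀ σ t m' m z),
    fun z h0 h1 h2 => ?_,
    ⟨hI'.zero_zero, (hI'.row 1 n1).trans inv_sq_isBigO_inv, (hI'.row 2 n2).trans inv_sq_isBigO_inv,
      hI'.col 1 n1, c11 ▸ hI'.block 1 n1 1 n1, c21 ▸ hI'.block 1 n1 2 n2, hI'.col 2 n2,
      c12 ▸ hI'.block 2 n2 1 n1, c22 ▸ hI'.block 2 n2 2 n2⟩,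
    ⟨hI.zero_zero, (hI.row 1 n1).trans inv_sq_isBigO_inv, (hI.row 2 n2).trans inv_sq_isBigO_inv,
      hI.col 1 n1, e11 ▸ hI.block 1 n1 1 n1, e12 ▸ hI.block 1 n1 2 n2, hI.col 2 n2,
      e21 ▸ hI.block 2 n2 1 n1, e22 ▸ hI.block 2 n2 2 n2⟩,
    hS0, hH0,
    -- The continuations of `s₁₁`, `s₃₃` are the Schwarz reflections of those of `h₁₁`, `h₃₃`.
    fun z => conj (colPair q₀ m' m 0 0 (conj z)), fun z => conj (colPair q₀ m' m 2 2 (conj z)),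
    colPair q₀ m' m 0 0, colPair q₀ m' m 2 2,
    hz11.conj (fun z => conj_mem_upperHalf) fun z hz => scatInv_apply_self hz _ 0,
    hz33.conj (fun z => conj_mem_lowerHalf) fun z hz => scatInv_apply_self hz _ 2,
    hz11, hz33,
    hl.conj (fun z => conj_mem_upperHalf) (map_one _) c22,
    hl'.conj (fun z => conj_mem_lowerHalf) c22 (map_one _), e22 ▸ hl, e22 ▸ hl'⟩
  have hz := ofReal_mem_regularSet h0 h1 h2
  exact ⟨hH z hz, fun H' h' => h'.eq hq₀ hqm hqp hz (hH z hz), mul_eq_one_comm.1 (hS z hz), hS z hz⟩
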